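/- Let $n\ge 1$, let $\tilde B\subset\mathbb C$ be a finite set with $0\in\tilde B$ and $\#\tilde B=r+1$, let $\phi_n:\mathbb C\to\mathbb C$, $\phi_n(t)=t^n$, put $\tilde B_n:=\phi_n^{-1}(\tilde B)$, and choose $t_{0,n}\in\mathbb C\setminus\tilde B_n$ and $t_0:=t_{0,n}^{\,n}\in\mathbb C\setminus\tilde B$. Conventions. In fundamental groups, $a\cdot b$ means: first $a$, then $b$; and $a^b:=b^{-1}ab$. Let $A\subset\mathbb C$ be finite with $k$ points and $x_0\in\mathbb C\setminus A$. An ordered geometric basis of $\pi_1(\mathbb C\setminus A;x_0)$ is a tuple $(\mu_1,\dots,\mu_k)$ obtained as follows. Order the points of $A$ as $x_1,\dots,x_k$. Choose simple segments $A_i$ from $x_i$ to $x_{i+1}$ ($0\le i<k$) with $A_i\cap A_{i+1}=\{x_{i+1}\}$ and all other intersections empty. Choose small closed topological disks $\Delta_i$ around the $x_i$ ($1\le i\le k$) that $A_{i-1}\cup A_i$ meets in a diameter from $x_i^-\in A_{i-1}$ to $x_i^+\in A_i$ (for $i=k$, in a radius ending at $x_k^-\in A_{k-1}$). Then $\mu_i:=\alpha_i\cdot\beta_i\cdot\alpha_i^{-1}$,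 where $\alpha_i$ runs from $x_0$ to $x_i^-$ along $A_0\cup\dots\cup A_{i-1}$, except that for each $j<i$ it goes counterclockwise along $\partial\Delta_j$ from $x_j^-$ to $x_j^+$, and $\beta_i$ runs once counterclockwise along $\partial\Delta_i$. A meridian of $a\in A$ is the class of a loop $\alpha\cdot\beta\cdot\alpha^{-1}$ where $\beta$ is a small circle around $a$, run once counterclockwise, whose closed disk contains no other point of $A$, and $\alpha$ is a path in $\mathbb C\setminus A$ from $x_0$ to that circle. Claim. Let $(\gamma_1,\dots,\gamma_{r+1})$ be an ordered geometric basis of $\pi_1(\mathbb C\setminus\tilde B;t_0)$ such that $\gamma_{r+1}$ is a meridian of $0$. Then $(\phi_n)_*:\pi_1(\mathbb C\setminus\tilde B_n;t_{0,n})\to\pi_1(\mathbb C\setminus\tilde B;t_0)$ is injective, the elements of the ordered list $$(v_0,v_1,\dots,v_{n-1},\gamma_{r+1}^{\,n}),\qquad v_j:=\bigl(\gamma_1^{\gamma_{r+1}^{j}},\dots,\gamma_r^{\gamma_{r+1}^{j}}\bigr),$$ of length $nr+1$ lie in its image, and their preimages under $(\phi_n)_*$, in this order, form an ordered geometric basis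 of $\pi_1(\mathbb C\setminus\tilde B_n;t_{0,n})$. -/

import Mathlib

noncomputable section

namespace GeomBasis

/-- The fundamental group `π₁(ℂ ∖ A; x₀)`, with the product "first the left factor, then the right
one". Mathlib's `FundamentalGroup` multiplies loops in the other order (`p * q` runs along `q`
first), hence the opposite group. -/
abbrev PiOne (A : Set ℂ) (x₀ : (Aᶜ : Set ℂ)) : Type :=
  (FundamentalGroup (Aᶜ : Set ℂ) x₀)ᵐᵒᵖ

/-- The class of a loop in `π₁(ℂ ∖ A; x₀)`. -/
def loopClass {A : Set ℂ} {x₀ : (Aᶜ : Set ℂ)} (p : Path x₀ x₀) : PiOne A x₀ :=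
  MulOpposite.op (FundamentalGroup.fromPath (Path.Homotopic.Quotient.mk p))

/-- The product in `PiOne` is concatenation from left to right. -/
theorem loopClass_mul {A : Set ℂ} {x₀ : (Aᶜ : Set ℂ)} (p q : Path x₀ x₀) :
    loopClass p * loopClass q = loopClass (p.trans q) := rfl

/-- `a ^ b = b⁻¹ a b`. -/
def conjBy {G : Type*} [Group G] (a b : G) : G := b⁻¹ * a * b

/-- The arc of the circle of centre `c` and radius `ρ` from angle `a` to angle `b`;
it runs counterclockwise if `a < b`. -/
def arc (c : ℂ) (ρ a b : ℝ) : Path (circleMap c ρ a) (circleMap c ρ b) where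
  toFun t := circleMap c ρ (a + (t : ℝ) * (b - a))
  continuous_toFun := by
    have := continuous_circleMap c ρ
    fun_prop
  source' := by simp
  target' := by simp

/-- The whole circle of centre `c` and radius `ρ`, run once counterclockwise from its leftmost
point `c - ρ`. -/
def circleLoop (c : ℂ) (ρ : ℝ) : Path (circleMap c ρ Real.pi) (circleMap c ρ Real.pi) :=
  (arc c ρ Real.pi (Real.pi + 2 * Real.pi)).cast rfl (periodic_circleMap c ρ Real.pi).symm

/-- The path, in the model configuration `0, 1, 2, …` on the real axis, from the base point `0` to
the point `(j + 1) - ε`: it runs along the real axis, but avoids the disk of radius `ε` around each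
`i ∈ {1, …, j}` by going counterclockwise along its boundary from `i - ε` to `i + ε`
(from angle `π` to angle `2π`). -/
def modelApproach (ε : ℝ) : (j : ℕ) → Path (0 : ℂ) (circleMap ((j + 1 : ℕ) : ℂ) ε Real.pi)
  | 0 => Path.segment _ _
  | j + 1 =>
    ((modelApproach ε j).trans (arc ((j + 1 : ℕ) : ℂ) ε Real.pi (2 * Real.pi))).trans
      (Path.segment _ _)

/-- The model loop `α · β · α⁻¹` around `j + 1`: `α` is `modelApproach ε j` and `β` is the
circle of radius `ε` around `j + 1`, run once counterclockwise. -/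
def modelLoop (ε : ℝ) (j : ℕ) : Path (0 : ℂ) 0 :=
  ((modelApproach ε j).trans (circleLoop ((j + 1 : ℕ) : ℂ) ε)).trans (modelApproach ε j).symm

/-- The closed curve `f` turns exactly once, counterclockwise, around `p`: its argument about `p`
increases by `2π`. -/
def TurnsOnceAround (f : unitInterval → ℂ) (p : ℂ) : Prop :=
  ∃ θ : unitInterval → ℝ, Continuous θ ∧
    (∀ t, f t - p = (‖f t - p‖ : ℂ) * Complex.exp ((θ t : ℂ) * Complex.I)) ∧
    θ 1 = θ 0 + 2 * Real.pi

/-- A diagram system for a set `A` of `k` points in the plane, together with an initial edge from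
the base point `x₀` and with small disks around the points of `A`.

The data consist of a topological embedding `emb` of a closed neighbourhood of the real segment
`[0, k]`, which sends `0` to `x₀` and `1, …, k` to the points `x₁, …, x_k` of `A`.
* The edges are the simple segments `A_i = emb [i, i + 1]`, for `0 ≤ i < k`. As `emb` is injective,
  `A_i` joins `x_i` to `x_{i+1}`, one has `A_i ∩ A_{i+1} = {x_{i+1}}`, and the other intersections
  are empty.
* The disk around `x_i` is the image of the round closed disk of radius `ε` around `i`;
  `A_{i-1} ∪ A_i` meets it in the image of the diameter from `i - ε` to `i + ε`
  (in that of the radius from `k - ε` to `k` if `i = k`).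
* `ccw` says that `emb` preserves the orientation: it sends the counterclockwise boundary of the
  round disk around `i` to the counterclockwise boundary of the disk around `x_i`. -/
structure DiagramSystem (A : Set ℂ) (x₀ : ℂ) (k : ℕ) where
  emb : ℂ → ℂ
  ε : ℝ
  ε_pos : 0 < ε
  ε_lt : ε < 1 / 2
  continuousOn : ContinuousOn emb (Metric.cthickening ε (segment ℝ (0 : ℂ) (k : ℂ)))
  injOn : Set.InjOn emb (Metric.cthickening ε (segment ℝ (0 : ℂ) (k : ℂ)))
  emb_zero : emb 0 = x₀
  range_points : Set.range (fun i : Fin k => emb (((i : ℕ) + 1 : ℕ) : ℂ)) = A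
  ccw : ∀ i : Fin k,
    TurnsOnceAround (fun t => emb (circleLoop (((i : ℕ) + 1 : ℕ) : ℂ) ε t))
      (emb (((i : ℕ) + 1 : ℕ) : ℂ))

/-- `(μ 0, …, μ (k - 1))` is an ordered geometric basis of `π₁(ℂ ∖ A; x₀)`: there is a diagram
system such that each `μ i` is the class of the loop that goes from `x₀` along the edges, avoiding
the disks around the preceding points counterclockwise, to the disk around the point of index
`i + 1`, turns once counterclockwise along its boundary, and returns the same way. -/
def IsGeometricBasis {A : Set ℂ} {x₀ : (Aᶜ : Set ℂ)} {k : ℕ} (μ : Fin k → PiOne A x₀) : Prop :=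
  ∃ D : DiagramSystem A (x₀ : ℂ) k, ∀ i : Fin k,
    ∃ p : Path x₀ x₀, (∀ t, (p t : ℂ) = D.emb (modelLoop D.ε i t)) ∧ μ i = loopClass p

/-- `g` is a meridian of the point `a ∈ A` in `π₁(ℂ ∖ A; x₀)`: it is the class of a loop
`α · β · α⁻¹`, where `β` is a small circle around `a`, run once counterclockwise, whose closed disk
contains no other point of `A`, and `α` is a path in `ℂ ∖ A` from `x₀` to that circle. -/
def IsMeridian {A : Set ℂ} {x₀ : (Aᶜ : Set ℂ)} (a : ℂ) (g : PiOne A x₀) : Prop :=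
  a ∈ A ∧ ∃ ρ : ℝ, 0 < ρ ∧ Metric.closedBall a ρ ∩ A ⊆ {a} ∧
    ∃ (q : (Aᶜ : Set ℂ)) (α : Path x₀ q) (β : Path q q),
      (∀ t, (β t : ℂ) = circleLoop a ρ t) ∧ g = loopClass ((α.trans β).trans α.symm)

/-- The preimage `φ_n⁻¹(A)` under `φ_n(t) = t ^ n`. -/
def powPreimage (n : ℕ) (A : Set ℂ) : Set ℂ := (fun t : ℂ => t ^ n) ⁻¹' A

/-- The map `ℂ ∖ φ_n⁻¹(A) → ℂ ∖ A` given by `φ_n(t) = t ^ n`. -/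
def powMap (n : ℕ) (A : Set ℂ) : C(((powPreimage n A)ᶜ : Set ℂ), (Aᶜ : Set ℂ)) where
  toFun t := ⟨(t : ℂ) ^ n, t.2⟩
  continuous_toFun := by fun_prop

/-- The homomorphism `(φ_n)_* : π₁(ℂ ∖ φ_n⁻¹(A); s) → π₁(ℂ ∖ A; s ^ n)`. -/
def powHom (n : ℕ) (A : Set ℂ) (s : ((powPreimage n A)ᶜ : Set ℂ)) :
    PiOne (powPreimage n A) s →* PiOne A (powMap n A s) :=
  MonoidHom.op (FundamentalGroup.map (powMap n A) s)

end GeomBasis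

end

noncomputable section

namespace GeomBasis

/-! ### Fundamental groups -/

section FundamentalGroupOp

variable {X Y Z : Type*} [TopologicalSpace X] [TopologicalSpace Y] [TopologicalSpace Z]

/-! Everything is transported to a model. The given diagram is the image of the segment `[0, r + 1]`
with marked points `1, …, r + 1`; squeezing the plane into the stadium around this segment extends
the embedding to an injective continuous map `D.plane` of the whole plane. The last marked point
goes to `0` (`emb_last_eq_zero`): the meridian `γ_{r+1}` is nontrivial in the fundamental group of
the plane without `0`, while a loop of the diagram around any other point bounds a disk that misses
`0`.

Put `F u = D.plane (r + 1 - u)`. It is injective, fixes `0` and turns once around `0`, so `F u = u *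
exp (h u)`. Hence `Φ w = ω * w * exp (h (w ^ n) / n)`, with a suitable root of unity `ω`, is an
injective continuous map with `Φ w ^ n = F (w ^ n)` (`exists_root_map`). This reduces the covering
to the explicit one `w ↦ r + 1 - w ^ n`. There the preimage of the segment is a star of `n` rays
(the sheets), each with `r` marked points, and centre `0`.

The new diagram is a `snake`: an embedded stadium whose axis starts at the tip of one ray, runs
inward past its `r` points, then moves outward and clockwise to the first point of the next ray, and
so on; after the last ray it ends in the centre. The marked point `j * r + i` of the snake is the
point `i` of the ray `j`. Composing with `Φ` gives a diagram system for the preimage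
(`exists_cover_diagram`). Its points are exactly the preimages because `Φ` commutes with the roots
of unity, and its orientation is checked at the centre and carried along the axis by homotopy.

It remains to push the loops of the snake forward by `theta`. Let `G m` be the class of the loop
that goes to the gap `m` of the real axis through the lower half plane and returns through the upper
one. The lower half plane contains all approach paths, so the model generator around `i + 1` is `G
(i + 1) * (G i)⁻¹` (`cls_modelLoop`). The same formula holds on the snake, so it suffices to know
the images of its gap classes. Every change of ray is a clockwise turn about `r + 1` in the base.
Along the lower edge of the snake it contributes `G r * (G (r + 1))⁻¹ = γ_{r+1}⁻¹`; along the upper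
edge it contributes `(G (r + 1))⁻¹`. The gap class after the point `i` of the ray `j` therefore maps
to `γ_{r+1} ^ (-j) * G i * G (r + 1) ^ j` (`exists_snake_gapClass`). In the quotient of consecutive
gap classes the right factors cancel and the conjugate by `γ_{r+1} ^ j` remains. The small circle
around the centre covers the one around `r + 1` exactly `n` times, which gives `γ_{r+1} ^ n`.
Injectivity is that of a covering map. -/

/-- The fundamental group with the product "first the left factor, then the right one". -/
abbrev LeftPi (X : Type*) [TopologicalSpace X] (x : X) : Type _ := (FundamentalGroup X x)ᵐᵒᵖ

/-- The class of a loop. -/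
def cls {x : X} (p : Path x x) : LeftPi X x :=
  MulOpposite.op (FundamentalGroup.fromPath (Path.Homotopic.Quotient.mk p))

theorem cls_eq_iff {x : X} {p q : Path x x} : cls p = cls q ↔ p.Homotopic q := by
  rw [← Path.Homotopic.Quotient.eq]
  exact MulOpposite.op_injective.eq_iff

theorem exists_cls_eq {x : X} (g : LeftPi X x) : ∃ p : Path x x, cls p = g := by
  obtain ⟨p, hp⟩ := Path.Homotopic.Quotient.mk_surjective (FundamentalGroup.toPath g.unop)
  exact ⟨p, congrArg MulOpposite.op hp⟩

theorem cls_trans {x : X} (p q : Path x x) : cls (p.trans q) = cls p * cls q := rfl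

/-- The homomorphism of fundamental groups induced by a continuous map. -/
def push (f : C(X, Y)) {x : X} {y : Y} (h : f x = y) : LeftPi X x →* LeftPi Y y :=
  MonoidHom.op (FundamentalGroup.mapOfEq f h)

theorem push_cls (f : C(X, Y)) {x : X} {y : Y} (h : f x = y) (p : Path x x) :
    push f h (cls p) = cls ((p.map f.continuous).cast h.symm h.symm) := by
  exact congrArg MulOpposite.op (FundamentalGroup.mapOfEq_apply f h _)

theorem push_eq_cls (f : C(X, Y)) {x : X} {y : Y} (h : f x = y) (p : Path x x) (q : Path y y)
    (hq : ∀ t, q t = f (p t)) : push f h (cls p) = cls q := by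
  rw [push_cls]
  congr 1
  ext t
  simp [hq]

theorem push_push (f : C(X, Y)) (f' : C(Y, Z)) {x : X} {y : Y} {z : Z} (h : f x = y)
    (h' : f' y = z) (g : LeftPi X x) :
    push f' h' (push f h g) = push (f'.comp f) (by simp [h, h']) g := by
  obtain ⟨p, rfl⟩ := exists_cls_eq g
  rw [push_cls, push_cls, push_cls]
  rfl

/-- The class of the loop `c · p · d⁻¹`. -/
def hol {x a b : X} (c : Path x a) (p : Path a b) (d : Path x b) : LeftPi X x :=
  cls ((c.trans p).trans d.symm)

theorem hol_congr {x a b : X} {c c' : Path x a} {p p' : Path a b} {d d' : Path x b}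
    (hc : c.Homotopic c') (hp : p.Homotopic p') (hd : d.Homotopic d') :
    hol c p d = hol c' p' d' :=
  cls_eq_iff.2 ((hc.hcomp hp).hcomp hd.symm₂)

/-- The return along `d` cancels the new departure along `d`, so such classes telescope. -/
theorem hol_mul {x a b e : X} (c : Path x a) (p : Path a b) (d : Path x b) (q : Path b e)
    (f : Path x e) : hol c p d * hol d q f = hol c (p.trans q) f := by
  unfold hol
  rw [← cls_trans, cls_eq_iff, ← Path.Homotopic.Quotient.eq]
  simp only [Path.Homotopic.Quotient.mk_trans, Path.Homotopic.Quotient.mk_symm, Path.Homotopic.Quotient.trans_assoc]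
  rw [← Path.Homotopic.Quotient.trans_assoc (Path.Homotopic.Quotient.symm (Path.Homotopic.Quotient.mk d)), Path.Homotopic.Quotient.symm_trans,
    Path.Homotopic.Quotient.refl_trans]

theorem hol_eq_one {x a b : X} {c : Path x a} {p : Path a b} {d : Path x b}
    (h : (c.trans p).Homotopic d) : hol c p d = 1 := by
  have : (1 : LeftPi X x) = cls (Path.refl x) := rfl
  unfold hol
  rw [this, cls_eq_iff, ← Path.Homotopic.Quotient.eq, Path.Homotopic.Quotient.mk_trans, Path.Homotopic.Quotient.eq.2 h, ← Path.Homotopic.Quotient.mk_trans,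
    Path.Homotopic.Quotient.eq]
  exact ⟨(Path.Homotopy.reflTransSymm d).symm⟩

theorem hol_refl_self {x a : X} (c : Path x a) : hol c (Path.refl a) c = 1 :=
  hol_eq_one ⟨Path.Homotopy.transRefl c⟩

theorem hol_symm {x a b : X} (c : Path x a) (p : Path a b) (d : Path x b) :
    hol d p.symm c = (hol c p d)⁻¹ := by
  rw [eq_inv_iff_mul_eq_one, hol_mul, ← hol_refl_self d]
  exact hol_congr (.refl _) ⟨(Path.Homotopy.reflSymmTrans p).symm⟩ (.refl _)

theorem hol_refl_symm {x a : X} (c d : Path x a) :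
    hol d (Path.refl a) c = (hol c (Path.refl a) d)⁻¹ := by
  rw [← hol_symm, Path.refl_symm]

theorem hol_refl_refl {x : X} (p : Path x x) : hol (Path.refl x) p (Path.refl x) = cls p := by
  unfold hol
  rw [cls_eq_iff, ← Path.Homotopic.Quotient.eq]
  simp only [Path.Homotopic.Quotient.mk_trans, Path.refl_symm, Path.Homotopic.Quotient.mk_refl, Path.Homotopic.Quotient.trans_refl,
    Path.Homotopic.Quotient.refl_trans]

theorem push_hol (f : C(X, Y)) {x a b : X} {y : Y} (h : f x = y) (c : Path x a) (p : Path a b)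
    (d : Path x b) :
    push f h (hol c p d) = hol ((c.map f.continuous).cast h.symm rfl) (p.map f.continuous)
      ((d.map f.continuous).cast h.symm rfl) := by
  subst h
  unfold hol
  rw [push_cls, cls_eq_iff, ← Path.Homotopic.Quotient.eq]
  congr 1
  ext t
  simp [Path.map_trans, Path.map_symm]

end FundamentalGroupOp

/-! ### Paths in simply connected subsets -/

section SimplyConnectedSets

variable {X : Type*} [TopologicalSpace X]

theorem _root_.IsSimplyConnected.path_homotopic {K : Set X} (hK : IsSimplyConnected K) {a b : X}
    {p q : Path a b} (hp : ∀ t, p t ∈ K) (hq : ∀ t, q t ∈ K) : p.Homotopic q := by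
  have := hK.simplyConnectedSpace
  have ha : a ∈ K := by simpa using hp 0
  have hb : b ∈ K := by simpa using hp 1
  let p' : Path (⟨a, ha⟩ : K) ⟨b, hb⟩ := ⟨⟨fun t => ⟨p t, hp t⟩, by fun_prop⟩, by simp, by simp⟩
  let q' : Path (⟨a, ha⟩ : K) ⟨b, hb⟩ := ⟨⟨fun t => ⟨q t, hq t⟩, by fun_prop⟩, by simp, by simp⟩
  have h := (SimplyConnectedSpace.paths_homotopic p' q').map
    (⟨Subtype.val, continuous_subtype_val⟩ : C(K, X))
  exact h

theorem _root_.IsSimplyConnected.exists_path {K : Set X} (hK : IsSimplyConnected K) {a b : X}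
    (ha : a ∈ K) (hb : b ∈ K) : ∃ p : Path a b, ∀ t, p t ∈ K :=
  hK.isPathConnected.joinedIn a ha b hb

end SimplyConnectedSets

theorem trans_mem {X : Type*} [TopologicalSpace X] {K : Set X} {a b c : X} {p : Path a b}
    {q : Path b c} (hp : ∀ t, p t ∈ K) (hq : ∀ t, q t ∈ K) (t : unitInterval) :
    p.trans q t ∈ K := by
  have : p.trans q t ∈ Set.range (p.trans q) := ⟨t, rfl⟩
  rw [Path.trans_range] at this
  rcases this with ⟨s, hs⟩ | ⟨s, hs⟩
  · exact hs ▸ hp s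
  · exact hs ▸ hq s

theorem symm_mem {X : Type*} [TopologicalSpace X] {K : Set X} {a b : X} {p : Path a b}
    (hp : ∀ t, p t ∈ K) (t : unitInterval) : p.symm t ∈ K := by
  simpa using hp _

/-- A space with two simply connected subsets, "lower" and "upper", which contain the base
point. -/
structure Bigon {X : Type*} [TopologicalSpace X] (x₀ : X) (L U : Set X) : Prop where
  lower : IsSimplyConnected L
  upper : IsSimplyConnected U
  mem_lower : x₀ ∈ L
  mem_upper : x₀ ∈ U

/-- `g` is the class of a loop that goes to `a` through `L` and returns through `U`. -/
def IsBigonClass {X : Type*} [TopologicalSpace X] (x₀ : X) (L U : Set X) (a : X)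
    (g : LeftPi X x₀) : Prop :=
  ∃ c d : Path x₀ a, (∀ t, c t ∈ L) ∧ (∀ t, d t ∈ U) ∧ g = hol c (Path.refl a) d

/-- `g` is the class of a loop that runs through `L` to the source of `p`, then along `p`, and
returns through `L`. -/
def IsHolonomy {X : Type*} [TopologicalSpace X] (x₀ : X) (L : Set X) {a b : X} (p : Path a b)
    (g : LeftPi X x₀) : Prop :=
  ∃ (c : Path x₀ a) (d : Path x₀ b), (∀ t, c t ∈ L) ∧ (∀ t, d t ∈ L) ∧ g = hol c p d

/-! ### Calculus of classes for a lower and an upper simply connected set -/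

namespace Bigon

variable {X : Type*} [TopologicalSpace X] {x₀ : X} {L U : Set X}

theorem exists_bigonClass (B : Bigon x₀ L U) {a : X} (hL : a ∈ L) (hU : a ∈ U) :
    ∃ g, IsBigonClass x₀ L U a g := by
  obtain ⟨c, hc⟩ := B.lower.exists_path B.mem_lower hL
  obtain ⟨d, hd⟩ := B.upper.exists_path B.mem_upper hU
  exact ⟨_, c, d, hc, hd, rfl⟩

/-- Simple connectedness makes the choice of the two paths irrelevant; hence a class depends only on
the end point. -/
theorem bigonClass_unique (B : Bigon x₀ L U) {a : X} {g g' : LeftPi X x₀}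
    (h : IsBigonClass x₀ L U a g) (h' : IsBigonClass x₀ L U a g') : g = g' := by
  obtain ⟨c, d, hc, hd, rfl⟩ := h
  obtain ⟨c', d', hc', hd', rfl⟩ := h'
  exact hol_congr (B.lower.path_homotopic hc hc') (.refl _) (B.upper.path_homotopic hd hd')

theorem bigonClass_base (B : Bigon x₀ L U) : IsBigonClass x₀ L U x₀ 1 :=
  ⟨Path.refl _, Path.refl _, fun _ => B.mem_lower, fun _ => B.mem_upper,
    (hol_refl_self _).symm⟩

theorem bigonClass_of_path {a b : X} {g : LeftPi X x₀} (h : IsBigonClass x₀ L U a g)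
    (p : Path a b) (hL : ∀ t, p t ∈ L) (hU : ∀ t, p t ∈ U) : IsBigonClass x₀ L U b g := by
  obtain ⟨c, d, hc, hd, rfl⟩ := h
  refine ⟨c.trans p, d.trans p, trans_mem hc hL, trans_mem hd hU, ?_⟩
  unfold hol
  rw [cls_eq_iff, ← Path.Homotopic.Quotient.eq]
  simp only [Path.Homotopic.Quotient.mk_trans, Path.Homotopic.Quotient.mk_symm, Path.Homotopic.Quotient.trans_assoc, Path.Homotopic.Quotient.mk_refl,
    Path.Homotopic.Quotient.trans_refl, Path.trans_symm]
  rw [← Path.Homotopic.Quotient.trans_assoc (Path.Homotopic.Quotient.mk p), Path.Homotopic.Quotient.trans_symm, Path.Homotopic.Quotient.refl_trans]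

theorem holonomy_trans (B : Bigon x₀ L U) {a b e : X} {p : Path a b} {q : Path b e}
    {g g' : LeftPi X x₀} (h : IsHolonomy x₀ L p g) (h' : IsHolonomy x₀ L q g') :
    IsHolonomy x₀ L (p.trans q) (g * g') := by
  obtain ⟨c, d, hc, hd, rfl⟩ := h
  obtain ⟨c', d', hc', hd', rfl⟩ := h'
  refine ⟨c, d', hc, hd', ?_⟩
  rw [← hol_mul c p d q d', hol_congr (B.lower.path_homotopic hc' hd) (.refl q) (.refl d')]

theorem holonomy_homotopic {a b : X} {p q : Path a b} {g : LeftPi X x₀}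
    (h : IsHolonomy x₀ L p g) (hpq : p.Homotopic q) : IsHolonomy x₀ L q g := by
  obtain ⟨c, d, hc, hd, rfl⟩ := h
  exact ⟨c, d, hc, hd, hol_congr (.refl _) hpq (.refl _)⟩

theorem holonomy_lower (B : Bigon x₀ L U) {a b : X} {p : Path a b} (hp : ∀ t, p t ∈ L) :
    IsHolonomy x₀ L p 1 := by
  obtain ⟨c, hc⟩ := B.lower.exists_path B.mem_lower (show a ∈ L by simpa using hp 0)
  exact ⟨c, c.trans p, hc, trans_mem hc hp, (hol_eq_one (.refl _)).symm⟩

/-- Closing `p` up through `U` on both sides gives a trivial loop. Replacing these closing paths by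
paths in `L` costs the two bigon classes. -/
theorem holonomy_upper (B : Bigon x₀ L U) {a b : X} {p : Path a b} (hp : ∀ t, p t ∈ U)
    {g g' : LeftPi X x₀} (h : IsBigonClass x₀ L U a g) (h' : IsBigonClass x₀ L U b g') :
    IsHolonomy x₀ L p (g * g'⁻¹) := by
  obtain ⟨c, d, hc, hd, rfl⟩ := h
  obtain ⟨c', d', hc', hd', rfl⟩ := h'
  refine ⟨c, c', hc, hc', ?_⟩
  have h1 : hol d p d' = 1 := hol_eq_one (B.upper.path_homotopic (trans_mem hd hp) hd')
  rw [← hol_refl_symm c' d', ← mul_one (hol c _ d), ← h1, hol_mul, hol_mul]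
  refine hol_congr (.refl _) ?_ (.refl _)
  rw [← Path.Homotopic.Quotient.eq]
  simp

theorem holonomy_loop (B : Bigon x₀ L U) {p : Path x₀ x₀} {g : LeftPi X x₀}
    (h : IsHolonomy x₀ L p g) : g = cls p := by
  obtain ⟨c, d, hc, hd, rfl⟩ := h
  rw [← hol_refl_refl]
  exact hol_congr (B.lower.path_homotopic hc fun _ => B.mem_lower) (.refl _)
    (B.lower.path_homotopic hd fun _ => B.mem_lower)

theorem holonomy_symm {a b : X} {p : Path a b} {g : LeftPi X x₀} (h : IsHolonomy x₀ L p g) :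
    IsHolonomy x₀ L p.symm g⁻¹ := by
  obtain ⟨c, d, hc, hd, rfl⟩ := h
  exact ⟨d, c, hd, hc, (hol_symm c p d).symm⟩

/-- Only the arc `q₂` leaves `L`, so it alone contributes. This is the source of the formula `G (i +
1) * (G i)⁻¹` for a generator. -/
theorem cls_loop_around (B : Bigon x₀ L U) {a b : X} {p : Path x₀ a} {q₁ : Path a b}
    {q₂ : Path b a} (hp : ∀ t, p t ∈ L) (h₁ : ∀ t, q₁ t ∈ L) (h₂ : ∀ t, q₂ t ∈ U)
    {g g' : LeftPi X x₀} (h : IsBigonClass x₀ L U a g) (h' : IsBigonClass x₀ L U b g') :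
    cls ((p.trans (q₁.trans q₂)).trans p.symm) = g' * g⁻¹ := by
  have := B.holonomy_trans (B.holonomy_trans (B.holonomy_lower hp) (B.holonomy_trans
    (B.holonomy_lower h₁) (B.holonomy_upper h₂ h' h))) (B.holonomy_lower (symm_mem hp))
  rw [← B.holonomy_loop this]
  simp

end Bigon

theorem IsBigonClass.push {X Y : Type*} [TopologicalSpace X] [TopologicalSpace Y] {x₀ : X} {y₀ : Y}
    {L U : Set X} {L' U' : Set Y} {f : C(X, Y)} (h0 : f x₀ = y₀) (hL : Set.MapsTo f L L')
    (hU : Set.MapsTo f U U') {a : X} {g : LeftPi X x₀} (h : IsBigonClass x₀ L U a g) :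
    IsBigonClass y₀ L' U' (f a) (GeomBasis.push f h0 g) := by
  obtain ⟨c, d, hc, hd, rfl⟩ := h
  refine ⟨(c.map f.continuous).cast h0.symm rfl, (d.map f.continuous).cast h0.symm rfl,
    fun t => hL (hc t), fun t => hU (hd t), ?_⟩
  rw [push_hol]
  rfl

/-! ### Punctured convex sets -/

/-- The points `1, …, k` of the plane. -/
def marked (k : ℕ) : Set ℂ := Set.range fun i : Fin k => (((i : ℕ) + 1 : ℕ) : ℂ)

theorem mem_marked {k : ℕ} {z : ℂ} : z ∈ marked k ↔ ∃ j : ℕ, 1 ≤ j ∧ j ≤ k ∧ z = j := by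
  constructor
  · rintro ⟨i, rfl⟩
    exact ⟨i + 1, by omega, by omega, rfl⟩
  · rintro ⟨j, h1, h2, rfl⟩
    exact ⟨⟨j - 1, by omega⟩, by simp [Nat.sub_add_cancel h1]⟩

theorem zero_notMem_marked (k : ℕ) : (0 : ℂ) ∉ marked k := by
  rw [mem_marked]
  rintro ⟨j, h1, -, h⟩
  have : j = 0 := by exact_mod_cast h.symm
  omega

theorem notMem_marked_of_im_ne {k : ℕ} {z : ℂ} (h : z.im ≠ 0) : z ∉ marked k := by
  rw [mem_marked]
  rintro ⟨j, -, -, rfl⟩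
  simp at h

theorem notMem_marked_of_norm_sub {k i : ℕ} {z : ℂ} (h0 : 0 < ‖z - i‖) (h1 : ‖z - i‖ < 1) :
    z ∉ marked k := by
  rw [mem_marked]
  rintro ⟨j, -, -, rfl⟩
  have h2 : ((j : ℂ) - i) = ((j - i : ℤ) : ℂ) := by push_cast; ring
  rw [h2, Complex.norm_intCast] at h0 h1
  have h3 : |(j : ℤ) - i| < 1 := by exact_mod_cast h1
  have h4 : 0 < |(j : ℤ) - i| := by exact_mod_cast h0
  omega

/-- `x` lies in the gap number `m` of the line with the points `1, …, k` removed. -/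
def InGap (k m : ℕ) (x : ℝ) : Prop := (m = 0 ∨ (m : ℝ) < x) ∧ (k ≤ m ∨ x < m + 1)

theorem InGap.notMem {k m : ℕ} {x : ℝ} (h : InGap k m x) : (x : ℂ) ∉ marked k := by
  rw [mem_marked]
  rintro ⟨j, h1, h2, h3⟩
  have h3 : x = j := by exact_mod_cast h3
  subst h3
  obtain ⟨ha, hb⟩ := h
  have ha : m = 0 ∨ m < j := ha.imp_right fun h => by exact_mod_cast h
  have hb : k ≤ m ∨ j < m + 1 := hb.imp_right fun h => by exact_mod_cast h
  omega

theorem InGap.lineMap {k m : ℕ} {x y : ℝ} (hx : InGap k m x) (hy : InGap k m y) {t : ℝ}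
    (h0 : 0 ≤ t) (h1 : t ≤ 1) : InGap k m ((1 - t) * x + t * y) := by
  constructor
  · rcases hx.1 with h | h
    · exact .inl h
    rcases hy.1 with h' | h'
    · exact .inl h'
    right
    nlinarith [mul_le_mul_of_nonneg_left (min_le_left x y) (sub_nonneg.2 h1),
      mul_le_mul_of_nonneg_left (min_le_right x y) h0, lt_min h h']
  · rcases hx.2 with h | h
    · exact .inl h
    rcases hy.2 with h' | h'
    · exact .inl h'
    right
    nlinarith [mul_le_mul_of_nonneg_left (le_max_left x y) (sub_nonneg.2 h1),
      mul_le_mul_of_nonneg_left (le_max_right x y) h0, max_lt h h']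

/-- The points of `M` in the closed lower half plane. -/
def lowerPart (M : Set ℂ) : Set M := {z | (z : ℂ).im ≤ 0}

/-- The points of `M` in the closed upper half plane. -/
def upperPart (M : Set ℂ) : Set M := {z | 0 ≤ (z : ℂ).im}

/-- The set is star-shaped about a point `c` off the axis: a segment from `c` to a point of the
closed half plane can meet the real axis only at its end. The sign `s` treats both half planes at
once. -/
theorem isSimplyConnected_part {V : Set ℂ} (hV : Convex ℝ V) {k : ℕ} {s : ℝ} (c : ℂ)
    (hcV : c ∈ V) (hc : 0 < s * c.im) :
    IsSimplyConnected {z : ↥(V \ marked k) | 0 ≤ s * (z : ℂ).im} := by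
  rw [← Topology.IsEmbedding.subtypeVal.isSimplyConnected_image]
  have hstar : StarConvex ℝ c
      (Subtype.val '' {z : ↥(V \ marked k) | 0 ≤ s * (z : ℂ).im}) := by
    rintro _ ⟨⟨z, hzV, hzP⟩, hz, rfl⟩ a b ha hb hab
    rcases ha.eq_or_lt with rfl | ha
    · obtain rfl : b = 1 := by linarith
      exact ⟨⟨z, hzV, hzP⟩, hz, by simp⟩
    · have him : 0 < s * (a • c + b • z).im := by
        simp only [Complex.real_smul, Complex.add_im, Complex.im_ofReal_mul]
        have : 0 ≤ s * z.im := hz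
        nlinarith [mul_pos ha hc, mul_nonneg hb this]
      have hne : (a • c + b • z).im ≠ 0 := fun h => by
        rw [h, mul_zero] at him
        exact lt_irrefl _ him
      exact ⟨⟨a • c + b • z, hV hcV hzV ha.le hb hab, notMem_marked_of_im_ne hne⟩, him.le, rfl⟩
  have hne : c.im ≠ 0 := fun h => by simp [h] at hc
  have := hstar.contractibleSpace ⟨c, ⟨c, hcV, notMem_marked_of_im_ne hne⟩, hc.le, rfl⟩
  exact inferInstanceAs (SimplyConnectedSpace _)

theorem bigon_punctured {V : Set ℂ} (hV : Convex ℝ V) {k : ℕ} {c d : ℂ} (hc : c ∈ V)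
    (hd : d ∈ V) (hc' : c.im < 0) (hd' : 0 < d.im) (h0 : (0 : ℂ) ∈ V \ marked k) :
    Bigon (⟨0, h0⟩ : ↥(V \ marked k)) (lowerPart _) (upperPart _) where
  lower := by
    have := isSimplyConnected_part (k := k) (s := -1) hV c hc (by linarith)
    convert this using 2
    ext z
    simp [lowerPart]
  upper := by
    have := isSimplyConnected_part (k := k) (s := 1) hV d hd (by linarith)
    convert this using 2
    ext z
    simp [upperPart]
  mem_lower := by simp [lowerPart]
  mem_upper := by simp [upperPart]

/-- A path with values in a set, as a path of the subtype. -/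
def _root_.Path.codRestrict {X : Type*} [TopologicalSpace X] {M : Set X} {a b : X} (p : Path a b)
    (h : ∀ t, p t ∈ M) :
    Path (⟨a, by simpa using h 0⟩ : M) ⟨b, by simpa using h 1⟩ where
  toFun t := ⟨p t, h t⟩
  continuous_toFun := by fun_prop
  source' := by simp
  target' := by simp

@[simp] theorem coe_codRestrict {X : Type*} [TopologicalSpace X] {M : Set X} {a b : X}
    (p : Path a b) (h : ∀ t, p t ∈ M) (t : unitInterval) : (p.codRestrict h t : X) = p t := rfl

/-- A gap is an interval of the real axis without marked points, so it lies in both half planes and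
a class may be moved along it. -/
theorem bigonClass_gap {V : Set ℂ} (hV : Convex ℝ V) {k m : ℕ} {x₀ a b : ↥(V \ marked k)}
    {x y : ℝ} (ha : (a : ℂ) = x) (hb : (b : ℂ) = y) (hx : InGap k m x) (hy : InGap k m y)
    {g : LeftPi _ x₀} (h : IsBigonClass x₀ (lowerPart _) (upperPart _) a g) :
    IsBigonClass x₀ (lowerPart _) (upperPart _) b g := by
  obtain ⟨a, haM⟩ := a
  obtain ⟨b, hbM⟩ := b
  obtain rfl : a = x := ha
  obtain rfl : b = y := hb
  have key : ∀ t : unitInterval, Path.segment (x : ℂ) y t =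
      (((1 - (t : ℝ)) * x + t * y : ℝ) : ℂ) := fun t => by
    simp [Path.segment_apply, AffineMap.lineMap_apply]
    ring
  have hmem : ∀ t, Path.segment (x : ℂ) y t ∈ V \ marked k := fun t => by
    refine ⟨?_, ?_⟩
    · have := hV haM.1 hbM.1 (sub_nonneg.2 t.2.2) t.2.1 (by ring : 1 - (t : ℝ) + t = 1)
      rw [key]
      convert this using 1
      simp
    · rw [key]
      exact (hx.lineMap hy t.2.1 t.2.2).notMem
  refine Bigon.bigonClass_of_path h ((Path.segment (x : ℂ) y).codRestrict hmem) ?_ ?_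
  · intro t
    simp [lowerPart, key, -Path.segment_apply]
  · intro t
    simp [upperPart, key, -Path.segment_apply]

/-! ### The model loops -/

/-- The path `t ↦ f (a + t (b - a))`. -/
def linePath {X : Type*} [TopologicalSpace X] (f : C(ℝ, X)) (a b : ℝ) : Path (f a) (f b) :=
  (Path.segment a b).map f.continuous

theorem linePath_apply {X : Type*} [TopologicalSpace X] (f : C(ℝ, X)) (a b : ℝ)
    (t : unitInterval) : linePath f a b t = f (a + t * (b - a)) := by
  simp [linePath, AffineMap.lineMap_apply, add_comm]

theorem linePath_trans {X : Type*} [TopologicalSpace X] (f : C(ℝ, X)) (a b c : ℝ) :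
    ((linePath f a b).trans (linePath f b c)).Homotopic (linePath f a c) := by
  rw [linePath, linePath, ← Path.map_trans]
  exact (SimplyConnectedSpace.paths_homotopic _ _).map f

theorem im_circleMap_ofReal (x ρ θ : ℝ) : (circleMap x ρ θ).im = ρ * Real.sin θ := by
  simp [circleMap, Complex.exp_ofReal_mul_I_im]

theorem circleMap_pi (c : ℂ) (ρ : ℝ) : circleMap c ρ Real.pi = c - ρ := by
  simp [circleMap, sub_eq_add_neg]

theorem circleMap_two_pi (c : ℂ) (ρ : ℝ) : circleMap c ρ (2 * Real.pi) = c + ρ := by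
  simp [circleMap]

theorem circleMap_notMem_marked {k i : ℕ} {ε : ℝ} (h0 : 0 < ε) (h1 : ε < 1 / 2) (θ : ℝ) :
    circleMap (i : ℂ) ε θ ∉ marked k := by
  have : ‖circleMap (i : ℂ) ε θ - i‖ = ε := by
    rw [circleMap_sub_center, norm_circleMap_zero, abs_of_pos h0]
  exact notMem_marked_of_norm_sub (i := i) (by rw [this]; exact h0) (by rw [this]; linarith)

section ModelLoop

variable {V : Set ℂ} {k : ℕ} {ε : ℝ}

theorem segment_mem_gap (hV : Convex ℝ V) {m : ℕ} {x y : ℝ} (hx : InGap k m x)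
    (hy : InGap k m y) (hxV : (x : ℂ) ∈ V) (hyV : (y : ℂ) ∈ V) (t : unitInterval) :
    Path.segment (x : ℂ) y t ∈ V \ marked k ∧ (Path.segment (x : ℂ) y t).im = 0 := by
  have key : Path.segment (x : ℂ) y t = (((1 - (t : ℝ)) * x + t * y : ℝ) : ℂ) := by
    simp [Path.segment_apply, AffineMap.lineMap_apply]
    ring
  have := hV hxV hyV (sub_nonneg.2 t.2.2) t.2.1 (by ring : 1 - (t : ℝ) + t = 1)
  rw [key]
  refine ⟨⟨?_, (hx.lineMap hy t.2.1 t.2.2).notMem⟩, by simp⟩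
  convert this using 1
  simp

/-- The detours run from angle `π` to `2π`, where the sine is nonpositive. This is why
counterclockwise avoidance means passing below. -/
theorem modelApproach_mem (hV : Convex ℝ V) (h0 : (0 : ℂ) ∈ V)
    (hball : ∀ i : ℕ, i < k → Metric.closedBall ((i + 1 : ℕ) : ℂ) ε ⊆ V) (hε : 0 < ε)
    (hε' : ε < 1 / 2) (j : ℕ) (hj : j < k) (t : unitInterval) :
    modelApproach ε j t ∈ V \ marked k ∧ (modelApproach ε j t).im ≤ 0 := by
  have hcirc : ∀ i < k, ∀ θ, circleMap ((i + 1 : ℕ) : ℂ) ε θ ∈ V := fun i hi θ =>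
    hball i hi (circleMap_mem_closedBall _ hε.le θ)
  induction j generalizing t with
  | zero =>
    have h1 := hcirc 0 hj Real.pi
    have e1 : circleMap ((0 + 1 : ℕ) : ℂ) ε Real.pi = ((1 - ε : ℝ) : ℂ) := by
      simp [circleMap_pi]
    have := segment_mem_gap (m := 0) (k := k) (x := 0) (y := 1 - ε) hV
      ⟨.inl rfl, .inr (by norm_num)⟩ ⟨.inl rfl, .inr (by simp [hε])⟩ (by simpa using h0)
      (by rw [← e1]; exact h1) t
    rw [← e1] at this
    simp only [Complex.ofReal_zero] at this
    exact ⟨this.1, this.2.le⟩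
  | succ j ih =>
    have ih := ih (by omega)
    suffices h : ∀ t, modelApproach ε (j + 1) t ∈ {z | z ∈ V \ marked k ∧ z.im ≤ 0} from h t
    clear t
    refine trans_mem (trans_mem (fun t => ih t) fun t => ?_) fun t => ?_
    · refine ⟨⟨hcirc j (by omega) _, circleMap_notMem_marked hε hε' _⟩, ?_⟩
      change (circleMap ((j + 1 : ℕ) : ℂ) ε (Real.pi + t * (2 * Real.pi - Real.pi))).im ≤ 0
      have := im_circleMap_ofReal (j + 1 : ℕ) ε (Real.pi + t * (2 * Real.pi - Real.pi))
      rw [Complex.ofReal_natCast] at this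
      rw [this]
      refine mul_nonpos_of_nonneg_of_nonpos hε.le ?_
      rw [add_comm, Real.sin_add_pi, neg_nonpos]
      have ht0 := t.2.1
      have ht1 := t.2.2
      exact Real.sin_nonneg_of_nonneg_of_le_pi (by nlinarith [Real.pi_pos])
        (by nlinarith [Real.pi_pos])
    · have e1 : circleMap ((j + 1 : ℕ) : ℂ) ε (2 * Real.pi) = ((j + 1 + ε : ℝ) : ℂ) := by
        simp [circleMap_two_pi]
      have e2 : circleMap ((j + 1 + 1 : ℕ) : ℂ) ε Real.pi = ((j + 1 + 1 - ε : ℝ) : ℂ) := by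
        simp [circleMap_pi]
      have := segment_mem_gap (m := j + 1) (k := k) (x := j + 1 + ε) (y := j + 1 + 1 - ε) hV
        ⟨.inr (by push_cast; linarith), .inr (by push_cast; linarith)⟩
        ⟨.inr (by push_cast; linarith), .inr (by push_cast; linarith)⟩
        (by rw [← e1]; exact hcirc j (by omega) _) (by rw [← e2]; exact hcirc (j + 1) hj _) t
      rw [← e1, ← e2] at this
      exact ⟨this.1, this.2.le⟩

theorem circleLoop_mem (hball : ∀ i : ℕ, i < k → Metric.closedBall ((i + 1 : ℕ) : ℂ) ε ⊆ V)
    (hε : 0 < ε) (hε' : ε < 1 / 2) (j : ℕ) (hj : j < k) (t : unitInterval) :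
    circleLoop ((j + 1 : ℕ) : ℂ) ε t ∈ V \ marked k :=
  ⟨hball j hj (circleMap_mem_closedBall _ hε.le _), circleMap_notMem_marked hε hε' _⟩

theorem modelLoop_mem (hV : Convex ℝ V) (h0 : (0 : ℂ) ∈ V)
    (hball : ∀ i : ℕ, i < k → Metric.closedBall ((i + 1 : ℕ) : ℂ) ε ⊆ V) (hε : 0 < ε)
    (hε' : ε < 1 / 2) (j : ℕ) (hj : j < k) (t : unitInterval) :
    modelLoop ε j t ∈ V \ marked k := by
  have h := fun t => (modelApproach_mem hV h0 hball hε hε' j hj t).1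
  exact trans_mem (trans_mem h (circleLoop_mem hball hε hε' j hj)) (symm_mem h) t

/-- The model approach and the model circle, as paths of the punctured convex set. -/
theorem exists_modelLoop_decomposition (hV : Convex ℝ V) (h0 : (0 : ℂ) ∈ V \ marked k)
    (hball : ∀ i : ℕ, i < k → Metric.closedBall ((i + 1 : ℕ) : ℂ) ε ⊆ V) (hε : 0 < ε)
    (hε' : ε < 1 / 2) (j : ℕ) (hj : j < k)
    (P : Path (⟨0, h0⟩ : ↥(V \ marked k)) ⟨0, h0⟩) (hP : ∀ t, (P t : ℂ) = modelLoop ε j t) :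
    ∃ (a : ↥(V \ marked k)) (p : Path (⟨0, h0⟩ : ↥(V \ marked k)) a) (q : Path a a),
      (∀ t, p t ∈ lowerPart _) ∧
      (∀ t : unitInterval,
        (q t : ℂ) = circleMap ((j + 1 : ℕ) : ℂ) ε (Real.pi + t * (2 * Real.pi))) ∧
      P = (p.trans q).trans p.symm := by
  have h := modelApproach_mem hV h0.1 hball hε hε' j hj
  refine ⟨_, (modelApproach ε j).codRestrict fun t => (h t).1,
    (circleLoop ((j + 1 : ℕ) : ℂ) ε).codRestrict (circleLoop_mem hball hε hε' j hj),
    fun t => (h t).2, fun t => ?_, ?_⟩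
  · change circleMap _ ε (Real.pi + t * (Real.pi + 2 * Real.pi - Real.pi)) = _
    congr 1
    ring
  · ext t
    rw [hP, modelLoop, Path.trans_apply, Path.trans_apply]
    split_ifs with h1
    · rw [Path.trans_apply, Path.trans_apply]
      split_ifs with h2
      · rfl
      · rfl
    · rfl

/-- The approach and the first half of the circle stay in the lower half plane; the second half of
the circle goes back through the upper one, from the gap `j + 1` to the gap `j`. -/
theorem cls_modelLoop (hV : Convex ℝ V) (h0 : (0 : ℂ) ∈ V \ marked k)
    (hball : ∀ i : ℕ, i < k → Metric.closedBall ((i + 1 : ℕ) : ℂ) ε ⊆ V) (hε : 0 < ε)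
    (hε' : ε < 1 / 2) (j : ℕ) (hj : j < k)
    (B : Bigon (⟨0, h0⟩ : ↥(V \ marked k)) (lowerPart _) (upperPart _))
    (P : Path (⟨0, h0⟩ : ↥(V \ marked k)) ⟨0, h0⟩) (hP : ∀ t, (P t : ℂ) = modelLoop ε j t)
    {a b : ↥(V \ marked k)} {x y : ℝ} (ha : (a : ℂ) = x) (hb : (b : ℂ) = y)
    (hx : InGap k j x) (hy : InGap k (j + 1) y) {g g' : LeftPi _ (⟨0, h0⟩ : ↥(V \ marked k))}
    (hg : IsBigonClass _ (lowerPart _) (upperPart _) a g)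
    (hg' : IsBigonClass _ (lowerPart _) (upperPart _) b g') :
    cls P = g' * g⁻¹ := by
  obtain ⟨a', p, q, hp, hq, rfl⟩ := exists_modelLoop_decomposition hV h0 hball hε hε' j hj P hP
  have hmem : ∀ θ, circleMap ((j + 1 : ℕ) : ℂ) ε θ ∈ V \ marked k := fun θ =>
    ⟨hball j hj (circleMap_mem_closedBall _ hε.le _), circleMap_notMem_marked hε hε' _⟩
  let f : C(ℝ, ↥(V \ marked k)) := ⟨fun θ => ⟨circleMap ((j + 1 : ℕ) : ℂ) ε θ, hmem θ⟩,
    (continuous_circleMap _ _).subtype_mk _⟩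
  have him : ∀ θ, ((f θ : ↥(V \ marked k)) : ℂ).im = ε * Real.sin θ := fun θ => by
    have := im_circleMap_ofReal (j + 1 : ℕ) ε θ
    rwa [Complex.ofReal_natCast] at this
  have e1 : a' = f Real.pi := by
    ext
    have := hq 0
    simpa [f] using this
  -- The circle starts at its leftmost point, so it is split at angle `2π` into `[π, 2π]` (lower)
  -- and `[2π, 3π]` (upper).
  have e2 : f Real.pi = f (3 * Real.pi) := by
    ext
    have := periodic_circleMap ((j + 1 : ℕ) : ℂ) ε Real.pi
    simp only [f, ContinuousMap.coe_mk]
    rw [← this]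
    congr 1
    ring
  let q₁ : Path a' (f (2 * Real.pi)) := (linePath f Real.pi (2 * Real.pi)).cast e1 rfl
  let q₂ : Path (f (2 * Real.pi)) a' :=
    (linePath f (2 * Real.pi) (3 * Real.pi)).cast rfl (e1.trans e2)
  have hq12 : q.Homotopic (q₁.trans q₂) := by
    have h := (linePath_trans f Real.pi (2 * Real.pi) (3 * Real.pi)).symm
    have hqe : q = (linePath f Real.pi (3 * Real.pi)).cast e1 (e1.trans e2) := by
      ext t
      rw [hq, Path.cast_coe, linePath_apply]
      simp only [f, ContinuousMap.coe_mk]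
      congr 1
      ring
    rw [hqe]
    exact h
  have h1 : ∀ t, q₁ t ∈ lowerPart (V \ marked k) := fun t => by
    change ((linePath f Real.pi (2 * Real.pi) t : ↥(V \ marked k)) : ℂ).im ≤ 0
    rw [linePath_apply, him]
    refine mul_nonpos_of_nonneg_of_nonpos hε.le ?_
    rw [add_comm, Real.sin_add_pi, neg_nonpos]
    have ht0 := t.2.1
    have ht1 := t.2.2
    exact Real.sin_nonneg_of_nonneg_of_le_pi (by nlinarith [Real.pi_pos])
      (by nlinarith [Real.pi_pos])
  have h2 : ∀ t, q₂ t ∈ upperPart (V \ marked k) := fun t => by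
    change 0 ≤ ((linePath f (2 * Real.pi) (3 * Real.pi) t : ↥(V \ marked k)) : ℂ).im
    rw [linePath_apply, him]
    refine mul_nonneg hε.le ?_
    rw [add_comm, Real.sin_add_two_pi]
    have ht0 := t.2.1
    have ht1 := t.2.2
    exact Real.sin_nonneg_of_nonneg_of_le_pi (by nlinarith [Real.pi_pos])
      (by nlinarith [Real.pi_pos])
  have ha' : (a' : ℂ) = (j + 1 - ε : ℝ) := by
    rw [e1]; simp [f, circleMap_pi]
  have hb' : ((f (2 * Real.pi) : ↥(V \ marked k)) : ℂ) = (j + 1 + ε : ℝ) := by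
    simp [f, circleMap_two_pi]
  have hga := bigonClass_gap hV ha ha' hx
    ⟨.inr (by linarith), .inr (by linarith)⟩ hg
  have hgb := bigonClass_gap hV hb hb' hy
    ⟨.inr (by push_cast; linarith), .inr (by push_cast; linarith)⟩ hg'
  rw [← B.cls_loop_around hp h1 h2 hga hgb, cls_eq_iff]
  exact ((Path.Homotopic.refl _).hcomp hq12).hcomp (.refl _)

end ModelLoop

/-! ### Continuous logarithms and turning numbers -/

theorem exists_continuous_log {X : Type*} [TopologicalSpace X] [SimplyConnectedSpace X]
    [LocallyPathConnectedSpace X] {f : X → ℂ} (hf : Continuous f) (h0 : ∀ x, f x ≠ 0) :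
    ∃ G : X → ℂ, Continuous G ∧ ∀ x, Complex.exp (G x) = f x := by
  have hu : IsSimplyConnected (Set.univ : Set X) :=
    (Homeomorph.Set.univ X).toHomotopyEquiv.simplyConnectedSpace
  obtain ⟨G, hG, h⟩ := Complex.exists_continuousOn_eqOn_exp_comp hu isOpen_univ hf.continuousOn
    (by rintro ⟨x, -, hx⟩; exact h0 x hx)
  exact ⟨G, continuousOn_univ.1 hG, fun x => h (Set.mem_univ x)⟩

/-- Two logarithms of one function, one of them shifted by their difference at `x`, are lifts
through `exp` that agree at `x`; on a connected space they coincide. -/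
theorem log_sub_log_const {X : Type*} [TopologicalSpace X] [PreconnectedSpace X] {G H : X → ℂ}
    (hG : Continuous G) (hH : Continuous H) (h : ∀ x, Complex.exp (G x) = Complex.exp (H x))
    (x y : X) : G x - H x = G y - H y := by
  have h1 : Complex.exp (G x - H x) = 1 := by
    rw [Complex.exp_sub, h, div_self (Complex.exp_ne_zero _)]
  have key : G = fun z => H z + (G x - H x) := by
    refine Complex.isCoveringMap_exp.eq_of_comp_eq hG (by fun_prop) ?_ x (by ring)
    ext z
    simp only [Function.comp_apply, Complex.exp_add, h, h1, mul_one]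
  have := congrFun key y
  rw [this]
  ring

/-- The argument of the nonvanishing periodic function `f` increases by `2π` in a period. -/
def TurnsOnce (f : ℝ → ℂ) : Prop :=
  ∃ G : ℝ → ℂ, Continuous G ∧ (∀ τ, Complex.exp (G τ) = f τ) ∧
    ∀ τ, G (τ + 2 * Real.pi) = G τ + 2 * Real.pi * Complex.I

theorem TurnsOnce.shift {f : ℝ → ℂ} (h : TurnsOnce f) (c : ℝ) :
    TurnsOnce fun τ => f (τ + c) := by
  obtain ⟨G, hG, h1, h2⟩ := h
  refine ⟨fun τ => G (τ + c), by fun_prop, fun τ => h1 _, fun τ => ?_⟩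
  change G (τ + 2 * Real.pi + c) = G (τ + c) + _
  rw [← h2, add_right_comm]

/-- A logarithm on the whole parameter plane exists, and its increment over a period is the same for
all values of the homotopy parameter. -/
theorem TurnsOnce.of_homotopy {H : ℝ × ℝ → ℂ} (hH : Continuous H) (h0 : ∀ x, H x ≠ 0)
    (hper : ∀ a τ, H (a, τ + 2 * Real.pi) = H (a, τ)) {a b : ℝ}
    (h : TurnsOnce fun τ => H (a, τ)) : TurnsOnce fun τ => H (b, τ) := by
  obtain ⟨G, hG, hG'⟩ := exists_continuous_log hH h0
  obtain ⟨G₀, hG₀, hG₀', hinc⟩ := h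
  have key : ∀ c τ, G (c, τ + 2 * Real.pi) = G (c, τ) + 2 * Real.pi * Complex.I := fun c τ => by
    have h1 := log_sub_log_const (G := fun x : ℝ × ℝ => G (x.1, x.2 + 2 * Real.pi)) (H := G)
      (by fun_prop) hG (fun x => by rw [hG', hG', hper]) (c, τ) (a, 0)
    have h2 := log_sub_log_const (G := fun t : ℝ => G (a, t)) (H := G₀) (by fun_prop) hG₀
      (fun t => by rw [hG', hG₀']) (0 + 2 * Real.pi) 0
    have h3 := hinc 0
    simp only at h1 h2
    linear_combination h1 + h2 + h3
  exact ⟨fun τ => G (b, τ), by fun_prop, fun τ => hG' _, key b⟩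

theorem circleLoop_apply (c : ℂ) (ρ : ℝ) (t : unitInterval) :
    circleLoop c ρ t = circleMap c ρ (Real.pi + t * (2 * Real.pi)) := by
  change circleMap c ρ (Real.pi + t * (Real.pi + 2 * Real.pi - Real.pi)) = _
  congr 1
  ring

/-- Log modulus plus `I` times the argument is a complex logarithm; conversely the imaginary part of
a logarithm is an argument. The complex form on all of `ℝ` is the one suited to homotopies. -/
theorem turnsOnceAround_iff {f : ℂ → ℂ} {c p : ℂ} {ρ : ℝ}
    (hf : Continuous fun τ : ℝ => f (circleMap c ρ τ)) (hp : ∀ τ, f (circleMap c ρ τ) ≠ p) :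
    TurnsOnceAround (fun t => f (circleLoop c ρ t)) p ↔
      TurnsOnce fun τ => f (circleMap c ρ τ) - p := by
  have h0 : ∀ τ, f (circleMap c ρ τ) - p ≠ 0 := fun τ => sub_ne_zero.2 (hp τ)
  simp only [TurnsOnceAround, circleLoop_apply]
  constructor
  · rintro ⟨θ, hθ, h1, h2⟩
    obtain ⟨G, hG, hG'⟩ := exists_continuous_log (X := ℝ)
      (f := fun τ => f (circleMap c ρ τ) - p) (hf.sub continuous_const) h0
    refine ⟨G, hG, hG', fun τ => ?_⟩
    have h3 := log_sub_log_const (G := fun t : unitInterval => G (Real.pi + t * (2 * Real.pi)))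
      (H := fun t => ((Real.log ‖f (circleMap c ρ (Real.pi + t * (2 * Real.pi))) - p‖ : ℝ) : ℂ) +
        (θ t : ℂ) * Complex.I) (by fun_prop) ?_ ?_ 1 0
    · have h4 := log_sub_log_const (G := fun τ => G (τ + 2 * Real.pi)) (H := G) (by fun_prop) hG
        (fun τ => by rw [hG', hG', periodic_circleMap c ρ]) τ Real.pi
      have e1 : circleMap c ρ (Real.pi + 2 * Real.pi) = circleMap c ρ Real.pi :=
        periodic_circleMap c ρ Real.pi
      simp only [Set.Icc.coe_one, Set.Icc.coe_zero, one_mul, zero_mul, add_zero, e1, h2,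
        Complex.ofReal_add, Complex.ofReal_mul, Complex.ofReal_ofNat] at h3 h4
      linear_combination h4 + h3
    · refine Continuous.add ?_ (by fun_prop)
      refine Complex.continuous_ofReal.comp (Continuous.log ?_ fun t => norm_ne_zero_iff.2 (h0 _))
      have : Continuous fun t : unitInterval => f (circleMap c ρ (Real.pi + t * (2 * Real.pi))) :=
        hf.comp (by fun_prop : Continuous fun t : unitInterval => Real.pi + t * (2 * Real.pi))
      exact (this.sub continuous_const).norm
    · intro t
      rw [hG', Complex.exp_add, ← Complex.ofReal_exp, Real.exp_log (norm_pos_iff.2 (h0 _))]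
      exact h1 t
  · rintro ⟨G, hG, h1, h2⟩
    refine ⟨fun t => (G (Real.pi + t * (2 * Real.pi))).im, by fun_prop, fun t => ?_, ?_⟩
    · have h1 : ∀ τ, f (circleMap c ρ τ) - p = Complex.exp (G τ) := fun τ => (h1 τ).symm
      rw [h1]
      conv_lhs => rw [← Complex.re_add_im (G _), Complex.exp_add]
      rw [Complex.norm_exp, Complex.ofReal_exp]
    · have := congrArg Complex.im (h2 Real.pi)
      simpa using this

/-- An injective continuous map of the plane that fixes `0` and turns once around `0` is
`u ↦ u * exp (h u)`, for a function `h` that is continuous outside of `0`. -/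
theorem exists_eq_mul_exp {F : ℂ → ℂ} (hF : Continuous F) (hF0 : ∀ u, u ≠ 0 → F u ≠ 0) {ρ : ℝ}
    (hρ : 0 < ρ) (ht : TurnsOnce fun τ => F (circleMap 0 ρ τ)) :
    ∃ h : ℂ → ℂ, ContinuousOn h {0}ᶜ ∧ ∀ u, u ≠ 0 → F u = u * Complex.exp (h u) := by
  -- `G` is a logarithm of `F ∘ exp`. Turning once means that `G z - z` has period `2πi`, so it
  -- descends along `exp` to the function `h`.
  obtain ⟨G, hG, hG'⟩ := exists_continuous_log (X := ℂ) (f := fun z => F (Complex.exp z))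
    (by fun_prop) (fun z => hF0 _ (Complex.exp_ne_zero z))
  obtain ⟨G₀, hG₀, hG₀', hinc⟩ := ht
  have hper : ∀ z, G (z + 2 * Real.pi * Complex.I) = G z + 2 * Real.pi * Complex.I := fun z => by
    have h1 := log_sub_log_const (G := fun z => G (z + 2 * Real.pi * Complex.I)) (H := G)
      (by fun_prop) hG (fun z => by rw [hG', hG', Complex.exp_periodic z]) z (Real.log ρ)
    have h2 := log_sub_log_const (G := fun t : ℝ => G (Real.log ρ + t * Complex.I)) (H := G₀)
      (by fun_prop) hG₀ (fun t => by
        rw [hG', hG₀', Complex.exp_add, ← Complex.ofReal_exp, Real.exp_log hρ]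
        simp [circleMap]) (0 + 2 * Real.pi) 0
    have h3 := hinc 0
    simp only [Complex.ofReal_mul, Complex.ofReal_ofNat, Complex.ofReal_zero, zero_add, zero_mul,
      add_zero] at h1 h2 h3
    linear_combination h1 + h2 + h3
  have hP : Function.Periodic (fun z => G z - z) (2 * Real.pi * Complex.I) := fun z => by
    simp only [hper]
    ring
  have hP' : ∀ z w, Complex.exp z = Complex.exp w → G z - z = G w - w := fun z w hzw => by
    obtain ⟨m, rfl⟩ := Complex.exp_eq_exp_iff_exists_int.1 hzw
    exact (hP.int_mul m) w
  refine ⟨fun u => G (Complex.log u) - Complex.log u, ?_, fun u hu => ?_⟩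
  · intro u hu
    refine ContinuousAt.continuousWithinAt ?_
    by_cases hs : u ∈ Complex.slitPlane
    · exact (hG.continuousAt.comp (continuousAt_clog hs)).sub (continuousAt_clog hs)
    · have hs' : -u ∈ Complex.slitPlane := by
        rw [Complex.mem_slitPlane_iff] at hs ⊢
        push Not at hs
        left
        rcases hs.1.lt_or_eq with h | h
        · simpa using h
        · exact absurd (Complex.ext h hs.2) hu
      have hev : ∀ᶠ v in nhds u, -v ∈ Complex.slitPlane ∧ v ≠ 0 :=
        (continuousAt_neg.eventually (Complex.isOpen_slitPlane.mem_nhds hs')).and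
          (isOpen_ne.mem_nhds hu)
      have hlog : ContinuousAt (fun v : ℂ => Complex.log (-v) + Real.pi * Complex.I) u :=
        (ContinuousAt.clog continuousAt_neg hs').add continuousAt_const
      -- On the negative axis the branch `log (-v) + πi` replaces `log v`; by periodicity it gives
      -- the same value of `h`.
      refine ((hG.continuousAt.comp hlog).sub hlog).congr ?_
      filter_upwards [hev] with v hv
      refine hP' _ _ ?_
      rw [Complex.exp_add, Complex.exp_log (neg_ne_zero.2 hv.2), Complex.exp_log hv.2,
        Complex.exp_pi_mul_I]
      ring
  · rw [Complex.exp_sub, hG', Complex.exp_log hu]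
    field_simp

/-! ### Squeezing the plane into a stadium -/

/-- The part of the real coordinate in `[0, k]`. -/
def clampTo (k : ℕ) (x : ℝ) : ℝ := max 0 (min k x)

/-- A strictly increasing map of the line into `(-ε, k + ε)`, the identity on `[0, k]`. -/
def squeezeRe (k : ℕ) (ε x : ℝ) : ℝ := clampTo k x + ε / 4 * Real.arctan (x - clampTo k x)

/-- An injective map of the plane into a stadium, which is the identity on `[0, k]`. -/
def squeeze (k : ℕ) (ε : ℝ) (z : ℂ) : ℂ := ⟨squeezeRe k ε z.re, ε / 4 * Real.arctan z.im⟩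

section Squeeze

variable {k : ℕ} {ε : ℝ}

theorem clampTo_mono : Monotone (clampTo k) := fun x y h => by
  unfold clampTo
  gcongr

theorem sub_clampTo_mono : Monotone fun x => x - clampTo k x := fun x y h => by
  have hk : (0 : ℝ) ≤ k := k.cast_nonneg
  simp only [clampTo]
  rcases max_cases 0 (min (k : ℝ) x) with h1 | h1 <;> rcases max_cases 0 (min (k : ℝ) y) with h2 | h2 <;>
    rcases min_cases (k : ℝ) x with h3 | h3 <;> rcases min_cases (k : ℝ) y with h4 | h4 <;> linarith

theorem clampTo_of_mem {x : ℝ} (h0 : 0 ≤ x) (h1 : x ≤ k) : clampTo k x = x := by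
  rw [clampTo, min_eq_right h1, max_eq_right h0]

theorem squeezeRe_strictMono (hε : 0 < ε) : StrictMono (squeezeRe k ε) := fun x y h => by
  unfold squeezeRe
  have h1 := clampTo_mono (k := k) h.le
  have h2 := sub_clampTo_mono (k := k) h.le
  simp only at h2
  rcases h2.lt_or_eq with h3 | h3
  · have := mul_lt_mul_of_pos_left (Real.arctan_strictMono h3) (by positivity : 0 < ε / 4)
    linarith
  · rw [h3]
    have : clampTo k x < clampTo k y := by linarith
    linarith

theorem squeezeRe_of_mem {x : ℝ} (h0 : 0 ≤ x) (h1 : x ≤ k) : squeezeRe k ε x = x := by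
  simp [squeezeRe, clampTo_of_mem h0 h1]

theorem squeeze_ofReal (x : ℝ) : squeeze k ε x = squeezeRe k ε x := by
  apply Complex.ext <;> simp [squeeze]

theorem continuous_squeeze : Continuous (squeeze k ε) := by
  have h1 : Continuous (clampTo k) := by unfold clampTo; fun_prop
  have h2 : Continuous (squeezeRe k ε) := by unfold squeezeRe; fun_prop
  have h3 : squeeze k ε = fun z : ℂ => (squeezeRe k ε z.re : ℂ) +
      ((ε / 4 * Real.arctan z.im : ℝ) : ℂ) * Complex.I := by
    ext z
    apply Complex.ext <;> simp [squeeze, -Complex.ofReal_mul]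
  rw [h3]
  fun_prop

theorem squeeze_injective (hε : 0 < ε) : Function.Injective (squeeze k ε) := fun z w h => by
  have h1 := congrArg Complex.re h
  have h2 := congrArg Complex.im h
  simp only [squeeze] at h1 h2
  refine Complex.ext ((squeezeRe_strictMono hε).injective h1) (Real.arctan_injective ?_)
  have : ε / 4 ≠ 0 := by positivity
  exact mul_left_cancel₀ this h2

theorem squeeze_im_nonneg (hε : 0 < ε) {z : ℂ} (h : 0 ≤ z.im) : 0 ≤ (squeeze k ε z).im := by
  simp only [squeeze]
  have := Real.arctan_nonneg.2 h
  positivity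

theorem squeeze_im_nonpos (hε : 0 < ε) {z : ℂ} (h : z.im ≤ 0) : (squeeze k ε z).im ≤ 0 := by
  simp only [squeeze]
  have := Real.arctan_mono h
  rw [Real.arctan_zero] at this
  exact mul_nonpos_of_nonneg_of_nonpos (by positivity) this

theorem mem_stadium {x : ℝ} (h0 : 0 ≤ x) (h1 : x ≤ k) {z : ℂ} (h : dist z x ≤ ε) :
    z ∈ Metric.cthickening ε (segment ℝ (0 : ℂ) (k : ℂ)) := by
  refine Metric.mem_cthickening_of_dist_le z x _ _ ?_ h
  rw [segment_eq_image']
  rcases Nat.eq_zero_or_pos k with rfl | hk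
  · refine ⟨0, by simp, ?_⟩
    have : x = 0 := le_antisymm (by simpa using h1) h0
    simp [this]
  · have hk' : (0 : ℝ) < k := by exact_mod_cast hk
    refine ⟨x / k, ⟨by positivity, (div_le_one hk').2 h1⟩, ?_⟩
    have : (k : ℂ) ≠ 0 := by exact_mod_cast hk.ne'
    simp
    field_simp

theorem clampTo_mem (x : ℝ) : 0 ≤ clampTo k x ∧ clampTo k x ≤ k :=
  ⟨le_max_left _ _, max_le k.cast_nonneg (min_le_left _ _)⟩

theorem abs_arctan_le_two (x : ℝ) : |Real.arctan x| ≤ 2 := by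
  rw [abs_le]
  have h1 := Real.arctan_lt_pi_div_two x
  have h2 := Real.neg_pi_div_two_lt_arctan x
  have h3 := Real.pi_lt_four
  constructor <;> linarith

/-- Each coordinate moves by at most `ε / 4 * 2` from the clamped point of the axis, so the distance
is at most `ε`. -/
theorem squeeze_mem (hε : 0 < ε) (z : ℂ) :
    squeeze k ε z ∈ Metric.cthickening ε (segment ℝ (0 : ℂ) (k : ℂ)) := by
  refine mem_stadium (clampTo_mem z.re).1 (clampTo_mem z.re).2 ?_
  rw [dist_eq_norm]
  refine (Complex.norm_le_abs_re_add_abs_im _).trans ?_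
  simp only [squeeze, squeezeRe, Complex.sub_re, Complex.sub_im, Complex.ofReal_re,
    Complex.ofReal_im, add_sub_cancel_left, sub_zero, abs_mul, abs_of_pos (by positivity : 0 < ε / 4)]
  nlinarith [abs_arctan_le_two (z.re - clampTo k z.re), abs_arctan_le_two z.im]

theorem squeezeRe_natCast {j : ℕ} (hj : j ≤ k) : squeezeRe k ε j = j :=
  squeezeRe_of_mem j.cast_nonneg (by exact_mod_cast hj)

theorem squeeze_natCast {j : ℕ} (hj : j ≤ k) : squeeze k ε j = j := by
  have := squeeze_ofReal (k := k) (ε := ε) j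
  rw [squeezeRe_natCast hj] at this
  simpa using this

theorem squeeze_mem_marked (hε : 0 < ε) {z : ℂ} (h : squeeze k ε z ∈ marked k) :
    z ∈ marked k := by
  rw [mem_marked] at h ⊢
  obtain ⟨j, h1, h2, h3⟩ := h
  rw [← squeeze_natCast h2] at h3
  exact ⟨j, h1, h2, squeeze_injective hε h3⟩

theorem InGap.squeezeRe (hε : 0 < ε) {m : ℕ} (hm : m ≤ k) {x : ℝ} (h : InGap k m x) :
    InGap k m (squeezeRe k ε x) := by
  refine ⟨h.1.imp_right fun h => ?_, ?_⟩
  · have := squeezeRe_strictMono (k := k) hε h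
    rwa [squeezeRe_natCast hm] at this
  · rcases le_or_gt k m with h' | h'
    · exact .inl h'
    · have h2 := h.2.resolve_left (by omega)
      have h3 : x < ((m + 1 : ℕ) : ℝ) := by push_cast; exact h2
      have := squeezeRe_strictMono (k := k) hε h3
      rw [squeezeRe_natCast (by omega)] at this
      exact .inr (by push_cast at this; exact this)

/-- In each coordinate both points lie on the same side of the centre, because `squeeze` is
increasing in each coordinate and fixes `k`. A convex combination equal to `k` would force the
cosine and the sine of `τ` to vanish together. This keeps the homotopy from the small circle to the
squeezed unit circle away from the centre. -/
theorem squeeze_convexComb_ne (hε : 0 < ε) {a : ℝ} (h0 : 0 ≤ a) (h1 : a ≤ 1) (τ : ℝ) :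
    (1 - a : ℝ) • circleMap (k : ℂ) ε τ + a • squeeze k ε (circleMap (k : ℂ) 1 τ) ≠ k := by
  intro h
  have hre := congrArg Complex.re h
  have him := congrArg Complex.im h
  have e1 : ∀ ρ, (circleMap (k : ℂ) ρ τ).re = k + ρ * Real.cos τ := fun ρ => by
    simp [circleMap, Complex.exp_ofReal_mul_I_re]
  have e2 : ∀ ρ, (circleMap (k : ℂ) ρ τ).im = ρ * Real.sin τ := fun ρ => by
    simp [circleMap, Complex.exp_ofReal_mul_I_im]
  simp only [Complex.add_re, Complex.add_im, Complex.real_smul, Complex.re_ofReal_mul,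
    Complex.im_ofReal_mul, e1, e2, squeeze, Complex.natCast_re, Complex.natCast_im, one_mul]
    at hre him
  have hk : squeezeRe k ε k = k := squeezeRe_natCast le_rfl
  have hcomb : ∀ {u v : ℝ}, 0 < u → 0 < v → 0 < (1 - a) * u + a * v := fun hu hv => by
    rcases h0.eq_or_lt with rfl | h0
    · simpa using hu
    · have := mul_pos h0 hv
      have := mul_nonneg (sub_nonneg.2 h1) hu.le
      linarith
  have hcos : Real.cos τ = 0 := by
    rcases lt_trichotomy (Real.cos τ) 0 with h | h | h
    · have := squeezeRe_strictMono (k := k) hε (by linarith : k + Real.cos τ < k)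
      rw [hk] at this
      have := hcomb (u := -(ε * Real.cos τ)) (v := k - squeezeRe k ε (k + Real.cos τ))
        (by nlinarith) (by linarith)
      nlinarith
    · exact h
    · have := squeezeRe_strictMono (k := k) hε (by linarith : (k : ℝ) < k + Real.cos τ)
      rw [hk] at this
      have := hcomb (u := ε * Real.cos τ) (v := squeezeRe k ε (k + Real.cos τ) - k)
        (by positivity) (by linarith)
      nlinarith
  have hsin : Real.sin τ = 0 := by
    rcases lt_trichotomy (Real.sin τ) 0 with h | h | h
    · have := Real.arctan_lt_zero.2 h
      have := hcomb (u := -(ε * Real.sin τ)) (v := -(ε / 4 * Real.arctan (Real.sin τ)))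
        (by nlinarith) (by nlinarith)
      nlinarith
    · exact h
    · have := Real.arctan_pos.2 h
      have := hcomb (u := ε * Real.sin τ) (v := ε / 4 * Real.arctan (Real.sin τ))
        (by positivity) (by positivity)
      nlinarith
  have := Real.sin_sq_add_cos_sq τ
  rw [hcos, hsin] at this
  norm_num at this

end Squeeze

/-! ### The snake -/

/-- The part of `x` in `[0, 1]`. -/
def clampOne (x : ℝ) : ℝ := max 0 (min 1 x)

theorem clampOne_nonneg (x : ℝ) : 0 ≤ clampOne x := le_max_left _ _

theorem clampOne_le_one (x : ℝ) : clampOne x ≤ 1 := max_le zero_le_one (min_le_left _ _)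

theorem clampOne_of_le {x : ℝ} (h : x ≤ 0) : clampOne x = 0 :=
  max_eq_left ((min_le_right _ _).trans h)

theorem clampOne_of_ge {x : ℝ} (h : 1 ≤ x) : clampOne x = 1 := by
  rw [clampOne, min_eq_left h, max_eq_right zero_le_one]

theorem clampOne_of_mem {x : ℝ} (h0 : 0 ≤ x) (h1 : x ≤ 1) : clampOne x = x := by
  rw [clampOne, min_eq_right h1, max_eq_right h0]

theorem clampOne_mono : Monotone clampOne := fun x y h => by
  unfold clampOne
  gcongr

theorem continuous_clampOne : Continuous clampOne := by
  unfold clampOne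
  fun_prop

/-- The height of the snake: on `[0, r]` it is `0`, and then it rises by `1` after each
`r` units of time. -/
def height (r q : ℕ) (t : ℝ) : ℝ := ∑ j ∈ Finset.range q, clampOne (t - (j + 1) * r)

/-! ### The height function of the snake -/

section Height

variable {r q : ℕ} {t : ℝ}

theorem continuous_height : Continuous (height r q) := by
  have := continuous_clampOne
  unfold height
  fun_prop

theorem height_mono : Monotone (height r q) := fun x y h =>
  Finset.sum_le_sum fun j _ => clampOne_mono (by linarith)

theorem height_nonneg : 0 ≤ height r q t := Finset.sum_nonneg fun _ _ => clampOne_nonneg _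

theorem height_le : height r q t ≤ q := by
  have := Finset.sum_le_card_nsmul (Finset.range q) (fun j => clampOne (t - (j + 1) * r)) 1
    fun _ _ => clampOne_le_one _
  simpa [height] using this

theorem height_of_le (h : t ≤ r) : height r q t = 0 :=
  Finset.sum_eq_zero fun j _ => clampOne_of_le (by
    have : (0 : ℝ) ≤ j * r := by positivity
    linarith)

theorem height_of_ge (h : q * r + 1 ≤ t) : height r q t = q := by
  have : ∀ j ∈ Finset.range q, clampOne (t - (j + 1) * r) = 1 := fun j hj => by
    refine clampOne_of_ge ?_
    have h1 : ((j + 1 : ℕ) : ℝ) ≤ q := by exact_mod_cast Finset.mem_range.1 hj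
    push_cast at h1
    have h2 : (0 : ℝ) ≤ r := r.cast_nonneg
    nlinarith
  simp [height, Finset.sum_congr rfl this]

theorem height_succ : height r (q + 1) t = height r q t + clampOne (t - (q + 1) * r) :=
  Finset.sum_range_succ _ _

/-- For `r ≥ 1` the last ramp ends at `q * r + 1 ≤ (q + 1) * r`. For `r = 0` all ramps would
coincide, whence the requirement `q = 0`. -/
theorem height_top (hq : r = 0 → q = 0) (h : (q + 1) * r ≤ t) : height r q t = q := by
  rcases Nat.eq_zero_or_pos r with h0 | h0
  · obtain rfl := hq h0
    simp [height]
  · have : (1 : ℝ) ≤ r := by exact_mod_cast h0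
    exact height_of_ge (by linarith)

/-- The quantity `t - r * height` is the position along the ray: it reaches `r` at the end of each
ray and falls back during a ramp. The bound keeps the axis at radius at least `1` before the final
approach to the centre. -/
theorem sub_height_le (h : t ≤ (q + 1) * r) : t - r * height r q t ≤ r := by
  have hr : (0 : ℝ) ≤ r := r.cast_nonneg
  induction q with
  | zero => simpa [height] using h
  | succ q ih =>
    rw [height_succ]
    have h0 := mul_nonneg hr (clampOne_nonneg (t - (q + 1) * r))
    rcases le_total t ((q + 1) * r) with h1 | h1
    · have := ih h1
      nlinarith
    · rcases Nat.eq_zero_or_pos r with rfl | hr0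
      · simp at h ⊢
        exact h
      have hr1 : (1 : ℝ) ≤ r := by exact_mod_cast hr0
      rw [height_of_ge (by nlinarith)]
      push_cast at h
      rcases le_total 1 (t - (q + 1) * r) with h2 | h2
      · rw [clampOne_of_ge h2]
        linarith
      · rw [clampOne_of_mem (by linarith) h2]
        nlinarith

theorem height_truncate {j : ℕ} (hj : j ≤ q) (h : t ≤ (j + 1) * r) :
    height r q t = height r j t := by
  induction q, hj using Nat.le_induction with
  | base => rfl
  | succ q hjq ih =>
    rw [height_succ, ih, clampOne_of_le, add_zero]
    have h1 : (j : ℝ) ≤ q := by exact_mod_cast hjq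
    have h2 : (0 : ℝ) ≤ r := r.cast_nonneg
    nlinarith

theorem height_ramp {j : ℕ} (hj : j < q) (h0 : (j + 1) * r ≤ t) (h1 : t ≤ (j + 2) * r)
    (hr : 0 < r) : height r q t = j + clampOne (t - (j + 1) * r) := by
  have hr1 : (1 : ℝ) ≤ r := by exact_mod_cast hr
  rw [height_truncate (j := j + 1) hj (by push_cast; linarith), height_succ,
    height_of_ge (by linarith)]

theorem height_plateau {j : ℕ} (hj : j ≤ q) (h0 : j * r + 1 ≤ t) (h1 : t ≤ (j + 1) * r) :
    height r q t = j := by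
  rw [height_truncate hj h1, height_of_ge h0]

end Height

/-- The number of the last marked point of the snake. -/
def lastPoint (r q : ℕ) : ℕ := (q + 1) * r + 1

/-- The angular coordinate of the snake, where `1` is a full turn in the base. -/
def snakeAng (n r q : ℕ) (u : ℂ) : ℝ :=
  height r q (lastPoint r q - ‖u‖) - n * u.arg / (2 * Real.pi)

/-- The radial coordinate of the snake. -/
def snakeRad (n r q : ℕ) (u : ℂ) : ℝ :=
  ‖u‖ + r * (height r q (lastPoint r q - ‖u‖) - q) -
    r * (clampOne (2 * ‖u‖ - 1) * (n * u.arg / (2 * Real.pi)))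

/-- The snake, as a function of the difference of the last marked point and the variable. -/
def snake (n r q : ℕ) (u : ℂ) : ℂ :=
  ((snakeRad n r q u ^ ((1 : ℝ) / n) : ℝ) : ℂ) *
    Complex.exp (-(2 * Real.pi * height r q (lastPoint r q - ‖u‖) / n * Complex.I)) * (u / ‖u‖)

/-- The thin neighbourhood of the positive half line on which the snake is used: a disk and a
sector. -/
def snakeDom (n r : ℕ) : Set ℂ :=
  {u | 1 / 2 ≤ ‖u‖ → |n * u.arg / (2 * Real.pi)| * (4 * (r + 1)) ≤ 1}

/-! ### Injectivity and continuity of the snake -/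

section Snake

variable {n r q : ℕ} {u v : ℂ}

theorem cast_lastPoint : ((lastPoint r q : ℕ) : ℝ) = (q + 1) * r + 1 := by
  simp [lastPoint]

theorem height_near (hq : r = 0 → q = 0) (h : ‖u‖ ≤ 1) :
    height r q (lastPoint r q - ‖u‖) = q :=
  height_top hq (by rw [cast_lastPoint]; linarith)

theorem snakeRad_near (hq : r = 0 → q = 0) (h : ‖u‖ ≤ 1 / 2) : snakeRad n r q u = ‖u‖ := by
  rw [snakeRad, height_near hq (by linarith), clampOne_of_le (by linarith)]
  ring

theorem mul_abs_le_of_mem (hu : u ∈ snakeDom n r) (h : 1 / 2 ≤ ‖u‖) :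
    |n * u.arg / (2 * Real.pi)| ≤ 1 / 4 ∧ r * |n * u.arg / (2 * Real.pi)| ≤ 1 / 4 := by
  have h1 := hu h
  have h2 := abs_nonneg (n * u.arg / (2 * Real.pi))
  have hr : (0 : ℝ) ≤ r := r.cast_nonneg
  constructor <;> nlinarith [mul_nonneg hr h2]

/-- The radius is coupled to the angle so that, once the angle is known, it determines `‖u‖`. The
cut-off removes the dependence on `u.arg` inside the disk of radius `1 / 2`, where the argument is
not continuous. -/
theorem snakeRad_eq (hq : r = 0 → q = 0) :
    snakeRad n r q u = ‖u‖ + r * (clampOne (2 * ‖u‖ - 1) * (snakeAng n r q u - q)) := by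
  rw [snakeRad, snakeAng]
  rcases le_total ‖u‖ 1 with h1 | h1
  · rw [height_near hq h1]
    ring
  · rw [clampOne_of_ge (by linarith)]
    ring

/-- On the axis the radius is at least `1` for `‖u‖ ≥ 1`, and the sector is so thin that the angular
term changes it by at most `1 / 4`. For `‖u‖` between `1 / 2` and `1` the cut-off `2‖u‖ - 1` makes
that term small enough. -/
theorem snakeRad_ge (hq : r = 0 → q = 0) (hu : u ∈ snakeDom n r) (h : 1 / 2 ≤ ‖u‖) :
    1 / 2 ≤ snakeRad n r q u := by
  have h1 := (mul_abs_le_of_mem hu h).2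
  have hr : (0 : ℝ) ≤ r := r.cast_nonneg
  have h2 : r * (n * u.arg / (2 * Real.pi)) ≤ 1 / 4 :=
    (mul_le_mul_of_nonneg_left (le_abs_self _) hr).trans h1
  have h3 : r * (clampOne (2 * ‖u‖ - 1) * (n * u.arg / (2 * Real.pi))) =
    clampOne (2 * ‖u‖ - 1) * (r * (n * u.arg / (2 * Real.pi))) := by ring
  rw [snakeRad, h3]
  rcases le_total ‖u‖ 1 with h4 | h4
  · rw [height_near hq h4, clampOne_of_mem (by linarith) (by linarith)]
    nlinarith
  · have := sub_height_le (r := r) (q := q) (t := lastPoint r q - ‖u‖)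
      (by rw [cast_lastPoint]; linarith)
    rw [clampOne_of_ge (by linarith)]
    rw [cast_lastPoint] at this ⊢
    linarith

theorem snakeRad_pos (hq : r = 0 → q = 0) (hu : u ∈ snakeDom n r) (h0 : u ≠ 0) :
    0 < snakeRad n r q u := by
  rcases le_total (1 / 2) ‖u‖ with h | h
  · linarith [snakeRad_ge hq hu h]
  · rw [snakeRad_near hq h]
    exact norm_pos_iff.2 h0

theorem snake_zero : snake n r q 0 = 0 := by simp [snake]

theorem snake_eq (hn : n ≠ 0) (h0 : u ≠ 0) : snake n r q u =
    ((snakeRad n r q u ^ ((1 : ℝ) / n) : ℝ) : ℂ) *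
      Complex.exp (-(2 * Real.pi * snakeAng n r q u / n * Complex.I)) := by
  have h1 : u / ‖u‖ = Complex.exp (u.arg * Complex.I) := by
    rw [div_eq_iff (by simpa using h0), mul_comm]
    exact (Complex.norm_mul_exp_arg_mul_I u).symm
  have h2 : (Real.pi : ℂ) ≠ 0 := by exact_mod_cast Real.pi_ne_zero
  have h3 : (n : ℂ) ≠ 0 := by exact_mod_cast hn
  rw [snake, h1, mul_assoc, ← Complex.exp_add]
  congr 2
  rw [snakeAng]
  push_cast
  field_simp
  ring

theorem norm_snake (hn : n ≠ 0) (hq : r = 0 → q = 0) (hu : u ∈ snakeDom n r) (h0 : u ≠ 0) :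
    ‖snake n r q u‖ = snakeRad n r q u ^ ((1 : ℝ) / n) := by
  rw [snake_eq hn h0, norm_mul, Complex.norm_real, Real.norm_of_nonneg
    (Real.rpow_nonneg (snakeRad_pos hq hu h0).le _)]
  have : -(2 * Real.pi * snakeAng n r q u / n * Complex.I) =
      ((-(2 * Real.pi * snakeAng n r q u / n) : ℝ) : ℂ) * Complex.I := by push_cast; ring
  rw [this, Complex.norm_exp_ofReal_mul_I, mul_one]

theorem snake_ne_zero (hn : n ≠ 0) (hq : r = 0 → q = 0) (hu : u ∈ snakeDom n r) (h0 : u ≠ 0) :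
    snake n r q u ≠ 0 := by
  rw [← norm_ne_zero_iff, norm_snake hn hq hu h0]
  exact (Real.rpow_pos_of_pos (snakeRad_pos hq hu h0) _).ne'

theorem snake_pow (hn : n ≠ 0) (hq : r = 0 → q = 0) (hu : u ∈ snakeDom n r) (h0 : u ≠ 0) :
    snake n r q u ^ n =
      snakeRad n r q u * Complex.exp (-(2 * Real.pi * snakeAng n r q u * Complex.I)) := by
  have h3 : (n : ℂ) ≠ 0 := by exact_mod_cast hn
  rw [snake_eq hn h0, mul_pow, ← Complex.ofReal_pow, ← Real.rpow_mul_natCast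
    (snakeRad_pos hq hu h0).le, one_div, inv_mul_cancel₀ (by exact_mod_cast hn), Real.rpow_one,
    ← Complex.exp_nat_mul]
  congr 2
  field_simp

theorem snakeAng_range (hu : u ∈ snakeDom n r) (h : 1 / 2 ≤ ‖u‖) :
    -(1 / 4) ≤ snakeAng n r q u ∧ snakeAng n r q u ≤ q + 1 / 4 := by
  have h1 := abs_le.1 (mul_abs_le_of_mem hu h).1
  have h2 := height_nonneg (r := r) (q := q) (t := lastPoint r q - ‖u‖)
  have h3 := height_le (r := r) (q := q) (t := lastPoint r q - ‖u‖)
  rw [snakeAng]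
  constructor <;> linarith

/-- For equal angles the radius is strictly increasing in `‖u‖`. Beyond `1` the cut-off is constant;
before that it has slope at most `2` and multiplies a term of size at most `1 / 4`, so it cannot
compensate the growth of `‖u‖`. -/
theorem snake_injOn_aux (hq : r = 0 → q = 0) (hu : u ∈ snakeDom n r)
    (hu1 : 1 / 2 ≤ ‖u‖)
    (hR : snakeRad n r q u = snakeRad n r q v) (hA : snakeAng n r q u = snakeAng n r q v)
    (huv : ‖u‖ ≤ ‖v‖) : ‖u‖ = ‖v‖ := by
  rw [snakeRad_eq hq, snakeRad_eq hq, ← hA] at hR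
  rcases le_total ‖u‖ 1 with h | h
  · have h1 : snakeAng n r q u - q = -(n * u.arg / (2 * Real.pi)) := by
      rw [snakeAng, height_near hq h]
      ring
    have h2 := (mul_abs_le_of_mem hu hu1).2
    have h3 : |r * (n * u.arg / (2 * Real.pi))| ≤ 1 / 4 := by
      rwa [abs_mul, abs_of_nonneg (r.cast_nonneg (α := ℝ))]
    rw [h1] at hR
    have h4 := abs_le.1 h3
    have h5 := clampOne_mono (by linarith : 2 * ‖u‖ - 1 ≤ 2 * ‖v‖ - 1)
    have h6 : clampOne (2 * ‖v‖ - 1) - clampOne (2 * ‖u‖ - 1) ≤ 2 * (‖v‖ - ‖u‖) := by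
      rw [clampOne_of_mem (x := 2 * ‖u‖ - 1) (by linarith) (by linarith)]
      have : clampOne (2 * ‖v‖ - 1) ≤ 2 * ‖v‖ - 1 := by
        rw [clampOne]
        exact max_le (by linarith) (min_le_right _ _)
      linarith
    nlinarith
  · rw [clampOne_of_ge (by linarith), clampOne_of_ge (by linarith)] at hR
    linarith

/-- Equal values give equal radii and angles that agree modulo `n`. Radii separate the inner disk
from the rest: below `1 / 2` inside, at least `1 / 2` outside. Outside, the angle is then recovered
exactly, and with it first `‖u‖` and then `u.arg`. -/
theorem snake_injOn (hn : n ≠ 0) (hq : r = 0 → q = 0) (hqn : q < n) :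
    Set.InjOn (snake n r q) (snakeDom n r) := by
  intro u hu v hv huv
  by_cases hu0 : u = 0
  · by_contra h
    rw [hu0, snake_zero] at huv
    exact snake_ne_zero hn hq hv (fun h0 => h (hu0.trans h0.symm)) huv.symm
  by_cases hv0 : v = 0
  · rw [hv0, snake_zero] at huv
    exact absurd huv (snake_ne_zero hn hq hu hu0)
  have hn' : (n : ℝ) ≠ 0 := by exact_mod_cast hn
  have hnc : (n : ℂ) ≠ 0 := by exact_mod_cast hn
  have hpi : (Real.pi : ℂ) ≠ 0 := by exact_mod_cast Real.pi_ne_zero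
  have hnorm : snakeRad n r q u ^ ((1 : ℝ) / n) = snakeRad n r q v ^ ((1 : ℝ) / n) := by
    rw [← norm_snake hn hq hu hu0, ← norm_snake hn hq hv hv0, huv]
  have hR : snakeRad n r q u = snakeRad n r q v := by
    refine (Real.rpow_left_inj (snakeRad_pos hq hu hu0).le (snakeRad_pos hq hv hv0).le ?_).1 hnorm
    positivity
  have hexp : ∃ m : ℤ, snakeAng n r q u = snakeAng n r q v + n * m := by
    rw [snake_eq hn hu0, snake_eq hn hv0, hnorm] at huv
    have h1 := mul_left_cancel₀ (by
      exact_mod_cast (Real.rpow_pos_of_pos (snakeRad_pos hq hv hv0) _).ne') huv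
    obtain ⟨m, hm⟩ := Complex.exp_eq_exp_iff_exists_int.1 h1
    refine ⟨-m, ?_⟩
    field_simp at hm
    have h2 : (snakeAng n r q u : ℂ) = snakeAng n r q v + n * (-m : ℂ) := by
      linear_combination -hm
    have h3 : snakeAng n r q u = snakeAng n r q v + n * (-m : ℝ) := by exact_mod_cast h2
    simpa using h3
  have hfin : ‖u‖ = ‖v‖ → u.arg = v.arg → u = v := fun h1 h2 => by
    rw [← Complex.norm_mul_exp_arg_mul_I u, ← Complex.norm_mul_exp_arg_mul_I v, h1, h2]
  obtain ⟨m, hm⟩ := hexp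
  have hn0 : (0 : ℝ) < n := by exact_mod_cast Nat.pos_of_ne_zero hn
  rcases lt_or_ge ‖u‖ (1 / 2) with h1 | h1 <;> rcases lt_or_ge ‖v‖ (1 / 2) with h2 | h2
  · rw [snakeRad_near hq h1.le, snakeRad_near hq h2.le] at hR
    refine hfin hR ?_
    rw [snakeAng, snakeAng, height_near hq (by linarith), height_near hq (by linarith)] at hm
    have h3 : u.arg = v.arg - 2 * Real.pi * m := by
      field_simp at hm
      exact mul_left_cancel₀ hn' (by linarith)
    have h4 := Complex.arg_mem_Ioc u
    have h5 := Complex.arg_mem_Ioc v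
    have h6 : m = 0 := by
      have hp := Real.pi_pos
      have h7 : (m : ℝ) < 1 := by nlinarith [h4.1, h4.2, h5.1, h5.2]
      have h8 : (-1 : ℝ) < m := by nlinarith [h4.1, h4.2, h5.1, h5.2]
      have h7 : m < 1 := by exact_mod_cast h7
      have h8 : -1 < m := by exact_mod_cast h8
      omega
    simpa [h6] using h3
  · rw [snakeRad_near hq h1.le] at hR
    linarith [snakeRad_ge hq hv h2]
  · rw [snakeRad_near hq h2.le] at hR
    linarith [snakeRad_ge hq hu h1]
  · have h3 := snakeAng_range (q := q) hu h1
    have h4 := snakeAng_range (q := q) hv h2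
    -- The angles fill an interval of length `q + 1 / 2 < n`, so congruence modulo `n` is equality.
    have hqn' : (q : ℝ) + 1 ≤ n := by exact_mod_cast hqn
    have h6 : m = 0 := by
      have h7 : (m : ℝ) < 1 := by nlinarith
      have h8 : (-1 : ℝ) < m := by nlinarith
      have h7 : m < 1 := by exact_mod_cast h7
      have h8 : -1 < m := by exact_mod_cast h8
      omega
    have hA : snakeAng n r q u = snakeAng n r q v := by simpa [h6] using hm
    have hN : ‖u‖ = ‖v‖ := by
      rcases le_total ‖u‖ ‖v‖ with h | h
      · exact snake_injOn_aux hq hu h1 hR hA h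
      · exact (snake_injOn_aux hq hv h2 hR.symm hA.symm h).symm
    refine hfin hN ?_
    rw [snakeAng, snakeAng, hN] at hA
    field_simp at hA
    have hp := Real.pi_pos
    have : (n : ℝ) * u.arg = n * v.arg := by linarith
    exact mul_left_cancel₀ hn' this

theorem mem_slitPlane_of_mem (hn : n ≠ 0) (hu : u ∈ snakeDom n r) (h : 1 / 2 ≤ ‖u‖) :
    u ∈ Complex.slitPlane := by
  rw [Complex.mem_slitPlane_iff_arg]
  refine ⟨fun h1 => ?_, fun h1 => by norm_num [h1] at h⟩
  have h2 := (mul_abs_le_of_mem hu h).1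
  have hn' : (1 : ℝ) ≤ n := by exact_mod_cast Nat.one_le_iff_ne_zero.2 hn
  have hp := Real.pi_pos
  rw [h1, abs_of_nonneg (by positivity), div_le_iff₀ (by positivity)] at h2
  nlinarith

/-- Where the argument may jump, that is for `‖u‖ < 1 / 2`, its coefficient vanishes identically;
elsewhere the domain lies in the slit plane. -/
theorem continuousAt_snakeRad (hn : n ≠ 0) (hu : u ∈ snakeDom n r) :
    ContinuousAt (snakeRad n r q) u := by
  have hh := continuous_height (r := r) (q := q)
  have hc := continuous_clampOne
  have h1 : ContinuousAt (fun u : ℂ => clampOne (2 * ‖u‖ - 1) * (n * u.arg / (2 * Real.pi))) u := by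
    rcases lt_or_ge ‖u‖ (1 / 2) with h | h
    · have : (fun _ => 0) =ᶠ[nhds u]
          fun u : ℂ => clampOne (2 * ‖u‖ - 1) * (n * u.arg / (2 * Real.pi)) := by
        filter_upwards [(isOpen_lt continuous_norm continuous_const).mem_nhds h] with v hv
        have hv : ‖v‖ < 1 / 2 := hv
        rw [clampOne_of_le (by linarith), zero_mul]
      exact continuousAt_const.congr this
    · have := Complex.continuousAt_arg (mem_slitPlane_of_mem hn hu h)
      fun_prop
  unfold snakeRad
  fun_prop

theorem continuousOn_snake (hn : n ≠ 0) (hq : r = 0 → q = 0) :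
    ContinuousOn (snake n r q) (snakeDom n r) := by
  intro u hu
  refine ContinuousAt.continuousWithinAt ?_
  have hh := continuous_height (r := r) (q := q)
  have hn' : (0 : ℝ) < 1 / n := by
    have : (0 : ℝ) < n := by exact_mod_cast Nat.pos_of_ne_zero hn
    positivity
  by_cases h0 : u = 0
  · subst h0
    -- The direction `u / ‖u‖` has no limit at `0`, but the norm is `‖u‖ ^ (1 / n)` there.
    rw [ContinuousAt, snake_zero, tendsto_zero_iff_norm_tendsto_zero]
    have h1 : Filter.Tendsto (fun u : ℂ => ‖u‖ ^ ((1 : ℝ) / n)) (nhds 0) (nhds 0) := by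
      have := (continuous_norm.rpow_const (fun _ : ℂ => .inr hn'.le)).tendsto (0 : ℂ)
      rwa [norm_zero, Real.zero_rpow hn'.ne'] at this
    refine h1.congr' ?_
    filter_upwards [Metric.ball_mem_nhds (0 : ℂ) (by norm_num : (0 : ℝ) < 1 / 2)] with v hv
    have hv : ‖v‖ < 1 / 2 := by simpa using hv
    by_cases hv0 : v = 0
    · subst hv0
      rw [snake_zero, norm_zero, Real.zero_rpow hn'.ne']
    · rw [norm_snake hn hq (fun h => absurd hv (not_lt.2 h)) hv0, snakeRad_near hq hv.le]
  · have h1 := continuousAt_snakeRad (q := q) hn hu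
    have h2 : ContinuousAt (fun u => snakeRad n r q u ^ ((1 : ℝ) / n)) u :=
      h1.rpow_const (.inr hn'.le)
    have h3 : ContinuousAt (fun u : ℂ => u / (‖u‖ : ℂ)) u :=
      continuousAt_id.div (by fun_prop) (by simpa using h0)
    unfold snake
    refine (ContinuousAt.mul ?_ ?_).mul h3
    · exact Complex.continuous_ofReal.continuousAt.comp h2
    · fun_prop

end Snake

/-! ### The model of the covering -/

/-- The closed stadium of radius `ε` around `[0, k]`. -/
def stadium (ε : ℝ) (k : ℕ) : Set ℂ := Metric.cthickening ε (segment ℝ (0 : ℂ) (k : ℂ))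

section Stadium

variable {ε : ℝ} {k : ℕ}

theorem convex_stadium : Convex ℝ (stadium ε k) := (convex_segment _ _).cthickening _

theorem exists_of_mem_stadium (hε : 0 ≤ ε) {z : ℂ} (hz : z ∈ stadium ε k) :
    ∃ x : ℝ, 0 ≤ x ∧ x ≤ k ∧ dist z x ≤ ε := by
  have hc : IsCompact (segment ℝ (0 : ℂ) (k : ℂ)) := by
    rw [segment_eq_image']
    exact isCompact_Icc.image (by fun_prop)
  rw [stadium, hc.cthickening_eq_biUnion_closedBall hε, Set.mem_iUnion₂] at hz
  obtain ⟨w, hw, hz⟩ := hz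
  rw [segment_eq_image'] at hw
  obtain ⟨θ, hθ, rfl⟩ := hw
  have hk : (0 : ℝ) ≤ k := k.cast_nonneg
  refine ⟨θ * k, mul_nonneg hθ.1 hk, by nlinarith [hθ.2], ?_⟩
  simpa using hz

theorem ball_subset_stadium {i : ℕ} (hi : i < k) :
    Metric.closedBall ((i + 1 : ℕ) : ℂ) ε ⊆ stadium ε k := fun z hz => by
  refine mem_stadium (x := ((i + 1 : ℕ) : ℝ)) (by positivity) (by exact_mod_cast hi) ?_
  rw [Complex.ofReal_natCast]
  exact hz

theorem ofReal_mem_stadium (hε : 0 ≤ ε) {x : ℝ} (h0 : 0 ≤ x) (h1 : x ≤ k) :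
    (x : ℂ) ∈ stadium ε k := mem_stadium h0 h1 (by simpa using hε)

theorem zero_mem_stadium (hε : 0 ≤ ε) : (0 : ℂ) ∈ stadium ε k := by
  simpa using ofReal_mem_stadium hε le_rfl (k.cast_nonneg (α := ℝ))

theorem zero_mem_stadium_diff (hε : 0 ≤ ε) : (0 : ℂ) ∈ stadium ε k \ marked k :=
  ⟨zero_mem_stadium hε, zero_notMem_marked k⟩

theorem bigon_stadium (hε : 0 < ε) :
    Bigon (⟨0, zero_mem_stadium_diff hε.le⟩ : ↥(stadium ε k \ marked k)) (lowerPart _)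
      (upperPart _) := by
  have h : ∀ s : ℝ, |s| ≤ ε → (s * Complex.I : ℂ) ∈ stadium ε k := fun s hs =>
    mem_stadium (x := 0) le_rfl k.cast_nonneg (by simpa using hs)
  refine bigon_punctured convex_stadium (h (-ε) ?_) (h ε ?_) ?_ ?_ _ <;>
    simp [abs_of_pos hε, hε]

theorem bigon_plane : Bigon (⟨0, ⟨Set.mem_univ _, zero_notMem_marked k⟩⟩ :
    ↥((Set.univ : Set ℂ) \ marked k)) (lowerPart _) (upperPart _) :=
  bigon_punctured convex_univ (Set.mem_univ (-Complex.I)) (Set.mem_univ Complex.I) (by simp)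
    (by simp) _

end Stadium

theorem abs_arcsin_le {x : ℝ} (h : |x| ≤ 1) : |Real.arcsin x| ≤ Real.pi / 2 * |x| := by
  wlog h0 : 0 ≤ x generalizing x
  · have := this (x := -x) (by rwa [abs_neg]) (by linarith)
    rwa [Real.arcsin_neg, abs_neg, abs_neg] at this
  rw [abs_of_nonneg h0] at h
  have h1 := Real.arcsin_nonneg.2 h0
  have h2 := Real.mul_le_sin h1 (Real.arcsin_le_pi_div_two x)
  rw [Real.sin_arcsin (by linarith) h] at h2
  rw [abs_of_nonneg h0, abs_of_nonneg h1]
  have hp := Real.pi_pos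
  rw [div_mul_eq_mul_div, div_le_iff₀ hp] at h2
  linarith

/-- The bounds force `u.re ≥ 0`, so the argument is `arcsin (u.im / ‖u‖)`, and Jordan's inequality
bounds it linearly. -/
theorem abs_arg_le {u : ℂ} {ε : ℝ} (hre : -(1 / 4) ≤ u.re) (him : |u.im| ≤ ε) (hε : ε ≤ 1 / 4)
    (hu : 1 / 2 ≤ ‖u‖) : |u.arg| ≤ Real.pi * ε := by
  have hsq : ‖u‖ ^ 2 = u.re ^ 2 + u.im ^ 2 := by
    rw [Complex.sq_norm, Complex.normSq_apply]
    ring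
  have h1 : u.im ^ 2 ≤ (1 / 4) ^ 2 := by
    rw [← sq_abs]
    exact pow_le_pow_left₀ (abs_nonneg _) (him.trans hε) 2
  have h2 : 0 ≤ u.re := by
    by_contra h
    nlinarith
  have hpos : 0 < ‖u‖ := by linarith
  have h3 : |u.im / ‖u‖| ≤ 2 * ε := by
    rw [abs_div, abs_norm, div_le_iff₀ hpos]
    nlinarith [abs_nonneg u.im]
  rw [Complex.arg_of_re_nonneg h2]
  refine (abs_arcsin_le (h3.trans (by linarith))).trans ?_
  nlinarith [Real.pi_pos]

/-- The admissible radii of the stadium of the snake. -/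
structure SnakeData (n r q : ℕ) (ε : ℝ) : Prop where
  n_ne : n ≠ 0
  q_eq : r = 0 → q = 0
  q_lt : q < n
  ε_pos : 0 < ε
  ε_le : 8 * n * (r + 1) * ε ≤ 1

/-! ### The model of the covering on the stadium of the snake -/

section Theta

variable {n r q : ℕ} {ε : ℝ}

theorem SnakeData.n_ge (D : SnakeData n r q ε) : (1 : ℝ) ≤ n := by
  exact_mod_cast Nat.one_le_iff_ne_zero.2 D.n_ne

theorem SnakeData.ε_le' (D : SnakeData n r q ε) : ε ≤ 1 / 8 ∧ n * ε ≤ 1 / 8 := by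
  have h1 := D.n_ge
  have h2 : (0 : ℝ) ≤ r := r.cast_nonneg
  have h3 := D.ε_pos
  have h4 := D.ε_le
  have h5 : n * ε ≤ n * ε * (r + 1) := by
    have : 0 ≤ n * ε := by positivity
    nlinarith
  constructor <;> nlinarith

/-- Outside the disk the argument is at most `π * ε`, so the angular width is at most `n * ε / 2`;
the bound on `ε` in `SnakeData` makes this small compared with `1 / (r + 1)`. -/
theorem SnakeData.sub_mem (D : SnakeData n r q ε) {z : ℂ}
    (hz : z ∈ stadium ε (lastPoint r q)) : (lastPoint r q : ℂ) - z ∈ snakeDom n r := by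
  intro hR
  obtain ⟨x, h0, h1, h2⟩ := exists_of_mem_stadium D.ε_pos.le hz
  have hε := D.ε_le'.1
  rw [dist_eq_norm] at h2
  have hre := (Complex.abs_re_le_norm (z - x)).trans h2
  have him := (Complex.abs_im_le_norm (z - x)).trans h2
  simp only [Complex.sub_re, Complex.sub_im, Complex.ofReal_re, Complex.ofReal_im, sub_zero]
    at hre him
  have h3 := abs_arg_le (ε := ε) (u := (lastPoint r q : ℂ) - z)
    (by simp; linarith [(abs_le.1 hre).2]) (by simpa using him) (by linarith) hR
  have hp := Real.pi_pos
  have hn := D.n_ge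
  rw [abs_div, abs_mul, Nat.abs_cast, abs_of_pos (by positivity : 0 < 2 * Real.pi),
    div_mul_eq_mul_div, div_le_one (by positivity)]
  have h4 := mul_le_mul_of_nonneg_left h3 (by positivity : (0 : ℝ) ≤ n * (4 * (r + 1)))
  nlinarith [D.ε_le]

/-- The map of the stadium of the snake to the model of the base. -/
def theta (n r q : ℕ) (z : ℂ) : ℂ := ((r + 1 : ℕ) : ℂ) - snake n r q (lastPoint r q - z) ^ n

theorem mem_snakeDom_ofReal {x : ℝ} (hx : 0 ≤ x) : (x : ℂ) ∈ snakeDom n r := fun _ => by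
  simp [Complex.arg_ofReal_of_nonneg hx]

theorem snakeAng_ofReal {x : ℝ} (hx : 0 ≤ x) :
    snakeAng n r q x = height r q (lastPoint r q - x) := by
  simp [snakeAng, Complex.arg_ofReal_of_nonneg hx, abs_of_nonneg hx]

theorem snakeRad_ofReal {x : ℝ} (hx : 0 ≤ x) :
    snakeRad n r q x = x + r * (height r q (lastPoint r q - x) - q) := by
  simp [snakeRad, Complex.arg_ofReal_of_nonneg hx, abs_of_nonneg hx]

/-- The side of the real axis in the base is thus read off from the angle modulo `1`: the upper side
for angles in `[0, 1 / 2]`, the lower side for angles in `[1 / 2, 1]`. -/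
theorem theta_im (hn : n ≠ 0) (hq : r = 0 → q = 0) {z : ℂ}
    (hz : (lastPoint r q : ℂ) - z ∈ snakeDom n r) (h0 : (lastPoint r q : ℂ) - z ≠ 0) :
    (theta n r q z).im = snakeRad n r q (lastPoint r q - z) *
      Real.sin (2 * Real.pi * snakeAng n r q (lastPoint r q - z)) := by
  rw [theta, snake_pow hn hq hz h0]
  have : -(2 * Real.pi * snakeAng n r q (lastPoint r q - z) * Complex.I) =
      ((-(2 * Real.pi * snakeAng n r q (lastPoint r q - z)) : ℝ) : ℂ) * Complex.I := by
    push_cast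
    ring
  rw [this, Complex.sub_im, Complex.natCast_im, Complex.im_ofReal_mul,
    Complex.exp_ofReal_mul_I_im, Real.sin_neg]
  ring

theorem theta_of_ang_int (hn : n ≠ 0) (hq : r = 0 → q = 0) {z : ℂ}
    (hz : (lastPoint r q : ℂ) - z ∈ snakeDom n r) (h0 : (lastPoint r q : ℂ) - z ≠ 0) {j : ℤ}
    (hj : snakeAng n r q (lastPoint r q - z) = j) :
    theta n r q z = ((r + 1 - snakeRad n r q (lastPoint r q - z) : ℝ) : ℂ) := by
  rw [theta, snake_pow hn hq hz h0, hj]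
  have : -(2 * Real.pi * ((j : ℝ) : ℂ) * Complex.I) = ((-j : ℤ) : ℂ) * (2 * Real.pi * Complex.I) := by
    push_cast
    ring
  rw [this, Complex.exp_int_mul_two_pi_mul_I]
  push_cast
  ring

theorem theta_of_ang_half (hn : n ≠ 0) (hq : r = 0 → q = 0) {z : ℂ}
    (hz : (lastPoint r q : ℂ) - z ∈ snakeDom n r) (h0 : (lastPoint r q : ℂ) - z ≠ 0) {j : ℤ}
    (hj : snakeAng n r q (lastPoint r q - z) = j + 1 / 2) :
    theta n r q z = ((r + 1 + snakeRad n r q (lastPoint r q - z) : ℝ) : ℂ) := by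
  rw [theta, snake_pow hn hq hz h0, hj]
  have : -(2 * Real.pi * ((j + 1 / 2 : ℝ) : ℂ) * Complex.I) =
      ((-j - 1 : ℤ) : ℂ) * (2 * Real.pi * Complex.I) + Real.pi * Complex.I := by
    push_cast
    ring
  rw [this, Complex.exp_add, Complex.exp_int_mul_two_pi_mul_I, Complex.exp_pi_mul_I]
  push_cast
  ring

theorem snake_natCast (hn : n ≠ 0) {i j : ℕ} (hi : 1 ≤ i) (hir : i ≤ r)
    (hj : j ≤ q) :
    snakeRad n r q (((lastPoint r q : ℝ) - (j * r + i : ℕ) : ℝ) : ℂ) = r + 1 - i ∧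
    snakeAng n r q (((lastPoint r q : ℝ) - (j * r + i : ℕ) : ℝ) : ℂ) = j ∧
    snake n r q (((lastPoint r q : ℝ) - (j * r + i : ℕ) : ℝ) : ℂ) =
      (((r + 1 - i : ℝ) ^ ((1 : ℝ) / n) : ℝ) : ℂ) *
        Complex.exp (-(2 * Real.pi * j / n * Complex.I)) := by
  have h1 : (1 : ℝ) ≤ i := by exact_mod_cast hi
  have h2 : (i : ℝ) ≤ r := by exact_mod_cast hir
  have h3 : (j : ℝ) ≤ q := by exact_mod_cast hj
  have h4 : 0 < (lastPoint r q : ℝ) - (j * r + i : ℕ) := by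
    rw [cast_lastPoint]
    push_cast
    nlinarith
  have h5 : height r q (j * r + i) = j := height_plateau hj (by linarith) (by linarith)
  have h6 : snakeRad n r q (((lastPoint r q : ℝ) - (j * r + i : ℕ) : ℝ) : ℂ) = r + 1 - i := by
    rw [snakeRad_ofReal h4.le, sub_sub_cancel]
    push_cast
    rw [h5, cast_lastPoint]
    ring
  have h7 : snakeAng n r q (((lastPoint r q : ℝ) - (j * r + i : ℕ) : ℝ) : ℂ) = j := by
    rw [snakeAng_ofReal h4.le, sub_sub_cancel]
    push_cast
    rw [h5]
  refine ⟨h6, h7, ?_⟩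
  rw [snake_eq hn (by exact_mod_cast h4.ne'), h6, h7]
  push_cast
  rfl

/-- A point over the marked point `i ≤ r` has radius `r + 1 - i` and an integral angle `m`, and the
range of the angles gives `0 ≤ m ≤ q`. The marked point `m * r + i` has the same snake value, so
injectivity identifies the two. Over `r + 1` lies only the centre. -/
theorem theta_notMem_marked (D : SnakeData n r q ε) {z : ℂ}
    (hz : z ∈ stadium ε (lastPoint r q) \ marked (lastPoint r q)) :
    theta n r q z ∉ marked (r + 1) := by
  intro h
  apply hz.2
  have hn := D.n_ne
  have hq := D.q_eq
  have hdom := D.sub_mem hz.1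
  rw [mem_marked] at h ⊢
  obtain ⟨i, hi1, hi2, hi⟩ := h
  by_cases h0 : (lastPoint r q : ℂ) - z = 0
  · exact ⟨lastPoint r q, by simp [lastPoint], le_rfl, (sub_eq_zero.1 h0).symm⟩
  have hrad := snakeRad_pos hq hdom h0
  have hval : snake n r q (lastPoint r q - z) ^ n = ((r + 1 - i : ℝ) : ℂ) := by
    rw [theta] at hi
    push_cast at hi ⊢
    linear_combination -hi
  have hnorm : snakeRad n r q (lastPoint r q - z) = r + 1 - i := by
    have h1 := congrArg norm hval
    have h2 : (0 : ℝ) ≤ r + 1 - i := by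
      have : (i : ℝ) ≤ ((r + 1 : ℕ) : ℝ) := by exact_mod_cast hi2
      push_cast at this
      linarith
    rw [norm_pow, norm_snake hn hq hdom h0, Complex.norm_real, Real.norm_of_nonneg h2,
      ← Real.rpow_mul_natCast hrad.le, one_div, inv_mul_cancel₀ (by exact_mod_cast hn),
      Real.rpow_one] at h1
    exact h1
  have hir : i ≤ r := by
    by_contra hcon
    obtain rfl : i = r + 1 := by omega
    push_cast at hnorm
    linarith
  have hir' : (i : ℝ) ≤ r := by exact_mod_cast hir
  -- The radius is at least `1` here, while in the inner disk it is `‖u‖ < 1 / 2`.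
  have hR : 1 / 2 ≤ ‖(lastPoint r q : ℂ) - z‖ := by
    by_contra hcon
    rw [snakeRad_near hq (not_le.1 hcon).le] at hnorm
    linarith
  obtain ⟨m, hm⟩ : ∃ m : ℤ, snakeAng n r q (lastPoint r q - z) = m := by
    rw [snake_pow hn hq hdom h0, hnorm] at hval
    have h1 : ((r + 1 - i : ℝ) : ℂ) ≠ 0 := by
      rw [← hnorm]
      exact_mod_cast hrad.ne'
    have h2 := (mul_eq_left₀ h1).1 hval
    obtain ⟨m, hm⟩ := Complex.exp_eq_one_iff.1 h2
    refine ⟨-m, ?_⟩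
    have hpi : (2 * Real.pi * Complex.I : ℂ) ≠ 0 := by simp [Real.pi_ne_zero]
    have h3 : (snakeAng n r q (lastPoint r q - z) : ℂ) = -m :=
      mul_right_cancel₀ hpi (by linear_combination -hm)
    exact_mod_cast h3
  have hrange := snakeAng_range (q := q) hdom hR
  rw [hm] at hrange
  have hm0 : 0 ≤ m := by
    have : (-1 : ℝ) < m := by linarith
    have : -1 < m := by exact_mod_cast this
    omega
  have hmq : m ≤ q := by
    have : (m : ℝ) < q + 1 := by linarith
    have : m < q + 1 := by exact_mod_cast this
    omega
  lift m to ℕ using hm0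
  have hmq : m ≤ q := by exact_mod_cast hmq
  obtain ⟨e1, e2, -⟩ := snake_natCast (n := n) (r := r) hn hi1 hir hmq
  have hle : m * r + i ≤ lastPoint r q := by
    rw [lastPoint]
    nlinarith
  have h4 : (0 : ℝ) < (lastPoint r q : ℝ) - (m * r + i : ℕ) := by
    have : m * r + i < lastPoint r q := by
      rw [lastPoint]
      nlinarith
    have : ((m * r + i : ℕ) : ℝ) < lastPoint r q := by exact_mod_cast this
    linarith
  refine ⟨m * r + i, by omega, hle, ?_⟩
  have := snake_injOn hn hq D.q_lt hdom (mem_snakeDom_ofReal h4.le) (by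
    rw [snake_eq hn h0, snake_eq hn (by exact_mod_cast h4.ne'), e1, e2, hm, hnorm]
    simp)
  push_cast at this ⊢
  linear_combination -this

theorem continuousOn_snake_sub (D : SnakeData n r q ε) :
    ContinuousOn (fun z : ℂ => snake n r q (lastPoint r q - z)) (stadium ε (lastPoint r q)) :=
  (continuousOn_snake D.n_ne D.q_eq).comp (by fun_prop) fun _ hz => D.sub_mem hz

/-- The map of the punctured stadium to the punctured plane. -/
def thetaMap (D : SnakeData n r q ε) :
    C(↥(stadium ε (lastPoint r q) \ marked (lastPoint r q)),
      ↥((Set.univ : Set ℂ) \ marked (r + 1))) where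
  toFun z := ⟨theta n r q z, Set.mem_univ _, theta_notMem_marked D z.2⟩
  continuous_toFun := by
    refine Continuous.subtype_mk ?_ _
    have h1 : ContinuousOn (theta n r q) (stadium ε (lastPoint r q) \ marked (lastPoint r q)) :=
      continuousOn_const.sub (((continuousOn_snake_sub D).mono Set.sdiff_subset).pow n)
    exact continuousOn_iff_continuous_domRestrict.1 h1

/-- On the axis, at a time when the snake is on the sheet number `j`. -/
theorem theta_ofReal (hn : n ≠ 0) (hq : r = 0 → q = 0) {x : ℝ} (hx : x < lastPoint r q) {j : ℕ}
    (hj : height r q x = j) : theta n r q x = ((x - r * j : ℝ) : ℂ) := by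
  have h1 : 0 < (lastPoint r q : ℝ) - x := by linarith
  have h2 : (lastPoint r q : ℂ) - x = (((lastPoint r q : ℝ) - x : ℝ) : ℂ) := by push_cast; rfl
  rw [theta_of_ang_int hn hq (j := j)]
  · rw [h2, snakeRad_ofReal h1.le, sub_sub_cancel, hj, cast_lastPoint]
    congr 1
    ring
  · rw [h2]
    exact mem_snakeDom_ofReal h1.le
  · rw [h2]
    exact_mod_cast h1.ne'
  · rw [h2, snakeAng_ofReal h1.le, sub_sub_cancel, hj]
    simp

end Theta

/-! ### Paths along the snake -/

/-- The point at time `t` and angle `α`, in polar coordinates around the last marked point. -/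
def polarPt (r q : ℕ) (t α : ℝ) : ℂ :=
  (lastPoint r q : ℂ) - (((lastPoint r q : ℝ) - t : ℝ) : ℂ) * Complex.exp (α * Complex.I)

theorem polarPt_zero {r q : ℕ} (t : ℝ) : polarPt r q t 0 = t := by
  simp [polarPt]

section Piece

variable {n r q : ℕ} {ε : ℝ}

/-- The angle of the paths that run close to the axis of the snake. -/
def smallAngle (r q : ℕ) (ε : ℝ) : ℝ := ε / lastPoint r q

/-- The height of the small angle. -/
def smallHeight (n r q : ℕ) (ε : ℝ) : ℝ := n * smallAngle r q ε / (2 * Real.pi)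

theorem one_le_lastPoint : (1 : ℝ) ≤ lastPoint r q := by
  rw [cast_lastPoint]
  have : (0 : ℝ) ≤ (q + 1) * r := by positivity
  linarith

theorem SnakeData.smallAngle_pos (D : SnakeData n r q ε) : 0 < smallAngle r q ε :=
  div_pos D.ε_pos (zero_lt_one.trans_le one_le_lastPoint)

theorem SnakeData.smallAngle_le (D : SnakeData n r q ε) : smallAngle r q ε ≤ ε :=
  div_le_self D.ε_pos.le one_le_lastPoint

theorem SnakeData.smallHeight_pos (D : SnakeData n r q ε) : 0 < smallHeight n r q ε := by
  have := D.smallAngle_pos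
  have := D.n_ge
  have := Real.pi_pos
  unfold smallHeight
  positivity

theorem SnakeData.smallHeight_le (D : SnakeData n r q ε) : smallHeight n r q ε ≤ 1 / 8 := by
  have h1 := D.smallAngle_le
  have h2 := D.n_ge
  have h3 := D.ε_le'.2
  have h4 := Real.pi_gt_three
  have h5 : n * smallAngle r q ε ≤ n * ε := mul_le_mul_of_nonneg_left h1 (by linarith)
  rw [smallHeight, div_le_iff₀ (by positivity)]
  nlinarith

/-- The points of the punctured stadium on the side `s` of the real axis whose image in the model
of the base is on the side `s'` of the real axis; the upper side is `1`, the lower side `-1`. -/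
def pieceSet (n r q : ℕ) (ε s s' : ℝ) : Set ℂ :=
  {z | z ∈ stadium ε (lastPoint r q) \ marked (lastPoint r q) ∧ 0 ≤ s * z.im ∧
    0 ≤ s' * (theta n r q z).im}

theorem lastPoint_sub_polarPt (t α : ℝ) : (lastPoint r q : ℂ) - polarPt r q t α =
    (((lastPoint r q : ℝ) - t : ℝ) : ℂ) * Complex.exp (α * Complex.I) := by
  rw [polarPt, sub_sub_cancel]

theorem polarPt_im (t α : ℝ) :
    (polarPt r q t α).im = -(((lastPoint r q : ℝ) - t) * Real.sin α) := by
  rw [polarPt, Complex.sub_im, Complex.natCast_im, Complex.im_ofReal_mul,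
    Complex.exp_ofReal_mul_I_im, zero_sub]

theorem polarPt_re (t α : ℝ) :
    (polarPt r q t α).re = lastPoint r q - ((lastPoint r q : ℝ) - t) * Real.cos α := by
  rw [polarPt, Complex.sub_re, Complex.natCast_re, Complex.re_ofReal_mul,
    Complex.exp_ofReal_mul_I_re]

theorem polarPt_mem_stadium (D : SnakeData n r q ε) {t α : ℝ} (h0 : 0 ≤ t)
    (h1 : t < lastPoint r q) (hα : |α| ≤ smallAngle r q ε) :
    polarPt r q t α ∈ stadium ε (lastPoint r q) := by
  have hp := one_le_lastPoint (r := r) (q := q)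
  have hε := D.ε_le'.1
  have hα1 := hα.trans D.smallAngle_le
  have hcos : 0 ≤ Real.cos α := Real.cos_nonneg_of_mem_Icc
    ⟨by linarith [(abs_le.1 hα1).1, Real.pi_gt_three], by linarith [(abs_le.1 hα1).2, Real.pi_gt_three]⟩
  have hcos1 := Real.cos_le_one α
  refine mem_stadium (x := (polarPt r q t α).re) ?_ ?_ ?_
  · rw [polarPt_re]
    nlinarith
  · rw [polarPt_re]
    nlinarith
  · rw [dist_eq_norm]
    have h2 : polarPt r q t α - ((polarPt r q t α).re : ℂ) =
        ((polarPt r q t α).im : ℂ) * Complex.I := by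
      apply Complex.ext <;> simp
    rw [h2, norm_mul, Complex.norm_I, mul_one, Complex.norm_real, Real.norm_eq_abs, polarPt_im,
      abs_neg, abs_mul, abs_of_pos (by linarith : 0 < (lastPoint r q : ℝ) - t)]
    have h3 : |Real.sin α| ≤ smallAngle r q ε := (Real.abs_sin_le_abs).trans hα
    -- The small angle is chosen so that even at the far end, at distance `lastPoint` from the
    -- centre, the path stays within `ε` of the axis.
    have h4 : (lastPoint r q : ℝ) * smallAngle r q ε = ε := by
      rw [smallAngle]
      field_simp
    have h5 := D.smallAngle_pos
    nlinarith [abs_nonneg (Real.sin α)]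

theorem polar_sub_ne_zero {t α : ℝ} (h1 : t < lastPoint r q) :
    (lastPoint r q : ℂ) - polarPt r q t α ≠ 0 := by
  rw [lastPoint_sub_polarPt]
  refine mul_ne_zero ?_ (Complex.exp_ne_zero _)
  exact_mod_cast (by linarith : 0 < (lastPoint r q : ℝ) - t).ne'

theorem norm_polar {t α : ℝ} (h1 : t < lastPoint r q) :
    ‖(lastPoint r q : ℂ) - polarPt r q t α‖ = lastPoint r q - t := by
  rw [lastPoint_sub_polarPt, norm_mul, Complex.norm_real, Complex.norm_exp_ofReal_mul_I, mul_one,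
    Real.norm_of_nonneg (by linarith)]

theorem snakeAng_polar (D : SnakeData n r q ε) {t α : ℝ} (h1 : t < lastPoint r q)
    (hα : |α| ≤ smallAngle r q ε) :
    snakeAng n r q ((lastPoint r q : ℂ) - polarPt r q t α) =
      height r q t - n * α / (2 * Real.pi) := by
  have hε := D.ε_le'.1
  have hα1 := abs_le.1 (hα.trans D.smallAngle_le)
  have harg : ((lastPoint r q : ℂ) - polarPt r q t α).arg = α := by
    rw [lastPoint_sub_polarPt, Complex.arg_real_mul _ (by linarith), Complex.arg_exp_mul_I,
      toIocMod_eq_self]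
    constructor <;> linarith [Real.pi_gt_three]
  rw [snakeAng, norm_polar h1, harg, sub_sub_cancel]

/-- A window of half a unit beginning at the integer `j` (for `s' = 1`) or ending there (for `s' =
-1`) is one half turn, on which the sine has constant sign. -/
theorem sin_nonneg_of_side {s' a : ℝ} (hs' : s' = 1 ∨ s' = -1) {j : ℤ} (h0 : 0 ≤ s' * (a - j))
    (h1 : s' * (a - j) ≤ 1 / 2) : 0 ≤ s' * Real.sin (2 * Real.pi * a) := by
  have e : Real.sin (2 * Real.pi * a) = Real.sin (2 * Real.pi * (a - j)) := by
    rw [← Real.sin_sub_int_mul_two_pi _ j]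
    congr 1
    ring
  have hp := Real.pi_pos
  have h2 : 0 ≤ Real.sin (2 * Real.pi * (s' * (a - j))) :=
    Real.sin_nonneg_of_nonneg_of_le_pi (by positivity) (by nlinarith)
  rw [e]
  rcases hs' with rfl | rfl
  · simpa using h2
  · rw [show 2 * Real.pi * (-1 * (a - j)) = -(2 * Real.pi * (a - j)) by ring, Real.sin_neg] at h2
    linarith

/-- At the angle `-(s * β)` the snake angle is the height shifted by `s * n * β / (2π)`. Membership
is thus reduced to an inequality about the height. -/
theorem polarPt_mem_piece (D : SnakeData n r q ε) {s s' t β : ℝ} (hs : s = 1 ∨ s = -1)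
    (hs' : s' = 1 ∨ s' = -1) (h0 : 0 ≤ t) (h1 : t < lastPoint r q) (hβ0 : 0 ≤ β)
    (hβ : β ≤ smallAngle r q ε) (hm : polarPt r q t (-(s * β)) ∉ marked (lastPoint r q)) {j : ℤ}
    (hj0 : 0 ≤ s' * (height r q t + s * (n * β / (2 * Real.pi)) - j))
    (hj1 : s' * (height r q t + s * (n * β / (2 * Real.pi)) - j) ≤ 1 / 2) :
    polarPt r q t (-(s * β)) ∈ pieceSet n r q ε s s' := by
  have hα : |-(s * β)| ≤ smallAngle r q ε := by
    rw [abs_neg, abs_mul, abs_of_nonneg hβ0]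
    rcases hs with rfl | rfl <;> simpa using hβ
  have hst := polarPt_mem_stadium D h0 h1 hα
  refine ⟨⟨hst, hm⟩, ?_, ?_⟩
  · rw [polarPt_im]
    have hε := D.ε_le'.1
    have h2 := hβ.trans D.smallAngle_le
    have h3 : 0 ≤ Real.sin β :=
      Real.sin_nonneg_of_nonneg_of_le_pi hβ0 (by linarith [Real.pi_gt_three])
    have h4 : 0 ≤ ((lastPoint r q : ℝ) - t) * Real.sin β := mul_nonneg (by linarith) h3
    rcases hs with rfl | rfl
    · rw [one_mul, one_mul, Real.sin_neg]
      linarith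
    · rw [neg_one_mul, neg_one_mul, neg_neg, neg_neg]
      exact h4
  · rw [theta_im D.n_ne D.q_eq (D.sub_mem hst) (polar_sub_ne_zero h1), snakeAng_polar D h1 hα]
    have h2 := snakeRad_pos D.q_eq (D.sub_mem hst) (polar_sub_ne_zero h1)
    have e : height r q t - n * -(s * β) / (2 * Real.pi) =
        height r q t + s * (n * β / (2 * Real.pi)) := by ring
    rw [e, mul_left_comm]
    exact mul_nonneg h2.le (sin_nonneg_of_side hs' hj0 hj1)

theorem continuous_polarPt {f g : ℝ → ℝ} (hf : Continuous f) (hg : Continuous g) :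
    Continuous fun x => polarPt r q (f x) (g x) := by
  unfold polarPt
  fun_prop

theorem polarPt_small_notMem (D : SnakeData n r q ε) {s t : ℝ} (hs : s = 1 ∨ s = -1)
    (h1 : t < lastPoint r q) :
    polarPt r q t (-(s * smallAngle r q ε)) ∉ marked (lastPoint r q) := by
  refine notMem_marked_of_im_ne ?_
  have hε := D.ε_le'.1
  have h2 := D.smallAngle_le
  have h3 : 0 < Real.sin (smallAngle r q ε) :=
    Real.sin_pos_of_pos_of_lt_pi D.smallAngle_pos (by linarith [Real.pi_gt_three])
  have h4 : 0 < ((lastPoint r q : ℝ) - t) * Real.sin (smallAngle r q ε) :=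
    mul_pos (by linarith) h3
  rw [polarPt_im]
  rcases hs with rfl | rfl
  · rw [one_mul, Real.sin_neg]
    linarith
  · rw [neg_one_mul, neg_neg]
    linarith

/-- A path that runs along the axis. -/
theorem joinedIn_along (D : SnakeData n r q ε) {s s' t₁ t₂ : ℝ} (hs : s = 1 ∨ s = -1)
    (hs' : s' = 1 ∨ s' = -1) (h0 : 0 ≤ t₁) (h12 : t₁ ≤ t₂) (h2 : t₂ < lastPoint r q) (j : ℤ)
    (ha0 : 0 ≤ s' * (height r q t₁ + s * smallHeight n r q ε - j))
    (ha1 : s' * (height r q t₁ + s * smallHeight n r q ε - j) ≤ 1 / 2)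
    (hb0 : 0 ≤ s' * (height r q t₂ + s * smallHeight n r q ε - j))
    (hb1 : s' * (height r q t₂ + s * smallHeight n r q ε - j) ≤ 1 / 2) :
    JoinedIn (pieceSet n r q ε s s') (polarPt r q t₁ (-(s * smallAngle r q ε)))
      (polarPt r q t₂ (-(s * smallAngle r q ε))) := by
  refine JoinedIn.ofLine (f := fun x => polarPt r q (t₁ + x * (t₂ - t₁))
    (-(s * smallAngle r q ε)))
    (continuous_polarPt (by fun_prop) (by fun_prop)).continuousOn (by simp) (by simp) ?_
  rintro _ ⟨x, ⟨hx0, hx1⟩, rfl⟩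
  have e1 : t₁ ≤ t₁ + x * (t₂ - t₁) := by nlinarith
  have e2 : t₁ + x * (t₂ - t₁) ≤ t₂ := by nlinarith
  have m1 := height_mono (r := r) (q := q) e1
  have m2 := height_mono (r := r) (q := q) e2
  have hh : smallHeight n r q ε = n * smallAngle r q ε / (2 * Real.pi) := rfl
  refine polarPt_mem_piece D hs hs' (by linarith) (by linarith) D.smallAngle_pos.le le_rfl
    (polarPt_small_notMem D hs (by linarith)) (j := j) ?_ ?_ <;> rw [← hh] <;>
    rcases hs' with rfl | rfl <;> linarith

/-- A path that runs to the axis. -/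
theorem joinedIn_across (D : SnakeData n r q ε) {s s' t : ℝ} (hs : s = 1 ∨ s = -1)
    (hs' : s' = 1 ∨ s' = -1) (h0 : 0 ≤ t) (h1 : t < lastPoint r q)
    (hm : (t : ℂ) ∉ marked (lastPoint r q)) (j : ℤ)
    (ha0 : 0 ≤ s' * (height r q t + s * smallHeight n r q ε - j))
    (ha1 : s' * (height r q t + s * smallHeight n r q ε - j) ≤ 1 / 2)
    (hb0 : 0 ≤ s' * (height r q t - j)) (hb1 : s' * (height r q t - j) ≤ 1 / 2) :
    JoinedIn (pieceSet n r q ε s s') (polarPt r q t (-(s * smallAngle r q ε))) t := by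
  have hα := D.smallAngle_pos
  refine JoinedIn.ofLine (f := fun x => polarPt r q t (-(s * ((1 - x) * smallAngle r q ε))))
    (continuous_polarPt (by fun_prop) (by fun_prop)).continuousOn (by simp)
    (by simp [polarPt_zero]) ?_
  rintro _ ⟨x, ⟨hx0, hx1⟩, rfl⟩
  have hh : n * ((1 - x) * smallAngle r q ε) / (2 * Real.pi) =
      (1 - x) * smallHeight n r q ε := by
    rw [smallHeight]
    ring
  refine polarPt_mem_piece D hs hs' h0 h1 (mul_nonneg (by linarith) hα.le) (by nlinarith) ?_
    (j := j) ?_ ?_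
  · rcases hx1.eq_or_lt with rfl | hx1
    · simpa [polarPt_zero] using hm
    · refine notMem_marked_of_im_ne ?_
      have hε := D.ε_le'.1
      have h2 := D.smallAngle_le
      have h5 : 0 < (1 - x) * smallAngle r q ε := mul_pos (by linarith) hα
      have h3 : 0 < Real.sin ((1 - x) * smallAngle r q ε) :=
        Real.sin_pos_of_pos_of_lt_pi h5 (by nlinarith [Real.pi_gt_three])
      have h4 : 0 < ((lastPoint r q : ℝ) - t) * Real.sin ((1 - x) * smallAngle r q ε) :=
        mul_pos (by linarith) h3
      rw [polarPt_im]
      rcases hs with rfl | rfl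
      · rw [one_mul, Real.sin_neg]
        linarith
      · rw [neg_one_mul, neg_neg]
        linarith
  · rw [hh]
    have : s' * (height r q t + s * ((1 - x) * smallHeight n r q ε) - j) =
      (1 - x) * (s' * (height r q t + s * smallHeight n r q ε - j)) +
        x * (s' * (height r q t - j)) := by ring
    rw [this]
    have := sub_nonneg.2 hx1
    positivity
  · rw [hh]
    have : s' * (height r q t + s * ((1 - x) * smallHeight n r q ε) - j) =
      (1 - x) * (s' * (height r q t + s * smallHeight n r q ε - j)) +
        x * (s' * (height r q t - j)) := by ring
    rw [this]
    nlinarith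

end Piece

/-! ### Holonomy along the snake -/

/-- The points of `M` on the side `s` of the real axis. -/
def signPart (s : ℝ) (M : Set ℂ) : Set M := {z | 0 ≤ s * (z : ℂ).im}

theorem signPart_one (M : Set ℂ) : signPart 1 M = upperPart M := by
  ext z
  simp [signPart, upperPart]

theorem signPart_neg_one (M : Set ℂ) : signPart (-1) M = lowerPart M := by
  ext z
  simp [signPart, lowerPart]

/-- The plane without the points `1, …, k`. -/
abbrev MarkedPlane (k : ℕ) : Type := ↥((Set.univ : Set ℂ) \ marked k)

/-- The base point `0` of the marked plane. -/
abbrev planeBase (k : ℕ) : MarkedPlane k := ⟨0, Set.mem_univ _, zero_notMem_marked k⟩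

/-- `G m` is the class of a loop that goes below the first `m` marked points and returns
above. -/
def IsGapFamily (k : ℕ) (G : ℕ → LeftPi (MarkedPlane k) (planeBase k)) : Prop :=
  ∀ m ≤ k, ∀ (x : ℝ) (hx : InGap k m x),
    IsBigonClass (planeBase k) (lowerPart _) (upperPart _) ⟨x, Set.mem_univ _, hx.notMem⟩ (G m)

theorem exists_gapFamily (k : ℕ) : ∃ G, IsGapFamily k G := by
  have h : ∀ m : ℕ, ∃ g : LeftPi (MarkedPlane k) (planeBase k), ∀ (x : ℝ) (hx : InGap k m x),
      IsBigonClass (planeBase k) (lowerPart _) (upperPart _) ⟨x, Set.mem_univ _, hx.notMem⟩ g := by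
    intro m
    have hm : InGap k m (m + 1 / 2) := ⟨.inr (by linarith), .inr (by linarith)⟩
    obtain ⟨g, hg⟩ := (bigon_plane (k := k)).exists_bigonClass
      (a := ⟨((m + 1 / 2 : ℝ) : ℂ), Set.mem_univ _, hm.notMem⟩) (by simp [lowerPart])
      (by simp [upperPart])
    exact ⟨g, fun x hx => bigonClass_gap convex_univ rfl rfl hm hx hg⟩
  choose G hG using h
  exact ⟨G, fun m _ => hG m⟩

theorem IsGapFamily.zero {k : ℕ} {G : ℕ → LeftPi (MarkedPlane k) (planeBase k)}
    (hG : IsGapFamily k G) : G 0 = 1 := by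
  have h0 : InGap k 0 0 := ⟨.inl rfl, .inr (by norm_num)⟩
  have h := hG 0 (Nat.zero_le _) 0 h0
  refine (bigon_plane (k := k)).bigonClass_unique h ?_
  have := (bigon_plane (k := k)).bigonClass_base
  convert this using 2
  exact Subtype.ext Complex.ofReal_zero

/-! ### Holonomy of the images of paths in the snake -/

section Reach

variable {n r q : ℕ} {ε : ℝ}

/-- The domain of the snake, without the marked points. -/
abbrev SnakePlane (r q : ℕ) (ε : ℝ) : Type := ↥(stadium ε (lastPoint r q) \ marked (lastPoint r q))

/-- The base point of the domain of the snake. -/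
abbrev SnakeData.base (D : SnakeData n r q ε) : SnakePlane r q ε :=
  ⟨0, zero_mem_stadium_diff D.ε_pos.le⟩

theorem SnakeData.theta_zero (D : SnakeData n r q ε) : theta n r q 0 = 0 := by
  have h : height r q 0 = (0 : ℕ) := by simpa using height_of_le (r := r) (q := q) r.cast_nonneg
  have := theta_ofReal D.n_ne D.q_eq (zero_lt_one.trans_le one_le_lastPoint) h
  simpa using this

theorem SnakeData.thetaMap_base (D : SnakeData n r q ε) : thetaMap D D.base = planeBase (r + 1) :=
  Subtype.ext D.theta_zero

/-- One can reach `z` on the side `s` of the axis, along a path whose image in the model of the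
base has the holonomy `g`. -/
def Reach (D : SnakeData n r q ε) (s : ℝ) (z : ℂ)
    (g : LeftPi (MarkedPlane (r + 1)) (planeBase (r + 1))) : Prop :=
  ∃ (hz : z ∈ stadium ε (lastPoint r q) \ marked (lastPoint r q))
    (p : Path D.base (⟨z, hz⟩ : SnakePlane r q ε)),
    (∀ t, p t ∈ signPart s _) ∧
      IsHolonomy (planeBase (r + 1)) (lowerPart _) (p.map (thetaMap D).continuous) g

theorem reach_base (D : SnakeData n r q ε) (s : ℝ) : Reach D s 0 1 := by
  refine ⟨zero_mem_stadium_diff D.ε_pos.le, Path.refl _, fun t => ?_,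
    (bigon_plane (k := r + 1)).holonomy_lower fun t => ?_⟩
  · change 0 ≤ s * (0 : ℂ).im
    simp
  · change (theta n r q 0).im ≤ 0
    rw [D.theta_zero, Complex.zero_im]

theorem exists_path_of_piece (D : SnakeData n r q ε) {s s' : ℝ} {z w : ℂ}
    (h : JoinedIn (pieceSet n r q ε s s') z w)
    (hz : z ∈ stadium ε (lastPoint r q) \ marked (lastPoint r q)) :
    ∃ (hw : w ∈ stadium ε (lastPoint r q) \ marked (lastPoint r q))
      (p : Path (⟨z, hz⟩ : SnakePlane r q ε) ⟨w, hw⟩),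
      (∀ t, p t ∈ signPart s _) ∧
        ∀ t, p.map (thetaMap D).continuous t ∈ signPart s' (Set.univ \ marked (r + 1)) := by
  obtain ⟨p, hp⟩ := h
  exact ⟨by simpa using (hp 1).1, p.codRestrict fun t => (hp t).1, fun t => (hp t).2.1,
    fun t => (hp t).2.2⟩

/-- Paths with image in the lower half plane have trivial holonomy. -/
theorem Reach.lower {D : SnakeData n r q ε} {s : ℝ} {z w : ℂ}
    {g : LeftPi (MarkedPlane (r + 1)) (planeBase (r + 1))} (h : Reach D s z g)
    (hzw : JoinedIn (pieceSet n r q ε s (-1)) z w) : Reach D s w g := by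
  obtain ⟨hz, p, hp, hg⟩ := h
  obtain ⟨hw, p', hp', hθ⟩ := exists_path_of_piece D hzw hz
  rw [signPart_neg_one] at hθ
  refine ⟨hw, p.trans p', trans_mem hp hp', ?_⟩
  rw [Path.map_trans, ← mul_one g]
  exact bigon_plane.holonomy_trans hg (bigon_plane.holonomy_lower hθ)

/-- A path with image in the upper half plane contributes only through the gaps in which its image
begins and ends. -/
theorem Reach.upper {D : SnakeData n r q ε} {s : ℝ} {z w : ℂ}
    {g : LeftPi (MarkedPlane (r + 1)) (planeBase (r + 1))} (h : Reach D s z g)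
    (hzw : JoinedIn (pieceSet n r q ε s 1) z w)
    {G : ℕ → LeftPi (MarkedPlane (r + 1)) (planeBase (r + 1))} (hG : IsGapFamily (r + 1) G)
    {a b : ℝ} (ha : theta n r q z = a) (hb : theta n r q w = b) {l m : ℕ} (hl : l ≤ r + 1)
    (hm : m ≤ r + 1) (hal : InGap (r + 1) l a) (hbm : InGap (r + 1) m b) :
    Reach D s w (g * (G l * (G m)⁻¹)) := by
  obtain ⟨hz, p, hp, hg⟩ := h
  obtain ⟨hw, p', hp', hθ⟩ := exists_path_of_piece D hzw hz
  rw [signPart_one] at hθ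
  refine ⟨hw, p.trans p', trans_mem hp hp', ?_⟩
  rw [Path.map_trans]
  refine bigon_plane.holonomy_trans hg (bigon_plane.holonomy_upper hθ ?_ ?_)
  · have := hG l hl a hal
    convert this using 1
    exact Subtype.ext ha
  · have := hG m hm b hbm
    convert this using 1
    exact Subtype.ext hb

/-- The two holonomies close up through the lower half plane of the base to the same point, so the
image of the bigon class is their quotient. -/
theorem Reach.bigonClass {D : SnakeData n r q ε} {z : ℂ}
    {g g' : LeftPi (MarkedPlane (r + 1)) (planeBase (r + 1))} (h : Reach D (-1) z g)
    (h' : Reach D 1 z g') :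
    ∃ (hz : z ∈ stadium ε (lastPoint r q) \ marked (lastPoint r q)) (c : LeftPi _ D.base),
      IsBigonClass D.base (lowerPart _) (upperPart _) ⟨z, hz⟩ c ∧
        push (thetaMap D) D.thetaMap_base c = g * g'⁻¹ := by
  obtain ⟨hz, p, hp, hg⟩ := h
  obtain ⟨hz', p', hp', hg'⟩ := h'
  rw [signPart_neg_one] at hp
  rw [signPart_one] at hp'
  refine ⟨hz, _, ⟨p, p', hp, hp', rfl⟩, ?_⟩
  obtain ⟨c, d, hc, hd, rfl⟩ := hg
  obtain ⟨c', d', hc', hd', rfl⟩ := hg'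
  have B := bigon_plane (k := r + 1)
  rw [push_hol]
  have e1 := D.thetaMap_base
  have hpp : ∀ {a : SnakePlane r q ε} (p : Path D.base a) (c : Path (planeBase (r + 1))
      (thetaMap D D.base)) (d : Path (planeBase (r + 1)) (thetaMap D a)),
      (∀ t, c t ∈ lowerPart _) → hol c (p.map (thetaMap D).continuous) d =
        hol ((p.map (thetaMap D).continuous).cast e1.symm rfl) (Path.refl _) d := by
    intro a p c d hc
    have h1 : (c.cast rfl e1.symm).Homotopic (Path.refl _) :=
      B.lower.path_homotopic hc fun _ => B.mem_lower
    unfold hol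
    rw [cls_eq_iff, ← Path.Homotopic.Quotient.eq]
    have h2 : c.trans (p.map (thetaMap D).continuous) = (c.cast rfl e1.symm).trans
        ((p.map (thetaMap D).continuous).cast e1.symm rfl) := by
      ext t
      simp [Path.trans_apply]
    rw [h2]
    simp only [Path.Homotopic.Quotient.mk_trans, Path.Homotopic.Quotient.eq.2 h1,
      Path.Homotopic.Quotient.mk_refl, Path.Homotopic.Quotient.refl_trans,
      Path.Homotopic.Quotient.trans_refl]
  rw [hpp p c d hc, hpp p' c' d' hc', ← hol_refl_symm,
    hol_congr (.refl _) (.refl _) (B.lower.path_homotopic hd hd'), hol_mul]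
  refine hol_congr (.refl _) ?_ (.refl _)
  exact ⟨(Path.Homotopy.transRefl _).symm⟩

end Reach

/-! ### Holonomy along the two edges of the snake -/

section Chains

variable {n r q : ℕ} {ε : ℝ} {G : ℕ → LeftPi (MarkedPlane (r + 1)) (planeBase (r + 1))}

theorem height_zigzag {j : ℕ} (hj : j < q) (hr : 0 < r) {τ : ℝ} (h0 : 0 ≤ τ) (h1 : τ ≤ 1) :
    height r q ((j + 1) * r + τ) = j + τ := by
  have hr1 : (1 : ℝ) ≤ r := by exact_mod_cast hr
  rw [height_ramp hj (by linarith) (by linarith) hr, add_sub_cancel_left, clampOne_of_mem h0 h1]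

theorem zigzag_lt {j : ℕ} (hj : j < q) (hr : 0 < r) {τ : ℝ} (h1 : τ ≤ 1) :
    (j + 1) * r + τ ≤ lastPoint r q - r := by
  have hj' : (j : ℝ) + 1 ≤ q := by exact_mod_cast hj
  have hr1 : (1 : ℝ) ≤ r := by exact_mod_cast hr
  rw [cast_lastPoint]
  nlinarith

theorem pos_of_lt (hq : r = 0 → q = 0) {j : ℕ} (hj : j < q) : 0 < r := by
  rcases Nat.eq_zero_or_pos r with h | h
  · have := hq h
    omega
  · exact h

/-- The time at which the lower path has the height `j - 1 / 2`. -/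
def lowerTime (n r q : ℕ) (ε : ℝ) : ℕ → ℝ
  | 0 => 0
  | j + 1 => (j + 1) * r + (1 / 2 + smallHeight n r q ε)

/-- The time at which the upper path has the height `j`. -/
def upperTime (n r q : ℕ) (ε : ℝ) : ℕ → ℝ
  | 0 => 0
  | j + 1 => (j + 1) * r + (1 - smallHeight n r q ε)

/-- The point of the upper path at the height `j`. -/
def upperPt (n r q : ℕ) (ε : ℝ) : ℕ → ℂ
  | 0 => 0
  | j + 1 => polarPt r q ((j + 1) * r + (1 - smallHeight n r q ε)) (-(1 * smallAngle r q ε))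

theorem abs_side_angle (D : SnakeData n r q ε) {s : ℝ} (hs : s = 1 ∨ s = -1) :
    |-(s * smallAngle r q ε)| ≤ smallAngle r q ε := by
  rcases hs with rfl | rfl <;> simp [abs_of_pos D.smallAngle_pos]

theorem snakeAng_side (D : SnakeData n r q ε) {s t : ℝ} (hs : s = 1 ∨ s = -1)
    (h1 : t < lastPoint r q) :
    snakeAng n r q ((lastPoint r q : ℂ) - polarPt r q t (-(s * smallAngle r q ε))) =
      height r q t + s * smallHeight n r q ε := by
  rw [snakeAng_polar D h1 (abs_side_angle D hs), smallHeight]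
  ring

/-- The image of a point at which the path crosses the line of a sheet. -/
theorem theta_side_int (D : SnakeData n r q ε) {s t : ℝ} (hs : s = 1 ∨ s = -1) (h0 : 0 ≤ t)
    (h1 : t ≤ lastPoint r q - 1) {j : ℤ} (hj : height r q t + s * smallHeight n r q ε = j) :
    theta n r q (polarPt r q t (-(s * smallAngle r q ε))) = ((t - r * j : ℝ) : ℂ) := by
  have h2 : t < lastPoint r q := by linarith
  have hang := snakeAng_side D hs h2
  rw [hj] at hang
  rw [theta_of_ang_int D.n_ne D.q_eq
    (D.sub_mem (polarPt_mem_stadium D h0 h2 (abs_side_angle D hs))) (polar_sub_ne_zero h2) hang,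
    snakeRad_eq D.q_eq, norm_polar h2, hang, clampOne_of_ge (by linarith), cast_lastPoint]
  congr 1
  ring

theorem theta_side_half (D : SnakeData n r q ε) {s t : ℝ} (hs : s = 1 ∨ s = -1) (h0 : 0 ≤ t)
    (h2 : t < lastPoint r q) {j : ℤ} (hj : height r q t + s * smallHeight n r q ε = j + 1 / 2) :
    ∃ a : ℝ, theta n r q (polarPt r q t (-(s * smallAngle r q ε))) = a ∧
      InGap (r + 1) (r + 1) a := by
  have hang := snakeAng_side D hs h2
  rw [hj] at hang
  have hmem := D.sub_mem (polarPt_mem_stadium D h0 h2 (abs_side_angle D hs))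
  refine ⟨_, theta_of_ang_half D.n_ne D.q_eq hmem (polar_sub_ne_zero h2) hang, .inr ?_,
    .inl le_rfl⟩
  have := snakeRad_pos D.q_eq hmem (polar_sub_ne_zero h2)
  push_cast
  linarith

theorem theta_real_half (D : SnakeData n r q ε) {t : ℝ} (h2 : t < lastPoint r q) {j : ℤ}
    (hj : height r q t = j + 1 / 2) :
    ∃ a : ℝ, theta n r q t = a ∧ InGap (r + 1) (r + 1) a := by
  have h3 : 0 < (lastPoint r q : ℝ) - t := by linarith
  have e : (lastPoint r q : ℂ) - t = (((lastPoint r q : ℝ) - t : ℝ) : ℂ) := by push_cast; rfl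
  have hmem : (lastPoint r q : ℂ) - t ∈ snakeDom n r := by
    rw [e]
    exact mem_snakeDom_ofReal h3.le
  have hne : (lastPoint r q : ℂ) - t ≠ 0 := by
    rw [e]
    exact_mod_cast h3.ne'
  refine ⟨_, theta_of_ang_half D.n_ne D.q_eq hmem hne (j := j) ?_, .inr ?_, .inl le_rfl⟩
  · rw [e, snakeAng_ofReal h3.le, sub_sub_cancel, hj]
  · have := snakeRad_pos D.q_eq hmem hne
    push_cast
    linarith

/-- The lower path up to the line of the sheet number `j`. -/
theorem joinedIn_lower (D : SnakeData n r q ε) {j : ℕ} (hj : j ≤ q) {t : ℝ}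
    (h1 : t < lastPoint r q) (h2 : lowerTime n r q ε j ≤ t)
    (h3 : height r q t - smallHeight n r q ε ≤ j) :
    JoinedIn (pieceSet n r q ε (-1) (-1))
      (polarPt r q (lowerTime n r q ε j) (-(-1 * smallAngle r q ε)))
      (polarPt r q t (-(-1 * smallAngle r q ε))) := by
  have e0 := D.smallHeight_pos
  have e1 := D.smallHeight_le
  have hmono := height_mono (r := r) (q := q) h2
  have hstart : 0 ≤ lowerTime n r q ε j ∧ (j : ℝ) - 1 / 2 ≤
      height r q (lowerTime n r q ε j) - smallHeight n r q ε := by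
    cases j with
    | zero =>
      simp only [lowerTime, height_of_le (r := r) (q := q) r.cast_nonneg, le_refl, true_and]
      push_cast
      linarith
    | succ j =>
      have hr := pos_of_lt D.q_eq hj
      simp only [lowerTime]
      rw [height_zigzag hj hr (by linarith) (by linarith)]
      refine ⟨by positivity, ?_⟩
      push_cast
      linarith
  refine joinedIn_along D (.inr rfl) (.inr rfl) hstart.1 h2 h1 j ?_ ?_ ?_ ?_ <;>
    simp only [Int.cast_natCast] <;> linarith [hstart.2]

/-- During the ramp after the ray `j` the lower edge lags behind the axis by `smallHeight`. It meets
the line of its ray when the height is `j + smallHeight`, at the position `r + smallHeight`, hence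
in the gap `r`. -/
theorem theta_cross (D : SnakeData n r q ε) {j : ℕ} (hj : j < q) :
    ∃ a : ℝ, theta n r q (polarPt r q ((j + 1) * r + smallHeight n r q ε)
      (-(-1 * smallAngle r q ε))) = a ∧ InGap (r + 1) r a := by
  have e0 := D.smallHeight_pos
  have e1 := D.smallHeight_le
  have hr := pos_of_lt D.q_eq hj
  have hr1 : (1 : ℝ) ≤ r := by exact_mod_cast hr
  have h1 := zigzag_lt hj hr (by linarith : smallHeight n r q ε ≤ 1)
  refine ⟨_, theta_side_int D (.inr rfl) (by positivity) (by linarith) (j := j) ?_, .inr ?_,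
    .inr ?_⟩
  · rw [height_zigzag hj hr e0.le (by linarith)]
    push_cast
    ring
  · push_cast
    linarith
  · push_cast
    linarith

/-- One change of ray takes the image of the lower edge through the upper half plane from the gap
`r` to the gap `r + 1`; the rest lies below. Each change thus contributes `G r * (G (r + 1))⁻¹`. -/
theorem reach_lowerTime (D : SnakeData n r q ε) (hG : IsGapFamily (r + 1) G) (j : ℕ) (hj : j ≤ q) :
    Reach D (-1) (polarPt r q (lowerTime n r q ε j) (-(-1 * smallAngle r q ε)))
      ((G r * (G (r + 1))⁻¹) ^ j) := by
  have e0 := D.smallHeight_pos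
  have e1 := D.smallHeight_le
  have hp := one_le_lastPoint (r := r) (q := q)
  induction j with
  | zero =>
    have h := reach_base D (-1)
    refine h.lower ?_
    have := joinedIn_across D (s := -1) (s' := -1) (t := 0) (.inr rfl) (.inr rfl) le_rfl
      (by linarith) (by simpa using zero_notMem_marked _) 0
    rw [height_of_le (r := r) (q := q) r.cast_nonneg, Complex.ofReal_zero] at this
    exact (this (by norm_num; linarith) (by norm_num; linarith) (by norm_num) (by norm_num)).symm
  | succ j ih =>
    have hr := pos_of_lt D.q_eq hj
    have hr1 : (1 : ℝ) ≤ r := by exact_mod_cast hr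
    have h1 := zigzag_lt hj hr (by linarith : smallHeight n r q ε ≤ 1)
    have h2 := zigzag_lt hj hr (by linarith : 1 / 2 + smallHeight n r q ε ≤ 1)
    have h3 := height_zigzag hj hr e0.le (by linarith)
    have h4 := height_zigzag hj hr (by linarith : 0 ≤ 1 / 2 + smallHeight n r q ε) (by linarith)
    have hcross : Reach D (-1) (polarPt r q ((j + 1) * r + smallHeight n r q ε)
        (-(-1 * smallAngle r q ε))) ((G r * (G (r + 1))⁻¹) ^ j) := by
      refine (ih (by omega)).lower (joinedIn_lower D (by omega) (by linarith) ?_ ?_)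
      · cases j with
        | zero => simp only [lowerTime]; positivity
        | succ j => simp only [lowerTime]; push_cast; linarith
      · rw [h3]
        linarith
    obtain ⟨a, ha, ha'⟩ := theta_cross D hj
    obtain ⟨b, hb, hb'⟩ := theta_side_half D (s := -1) (j := j) (.inr rfl)
      (by positivity : 0 ≤ (j + 1) * r + (1 / 2 + smallHeight n r q ε)) (by linarith)
      (by rw [h4]; push_cast; ring)
    rw [pow_succ]
    refine hcross.upper ?_ hG ha hb (by omega) le_rfl ha' hb'
    refine joinedIn_along D (.inr rfl) (.inl rfl) (by positivity) (by linarith) (by linarith) j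
      ?_ ?_ ?_ ?_ <;> simp only [h3, h4, Int.cast_natCast] <;> linarith

/-- At the middle of the ramp the axis itself is to the right of `r + 1` in the base, so the
crossing of the upper half plane already counts and the exponent is `j + 1`. -/
theorem reach_lower_zigzag (D : SnakeData n r q ε) (hG : IsGapFamily (r + 1) G) {j : ℕ}
    (hj : j < q) (hm : (((j + 1) * r + 1 / 2 : ℝ) : ℂ) ∉ marked (lastPoint r q)) :
    Reach D (-1) (((j + 1) * r + 1 / 2 : ℝ) : ℂ) ((G r * (G (r + 1))⁻¹) ^ (j + 1)) := by
  have e0 := D.smallHeight_pos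
  have e1 := D.smallHeight_le
  have hr := pos_of_lt D.q_eq hj
  have hr1 : (1 : ℝ) ≤ r := by exact_mod_cast hr
  have h1 := zigzag_lt hj hr (by linarith : smallHeight n r q ε ≤ 1)
  have h2 := zigzag_lt hj hr (by norm_num : (1 / 2 : ℝ) ≤ 1)
  have h3 := height_zigzag hj hr e0.le (by linarith)
  have h4 := height_zigzag hj hr (by norm_num : (0 : ℝ) ≤ 1 / 2) (by norm_num)
  have hcross : Reach D (-1) (polarPt r q ((j + 1) * r + smallHeight n r q ε)
      (-(-1 * smallAngle r q ε))) ((G r * (G (r + 1))⁻¹) ^ j) := by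
    refine (reach_lowerTime D hG j hj.le).lower (joinedIn_lower D hj.le (by linarith) ?_ ?_)
    · cases j with
      | zero => simp only [lowerTime]; positivity
      | succ j => simp only [lowerTime]; push_cast; linarith
    · rw [h3]
      linarith
  obtain ⟨a, ha, ha'⟩ := theta_cross D hj
  obtain ⟨b, hb, hb'⟩ := theta_real_half D (j := j) (t := (j + 1) * r + 1 / 2) (by linarith)
    (by rw [h4]; push_cast; ring)
  rw [pow_succ]
  refine hcross.upper (JoinedIn.trans (y := polarPt r q ((j + 1) * r + 1 / 2)
    (-(-1 * smallAngle r q ε))) ?_ ?_) hG ha hb (by omega) le_rfl ha' hb'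
  · refine joinedIn_along D (.inr rfl) (.inl rfl) (by positivity) (by linarith) (by linarith) j
      ?_ ?_ ?_ ?_ <;> simp only [h3, h4, Int.cast_natCast] <;> linarith
  · refine joinedIn_across D (.inr rfl) (.inl rfl) (by positivity) (by linarith) hm j
      ?_ ?_ ?_ ?_ <;> simp only [h4, Int.cast_natCast] <;> linarith

theorem reach_lower_plateau (D : SnakeData n r q ε) (hG : IsGapFamily (r + 1) G) {j : ℕ}
    (hj : j ≤ q) {x : ℝ} (hx0 : 0 ≤ x) (hx1 : x < lastPoint r q)
    (hm : (x : ℂ) ∉ marked (lastPoint r q)) (hx : height r q x = j)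
    (hjx : j = 0 ∨ (j : ℝ) * r + 1 ≤ x) : Reach D (-1) x ((G r * (G (r + 1))⁻¹) ^ j) := by
  have e0 := D.smallHeight_pos
  have e1 := D.smallHeight_le
  refine ((reach_lowerTime D hG j hj).lower (joinedIn_lower D hj hx1 ?_ (by linarith))).lower ?_
  · cases j with
    | zero => exact hx0
    | succ j =>
      have := hjx.resolve_left (by omega)
      push_cast at this
      simp only [lowerTime]
      linarith
  · refine joinedIn_across D (.inr rfl) (.inr rfl) hx0 hx1 hm j ?_ ?_ ?_ ?_ <;>
      simp only [hx, Int.cast_natCast] <;> linarith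

/-- The upper path up to the middle between the lines of the sheets number `j` and `j + 1`. -/
theorem joinedIn_upper (D : SnakeData n r q ε) {j : ℕ} (hj : j ≤ q) {t : ℝ} (h0 : 0 ≤ t)
    (h1 : t < lastPoint r q) (h2 : upperTime n r q ε j ≤ t)
    (h3 : height r q t + smallHeight n r q ε ≤ j + 1 / 2) :
    JoinedIn (pieceSet n r q ε 1 1) (upperPt n r q ε j)
      (polarPt r q t (-(1 * smallAngle r q ε))) := by
  have e0 := D.smallHeight_pos
  have e1 := D.smallHeight_le
  have hp := one_le_lastPoint (r := r) (q := q)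
  have hmono := height_mono (r := r) (q := q) h2
  cases j with
  | zero =>
    have h4 : height r q 0 = 0 := height_of_le (r := r) (q := q) r.cast_nonneg
    have := joinedIn_across D (s := 1) (s' := 1) (t := 0) (.inl rfl) (.inl rfl) le_rfl
      (by linarith) (by simpa using zero_notMem_marked _) 0
    rw [h4, Complex.ofReal_zero] at this
    refine JoinedIn.trans (this (by norm_num; linarith) (by norm_num; linarith) (by norm_num)
      (by norm_num)).symm ?_
    have h5 := height_nonneg (r := r) (q := q) (t := t)
    simp only [Nat.cast_zero] at h3
    refine joinedIn_along D (.inl rfl) (.inl rfl) le_rfl h0 h1 0 ?_ ?_ ?_ ?_ <;>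
      simp only [h4, Int.cast_zero] <;> linarith
  | succ j =>
    have hr := pos_of_lt D.q_eq hj
    have h4 := height_zigzag hj hr (by linarith : 0 ≤ 1 - smallHeight n r q ε) (by linarith)
    simp only [upperTime] at h2 hmono
    rw [h4] at hmono
    simp only [Nat.cast_add, Nat.cast_one] at h3
    refine joinedIn_along D (.inl rfl) (.inl rfl) ?_ h2 h1 (j + 1 : ℕ) ?_ ?_ ?_ ?_
    · have : 0 ≤ 1 - smallHeight n r q ε := by linarith
      positivity
    all_goals
      simp only [h4, Int.cast_add, Int.cast_natCast, Int.cast_one,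
        Nat.cast_add, Nat.cast_one]
      linarith

/-- The upper edge is ahead of the axis by `smallHeight`. It reaches the line of the next ray before
the ramp ends, at the position `1 - smallHeight`, left of all marked points. -/
theorem theta_upperPt (D : SnakeData n r q ε) {j : ℕ} (hj : j ≤ q) :
    ∃ a : ℝ, theta n r q (upperPt n r q ε j) = a ∧ InGap (r + 1) 0 a := by
  have e0 := D.smallHeight_pos
  have e1 := D.smallHeight_le
  cases j with
  | zero => exact ⟨0, by simpa [upperPt] using D.theta_zero, .inl rfl, .inr (by norm_num)⟩
  | succ j =>
    have hr := pos_of_lt D.q_eq hj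
    have hr1 : (1 : ℝ) ≤ r := by exact_mod_cast hr
    have h1 := zigzag_lt hj hr (by linarith : 1 - smallHeight n r q ε ≤ 1)
    have h2 : 0 ≤ 1 - smallHeight n r q ε := by linarith
    refine ⟨_, theta_side_int D (.inl rfl) (by positivity) (by linarith) (j := (j + 1 : ℕ)) ?_,
      .inl rfl, .inr ?_⟩
    · rw [height_zigzag hj hr h2 (by linarith)]
      push_cast
      ring
    · push_cast
      linarith

theorem reach_upper_half (D : SnakeData n r q ε) (hG : IsGapFamily (r + 1) G) {j : ℕ}
    (hj : j < q) {g : LeftPi (MarkedPlane (r + 1)) (planeBase (r + 1))}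
    (h : Reach D 1 (upperPt n r q ε j) g) :
    Reach D 1 (polarPt r q ((j + 1) * r + (1 / 2 - smallHeight n r q ε))
      (-(1 * smallAngle r q ε))) (g * (G (r + 1))⁻¹) := by
  have e0 := D.smallHeight_pos
  have e1 := D.smallHeight_le
  have hr := pos_of_lt D.q_eq hj
  have hr1 : (1 : ℝ) ≤ r := by exact_mod_cast hr
  have h2 : 0 ≤ 1 / 2 - smallHeight n r q ε := by linarith
  have h1 := zigzag_lt hj hr (by linarith : 1 / 2 - smallHeight n r q ε ≤ 1)
  have h3 := height_zigzag hj hr h2 (by linarith)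
  obtain ⟨a, ha, ha'⟩ := theta_upperPt D hj.le
  obtain ⟨b, hb, hb'⟩ := theta_side_half D (s := 1) (j := j) (.inl rfl)
    (by positivity : 0 ≤ (j + 1) * r + (1 / 2 - smallHeight n r q ε)) (by linarith)
    (by rw [h3]; push_cast; ring)
  have := h.upper (joinedIn_upper D hj.le (by positivity) (by linarith) ?_ ?_) hG ha hb
    (Nat.zero_le _) le_rfl ha' hb'
  · rwa [hG.zero, one_mul (_⁻¹)] at this
  · cases j with
    | zero => simp only [upperTime]; positivity
    | succ j => simp only [upperTime]; push_cast; linarith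
  · rw [h3]
    linarith

/-- Each change of ray takes the image of the upper edge above all marked points, from the gap `0`
to the gap `r + 1`, and back below them. As `G 0 = 1`, it contributes `(G (r + 1))⁻¹`. -/
theorem reach_upperPt (D : SnakeData n r q ε) (hG : IsGapFamily (r + 1) G) (j : ℕ) (hj : j ≤ q) :
    Reach D 1 (upperPt n r q ε j) ((G (r + 1))⁻¹ ^ j) := by
  have e0 := D.smallHeight_pos
  have e1 := D.smallHeight_le
  induction j with
  | zero => exact reach_base D 1
  | succ j ih =>
    have hr := pos_of_lt D.q_eq hj
    have hr1 : (1 : ℝ) ≤ r := by exact_mod_cast hr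
    have h2 : 0 ≤ 1 / 2 - smallHeight n r q ε := by linarith
    have h1 := zigzag_lt hj hr (by linarith : 1 - smallHeight n r q ε ≤ 1)
    have h3 := height_zigzag hj hr h2 (by linarith)
    have h4 := height_zigzag hj hr (by linarith : 0 ≤ 1 - smallHeight n r q ε) (by linarith)
    rw [pow_succ]
    refine (reach_upper_half D hG hj (ih (by omega))).lower ?_
    refine joinedIn_along D (.inl rfl) (.inr rfl) (by positivity) (by linarith) (by linarith)
      (j + 1 : ℕ) ?_ ?_ ?_ ?_ <;>
      simp only [h3, h4, Int.cast_add, Int.cast_natCast, Int.cast_one,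
        Nat.cast_add, Nat.cast_one] <;> linarith

theorem reach_upper_zigzag (D : SnakeData n r q ε) (hG : IsGapFamily (r + 1) G) {j : ℕ}
    (hj : j < q) (hm : (((j + 1) * r + 1 / 2 : ℝ) : ℂ) ∉ marked (lastPoint r q)) :
    Reach D 1 (((j + 1) * r + 1 / 2 : ℝ) : ℂ) ((G (r + 1))⁻¹ ^ (j + 1)) := by
  have e0 := D.smallHeight_pos
  have e1 := D.smallHeight_le
  have hr := pos_of_lt D.q_eq hj
  have hr1 : (1 : ℝ) ≤ r := by exact_mod_cast hr
  have h2 : 0 ≤ 1 / 2 - smallHeight n r q ε := by linarith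
  have h1 := zigzag_lt hj hr (by norm_num : (1 / 2 : ℝ) ≤ 1)
  have h3 := height_zigzag hj hr h2 (by linarith)
  have h4 := height_zigzag hj hr (by norm_num : (0 : ℝ) ≤ 1 / 2) (by norm_num)
  rw [pow_succ]
  refine ((reach_upper_half D hG hj (reach_upperPt D hG j hj.le)).lower
    (w := polarPt r q ((j + 1) * r + 1 / 2) (-(1 * smallAngle r q ε))) ?_).lower ?_
  · refine joinedIn_along D (.inl rfl) (.inr rfl) (by positivity) (by linarith) (by linarith)
      (j + 1 : ℕ) ?_ ?_ ?_ ?_ <;>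
      simp only [h3, h4, Int.cast_add, Int.cast_natCast, Int.cast_one,
        Nat.cast_add, Nat.cast_one] <;> linarith
  · refine joinedIn_across D (.inl rfl) (.inr rfl) (by positivity) (by linarith) hm
      (j + 1 : ℕ) ?_ ?_ ?_ ?_ <;>
      simp only [h4, Int.cast_add, Int.cast_natCast, Int.cast_one,
        Nat.cast_add, Nat.cast_one] <;> linarith

/-- On the ray itself the upper edge stays above the axis of the base, from the gap `0` to the gap
`i`; this adds the factor `(G i)⁻¹`. -/
theorem reach_upper_plateau (D : SnakeData n r q ε) (hG : IsGapFamily (r + 1) G) {i j : ℕ}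
    (hi : i ≤ r + 1) (hj : j ≤ q) {x : ℝ} (hx0 : 0 ≤ x) (hx1 : x < lastPoint r q)
    (hm : (x : ℂ) ∉ marked (lastPoint r q)) (hx : height r q x = j)
    (hjx : j = 0 ∨ (j : ℝ) * r + 1 ≤ x) (hgap : InGap (r + 1) i (x - r * j)) :
    Reach D 1 x ((G (r + 1))⁻¹ ^ j * (G i)⁻¹) := by
  have e0 := D.smallHeight_pos
  have e1 := D.smallHeight_le
  obtain ⟨a, ha, ha'⟩ := theta_upperPt D hj
  have := (reach_upperPt D hG j hj).upper (w := x) ?_ hG ha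
    (theta_ofReal D.n_ne D.q_eq hx1 hx) (Nat.zero_le _) hi ha' hgap
  · rwa [hG.zero, one_mul (_⁻¹)] at this
  · refine (joinedIn_upper D hj hx0 hx1 ?_ (by linarith)).trans ?_
    · cases j with
      | zero => exact hx0
      | succ j =>
        have := hjx.resolve_left (by omega)
        push_cast at this
        simp only [upperTime]
        linarith
    · refine joinedIn_across D (.inl rfl) (.inl rfl) hx0 hx1 hm j ?_ ?_ ?_ ?_ <;>
        simp only [hx, Int.cast_natCast] <;> linarith

/-- The class of the loop that goes below the snake to a gap and returns above. -/
theorem exists_snake_gapClass (D : SnakeData n r q ε) (hG : IsGapFamily (r + 1) G) {i j : ℕ}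
    (hi : i ≤ r) (hj : j ≤ q) :
    ∃ (x : ℝ) (hx : (x : ℂ) ∈ stadium ε (lastPoint r q) \ marked (lastPoint r q))
      (c : LeftPi _ D.base), InGap (lastPoint r q) (j * r + i) x ∧
      IsBigonClass D.base (lowerPart _) (upperPart _) ⟨x, hx⟩ c ∧
      push (thetaMap D) D.thetaMap_base c =
        (G r * (G (r + 1))⁻¹) ^ j * G i * G (r + 1) ^ j := by
  have hgr : G r * (G (r + 1))⁻¹ * G (r + 1) = G r := by group
  -- The gap between two rays is both the last gap of the ray `l` and the gap `0` of the ray `l +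
  -- 1`. It is tested at the middle of the ramp, and the two descriptions give the same group
  -- element.
  have zig : ∀ l, l < q →
      ∃ (x : ℝ) (hx : (x : ℂ) ∈ stadium ε (lastPoint r q) \ marked (lastPoint r q))
      (c : LeftPi _ D.base), InGap (lastPoint r q) ((l + 1) * r) x ∧
      IsBigonClass D.base (lowerPart _) (upperPart _) ⟨x, hx⟩ c ∧
      push (thetaMap D) D.thetaMap_base c = (G r * (G (r + 1))⁻¹) ^ (l + 1) *
        G (r + 1) ^ (l + 1) := by
    intro l hl
    have hgap : InGap (lastPoint r q) ((l + 1) * r) ((l + 1) * r + 1 / 2) :=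
      ⟨.inr (by push_cast; linarith), .inr (by push_cast; linarith)⟩
    obtain ⟨hz, c, hc, hc'⟩ := (reach_lower_zigzag D hG hl hgap.notMem).bigonClass
      (reach_upper_zigzag D hG hl hgap.notMem)
    exact ⟨_, hz, c, hgap, hc, by rw [hc', inv_pow, inv_inv]⟩
  by_cases h1 : i = 0 ∧ 1 ≤ j
  · obtain ⟨rfl, h1⟩ := h1
    obtain ⟨l, rfl⟩ : ∃ l, j = l + 1 := ⟨j - 1, by omega⟩
    obtain ⟨x, hx, c, h2, h3, h4⟩ := zig l hj
    exact ⟨x, hx, c, h2, h3, by rw [h4, hG.zero, mul_one]⟩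
  by_cases h2 : i = r ∧ j < q
  · obtain ⟨rfl, h2⟩ := h2
    obtain ⟨x, hx, c, h3, h4, h5⟩ := zig j h2
    refine ⟨x, hx, c, by rwa [← Nat.succ_mul], h4, ?_⟩
    rw [h5, pow_succ, pow_succ' (G (i + 1))]
    group
  have hir : (i : ℝ) ≤ r := by exact_mod_cast hi
  have hjq : (j : ℝ) ≤ q := by exact_mod_cast hj
  have hr0 : (0 : ℝ) ≤ r := r.cast_nonneg
  have hgap : InGap (lastPoint r q) (j * r + i) (j * r + i + 1 / 2) :=
    ⟨.inr (by push_cast; linarith), .inr (by push_cast; linarith)⟩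
  have hx1 : (j * r + i + 1 / 2 : ℝ) < lastPoint r q := by
    rw [cast_lastPoint]
    nlinarith
  -- The remaining gaps lie before the first point, between two points of one ray, or just before
  -- the centre. There the height is constant.
  have hx : height r q (j * r + i + 1 / 2) = j := by
    rcases Nat.lt_or_ge i r with h3 | h3
    · have h4 : ((i + 1 : ℕ) : ℝ) ≤ r := by exact_mod_cast h3
      push_cast at h4
      rcases Nat.eq_zero_or_pos i with h5 | h5
      · obtain rfl : j = 0 := by omega
        rw [height_of_le (by push_cast; linarith)]
        simp
      · have h5 : (1 : ℝ) ≤ i := by exact_mod_cast h5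
        exact height_plateau hj (by linarith) (by linarith)
    · obtain rfl : i = r := by omega
      obtain rfl : j = q := by omega
      exact height_top D.q_eq (by linarith)
  have hjx : j = 0 ∨ (j : ℝ) * r + 1 ≤ j * r + i + 1 / 2 := by
    rcases Nat.eq_zero_or_pos j with h3 | h3
    · exact .inl h3
    · have h4 : (1 : ℝ) ≤ i := by exact_mod_cast (by omega : 1 ≤ i)
      exact .inr (by linarith)
  have hgap' : InGap (r + 1) i (j * r + i + 1 / 2 - r * j) :=
    ⟨.inr (by linarith), .inr (by linarith)⟩
  obtain ⟨hz, c, hc, hc'⟩ := (reach_lower_plateau D hG hj (by positivity) hx1 hgap.notMem hx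
    hjx).bigonClass (reach_upper_plateau D hG (by omega) hj (by positivity) hx1 hgap.notMem hx
    hjx hgap')
  refine ⟨_, hz, c, hgap, hc, ?_⟩
  rw [hc']
  group

end Chains

/-! ### The image of the model loops of the snake -/

theorem IsHolonomy.cast {X : Type*} [TopologicalSpace X] {x₀ : X} {L : Set X} {a b a' b' : X}
    {p : Path a b} {g : LeftPi X x₀} (h : IsHolonomy x₀ L p g) (ha : a' = a) (hb : b' = b) :
    IsHolonomy x₀ L (p.cast ha hb) g := by
  subst ha hb
  exact h

theorem Bigon.holonomy_loop_cast {X : Type*} [TopologicalSpace X] {x₀ : X} {L U : Set X}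
    (B : Bigon x₀ L U) {y : X} (hy : x₀ = y) {p : Path y y} {g : LeftPi X x₀}
    (h : IsHolonomy x₀ L p g) : g = cls (p.cast hy hy) := by
  subst hy
  exact B.holonomy_loop h

theorem Bigon.holonomy_linePath {X : Type*} [TopologicalSpace X] {x₀ : X} {L U : Set X}
    (B : Bigon x₀ L U) {f : C(ℝ, X)} {a b c : ℝ} {g g' : LeftPi X x₀}
    (h : IsHolonomy x₀ L (linePath f a b) g) (h' : IsHolonomy x₀ L (linePath f b c) g') :
    IsHolonomy x₀ L (linePath f a c) (g * g') :=
  Bigon.holonomy_homotopic (B.holonomy_trans h h') (linePath_trans f a b c)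

/-- The circle of radius `ε` around the last marked point. -/
def lastCircle {r : ℕ} {ε : ℝ} (h0 : 0 < ε) (h1 : ε < 1 / 2) : C(ℝ, MarkedPlane (r + 1)) :=
  ⟨fun θ => ⟨circleMap ((r + 1 : ℕ) : ℂ) ε θ, Set.mem_univ _, circleMap_notMem_marked h0 h1 θ⟩,
    (continuous_circleMap _ _).subtype_mk _⟩

section LastCircle

variable {r : ℕ} {ε : ℝ} {G : ℕ → LeftPi (MarkedPlane (r + 1)) (planeBase (r + 1))}

theorem im_lastCircle (h0 : 0 < ε) (h1 : ε < 1 / 2) (θ : ℝ) :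
    ((lastCircle (r := r) h0 h1 θ : MarkedPlane (r + 1)) : ℂ).im = ε * Real.sin θ := by
  have := im_circleMap_ofReal (r + 1 : ℕ) ε θ
  rwa [Complex.ofReal_natCast] at this

/-- In each turn the lower half circle has trivial holonomy, and the upper half circle leads from
the gap `r + 1` back to the gap `r`. -/
theorem holonomy_lastCircle (hG : IsGapFamily (r + 1) G) (h0 : 0 < ε) (h1 : ε < 1 / 2) (m : ℕ) :
    IsHolonomy (planeBase (r + 1)) (lowerPart _)
      (linePath (lastCircle h0 h1) Real.pi (Real.pi + m * (2 * Real.pi)))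
      ((G (r + 1) * (G r)⁻¹) ^ m) := by
  have B := bigon_plane (k := r + 1)
  have hp := Real.pi_pos
  induction m with
  | zero =>
    rw [pow_zero]
    refine B.holonomy_lower fun t => ?_
    change ((linePath (lastCircle (r := r) h0 h1) _ _ t : MarkedPlane (r + 1)) : ℂ).im ≤ 0
    rw [linePath_apply, im_lastCircle]
    simp
  | succ m ih =>
    rw [pow_succ]
    have hsin : ∀ θ, Real.sin (m * (2 * Real.pi) + θ) = Real.sin θ := fun θ => by
      rw [add_comm]
      exact Real.sin_add_nat_mul_two_pi θ m
    suffices h : IsHolonomy (planeBase (r + 1)) (lowerPart _) (linePath (lastCircle h0 h1)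
        (Real.pi + m * (2 * Real.pi)) (Real.pi + ((m + 1 : ℕ) : ℝ) * (2 * Real.pi)))
        (1 * (G (r + 1) * (G r)⁻¹)) by
      rw [one_mul] at h
      exact B.holonomy_linePath ih h
    refine B.holonomy_linePath (b := m * (2 * Real.pi) + 2 * Real.pi)
      (B.holonomy_lower fun t => ?_) (B.holonomy_upper (fun t => ?_) ?_ ?_)
    · change ((linePath (lastCircle (r := r) h0 h1) _ _ t : MarkedPlane (r + 1)) : ℂ).im ≤ 0
      rw [linePath_apply, im_lastCircle]
      have ht0 := t.2.1
      have ht1 := t.2.2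
      have e : Real.pi + m * (2 * Real.pi) + t * (m * (2 * Real.pi) + 2 * Real.pi -
          (Real.pi + m * (2 * Real.pi))) = m * (2 * Real.pi) + (t * Real.pi + Real.pi) := by ring
      rw [e, hsin, Real.sin_add_pi]
      have := Real.sin_nonneg_of_nonneg_of_le_pi (x := t * Real.pi) (by nlinarith) (by nlinarith)
      nlinarith
    · change 0 ≤ ((linePath (lastCircle (r := r) h0 h1) _ _ t : MarkedPlane (r + 1)) : ℂ).im
      rw [linePath_apply, im_lastCircle]
      have ht0 := t.2.1
      have ht1 := t.2.2
      have e : m * (2 * Real.pi) + 2 * Real.pi + t * (Real.pi + ((m + 1 : ℕ) : ℝ) * (2 * Real.pi) -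
          (m * (2 * Real.pi) + 2 * Real.pi)) =
          m * (2 * Real.pi) + (t * Real.pi + 2 * Real.pi) := by
        push_cast
        ring
      rw [e, hsin, Real.sin_add_two_pi]
      have := Real.sin_nonneg_of_nonneg_of_le_pi (x := t * Real.pi) (by nlinarith) (by nlinarith)
      positivity
    · have hx : InGap (r + 1) (r + 1) (r + 1 + ε) := ⟨.inr (by push_cast; linarith), .inl le_rfl⟩
      have := hG (r + 1) le_rfl _ hx
      convert this using 1
      apply Subtype.ext
      change circleMap ((r + 1 : ℕ) : ℂ) ε _ = _
      have e : m * (2 * Real.pi) + 2 * Real.pi = 0 + ((m + 1 : ℕ) : ℝ) * (2 * Real.pi) := by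
        push_cast
        ring
      rw [e, (periodic_circleMap ((r + 1 : ℕ) : ℂ) ε).nat_mul (m + 1) 0]
      simp [circleMap]
    · have hx : InGap (r + 1) r (r + 1 - ε) :=
        ⟨.inr (by linarith), .inr (by linarith)⟩
      have := hG r (by omega) _ hx
      convert this using 1
      apply Subtype.ext
      change circleMap ((r + 1 : ℕ) : ℂ) ε _ = _
      rw [(periodic_circleMap ((r + 1 : ℕ) : ℂ) ε).nat_mul (m + 1) Real.pi, circleMap_pi]
      simp

end LastCircle

/-! ### Images of the generators -/

section SnakeLoops

variable {n r q : ℕ} {ε : ℝ} {G : ℕ → LeftPi (MarkedPlane (r + 1)) (planeBase (r + 1))}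

theorem snake_near (hq : r = 0 → q = 0) {u : ℂ} (h : ‖u‖ ≤ 1 / 2) :
    snake n r q u = ((‖u‖ ^ ((1 : ℝ) / n) : ℝ) : ℂ) *
      Complex.exp (-(2 * Real.pi * q / n * Complex.I)) * (u / ‖u‖) := by
  rw [snake, snakeRad_near hq h, height_near hq (by linarith), Complex.ofReal_natCast]

/-- Near the centre the snake is a rotation by a multiple of `2π / n` composed with the radial
`n`-th root; the power map undoes both. -/
theorem snake_pow_near (hn : n ≠ 0) (hq : r = 0 → q = 0) {u : ℂ} (h : ‖u‖ ≤ 1 / 2) :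
    snake n r q u ^ n = ‖u‖ * (u / ‖u‖) ^ n := by
  have hn' : (n : ℂ) ≠ 0 := by exact_mod_cast hn
  have h1 : Complex.exp (-(2 * Real.pi * q / n * Complex.I)) ^ n = 1 := by
    rw [← Complex.exp_nat_mul, Complex.exp_eq_one_iff]
    refine ⟨-q, ?_⟩
    push_cast
    field_simp
  rw [snake_near hq h, mul_pow, mul_pow, h1, mul_one, ← Complex.ofReal_pow,
    ← Real.rpow_mul_natCast (norm_nonneg u), one_div, inv_mul_cancel₀ (by exact_mod_cast hn),
    Real.rpow_one]

/-- The radius is kept and the angle, counted from the leftmost point, is multiplied by `n`; this is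
where the exponent `n` of the last generator comes from. -/
theorem theta_circle (D : SnakeData n r q ε) (τ : ℝ) :
    theta n r q (circleMap (lastPoint r q : ℂ) ε (Real.pi + τ)) =
      circleMap ((r + 1 : ℕ) : ℂ) ε (Real.pi + n * τ) := by
  have hε := D.ε_pos
  have hε' := D.ε_le'.1
  have h1 : (lastPoint r q : ℂ) - circleMap (lastPoint r q : ℂ) ε (Real.pi + τ) =
      ε * Complex.exp (τ * Complex.I) := by
    simp only [circleMap, Complex.ofReal_add, add_mul, Complex.exp_add, Complex.exp_pi_mul_I]
    ring
  have h2 : ‖(ε : ℂ) * Complex.exp (τ * Complex.I)‖ = ε := by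
    rw [norm_mul, Complex.norm_exp_ofReal_mul_I, mul_one, Complex.norm_real,
      Real.norm_of_nonneg hε.le]
  rw [theta, h1, snake_pow_near D.n_ne D.q_eq (by rw [h2]; linarith), h2,
    mul_div_cancel_left₀ _ (by exact_mod_cast hε.ne' : (ε : ℂ) ≠ 0), ← Complex.exp_nat_mul]
  simp only [circleMap, Complex.ofReal_add, add_mul, Complex.exp_add, Complex.exp_pi_mul_I,
    Complex.ofReal_mul, Complex.ofReal_natCast, mul_assoc]
  ring

theorem SnakeData.ε_lt (D : SnakeData n r q ε) : ε < 1 / 2 := by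
  linarith [D.ε_le'.1]

/-- The image of the model loop around the point number `i + 1` of the sheet number `j`. -/
theorem push_snake_loop (D : SnakeData n r q ε) (hG : IsGapFamily (r + 1) G) {i j : ℕ}
    (hi : i < r) (hj : j ≤ q) (P : Path D.base D.base)
    (hP : ∀ t, (P t : ℂ) = modelLoop ε (i + r * j) t) :
    push (thetaMap D) D.thetaMap_base (cls P) =
      conjBy (G (i + 1) * (G i)⁻¹) ((G (r + 1) * (G r)⁻¹) ^ j) := by
  obtain ⟨x, hx, c, h1, h2, h3⟩ := exists_snake_gapClass D hG hi.le hj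
  obtain ⟨y, hy, d, h4, h5, h6⟩ := exists_snake_gapClass D hG (i := i + 1) hi hj
  have hlt : i + r * j < lastPoint r q := by
    have := Nat.mul_le_mul_left r hj
    rw [lastPoint]
    nlinarith
  have e : j * r + i = i + r * j := by ring
  rw [e] at h1
  rw [← add_assoc, e] at h4
  have := cls_modelLoop convex_stadium (zero_mem_stadium_diff D.ε_pos.le)
    (fun i hi => ball_subset_stadium hi) D.ε_pos D.ε_lt _ hlt (bigon_stadium D.ε_pos) P hP rfl rfl
    h1 h4 h2 h5
  refine (congrArg _ this).trans ?_
  rw [map_mul, map_inv, h3, h6, conjBy]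
  -- The factors `G (r + 1) ^ j` of the two consecutive gap classes have cancelled; what is left on
  -- both sides is a power of the last generator.
  have e2 : G (r + 1) * (G r)⁻¹ = (G r * (G (r + 1))⁻¹)⁻¹ := by group
  rw [e2, inv_pow, inv_inv]
  group

/-- The image of the model loop around the last point. -/
theorem push_snake_last (D : SnakeData n r q ε) (hG : IsGapFamily (r + 1) G)
    (P : Path D.base D.base) (hP : ∀ t, (P t : ℂ) = modelLoop ε ((q + 1) * r) t) :
    push (thetaMap D) D.thetaMap_base (cls P) = (G (r + 1) * (G r)⁻¹) ^ n := by
  have hε := D.ε_pos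
  have hε' := D.ε_lt
  have hlast : ((q + 1) * r + 1 : ℕ) = lastPoint r q := rfl
  obtain ⟨a, p, c, hp, hc, rfl⟩ := exists_modelLoop_decomposition convex_stadium
    (zero_mem_stadium_diff hε.le) (k := lastPoint r q) (fun i hi => ball_subset_stadium hi) hε hε'
    ((q + 1) * r) (Nat.lt_succ_self _) P hP
  have hcast := cast_lastPoint (r := r) (q := q)
  have hr0 : (0 : ℝ) ≤ r := r.cast_nonneg
  have hq0 : (0 : ℝ) ≤ q := q.cast_nonneg
  have hqr := mul_nonneg hq0 hr0
  have ha : (a : ℂ) = ((lastPoint r q - ε : ℝ) : ℂ) := by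
    have := hc 0
    rw [Path.source] at this
    rw [this, hlast]
    simp [circleMap_pi]
  obtain ⟨a, haM⟩ := a
  obtain rfl : a = ((lastPoint r q - ε : ℝ) : ℂ) := ha
  have hjx : q = 0 ∨ (q : ℝ) * r + 1 ≤ lastPoint r q - ε := by
    rcases Nat.eq_zero_or_pos q with h | h
    · exact .inl h
    · have : (1 : ℝ) ≤ r := by exact_mod_cast pos_of_lt D.q_eq h
      right
      linarith
  obtain ⟨hz, p', hp', hA⟩ := reach_lower_plateau D hG le_rfl (x := lastPoint r q - ε)
    (by linarith) (by linarith) haM.2 (height_top D.q_eq (by linarith)) hjx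
  rw [signPart_neg_one] at hp'
  have hpp : p'.Homotopic p := (bigon_stadium hε).lower.path_homotopic hp' hp
  have hA := Bigon.holonomy_homotopic hA (hpp.map (thetaMap D))
  have B := bigon_plane (k := r + 1)
  have e1 : ∀ τ, thetaMap D (c τ) = lastCircle hε hε' (Real.pi + τ * (n * (2 * Real.pi))) :=
    fun τ => by
    apply Subtype.ext
    change theta n r q (c τ) = circleMap ((r + 1 : ℕ) : ℂ) ε _
    rw [hc, hlast, theta_circle D]
    congr 1
    ring
  have hs := e1 0
  have ht := e1 1
  simp only [Path.source, Path.target, Set.Icc.coe_zero, Set.Icc.coe_one, zero_mul, one_mul,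
    add_zero] at hs ht
  have hcmap : c.map (thetaMap D).continuous =
      (linePath (lastCircle hε hε') Real.pi (Real.pi + n * (2 * Real.pi))).cast hs ht := by
    ext τ
    rw [Path.cast_coe, linePath_apply, add_sub_cancel_left]
    exact congrArg Subtype.val (e1 τ)
  have hC : IsHolonomy (planeBase (r + 1)) (lowerPart _) (c.map (thetaMap D).continuous)
      ((G (r + 1) * (G r)⁻¹) ^ n) := by
    rw [hcmap]
    exact (holonomy_lastCircle hG hε hε' n).cast hs ht
  have := B.holonomy_loop_cast D.thetaMap_base.symm
    (B.holonomy_trans (B.holonomy_trans hA hC) (Bigon.holonomy_symm hA))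
  rw [push_cls]
  have e3 : ((p.trans c).trans p.symm).map (thetaMap D).continuous =
      ((p.map (thetaMap D).continuous).trans (c.map (thetaMap D).continuous)).trans
        (p.map (thetaMap D).continuous).symm := by
    rw [Path.map_trans, Path.map_trans, Path.map_symm]
  rw [e3, ← this]
  -- The approach has as holonomy a power of the same element as the circle, so the conjugation has
  -- no effect.
  have e2 : G r * (G (r + 1))⁻¹ = (G (r + 1) * (G r)⁻¹)⁻¹ := by group
  rw [e2]
  generalize G (r + 1) * (G r)⁻¹ = x
  group

end SnakeLoops

/-! ### The plane as a neighbourhood of a diagram -/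

theorem exists_modelLoop {ε : ℝ} {k : ℕ} (h0 : 0 < ε) (h1 : ε < 1 / 2) {i : ℕ} (hi : i < k) :
    ∃ P : Path (⟨0, zero_mem_stadium_diff h0.le⟩ : ↥(stadium ε k \ marked k))
      ⟨0, zero_mem_stadium_diff h0.le⟩, ∀ t, (P t : ℂ) = modelLoop ε i t :=
  ⟨(modelLoop ε i).codRestrict (modelLoop_mem convex_stadium (zero_mem_stadium h0.le)
    (fun _ h => ball_subset_stadium h) h0 h1 i hi), fun _ => rfl⟩

namespace DiagramSystem

variable {A : Set ℂ} {x₀ : ℂ} {k : ℕ} (D : DiagramSystem A x₀ k)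

/-- An injective map of the plane onto a neighbourhood of the diagram. -/
def plane (z : ℂ) : ℂ := D.emb (squeeze k D.ε z)

theorem continuous_plane : Continuous D.plane :=
  D.continuousOn.comp_continuous continuous_squeeze (squeeze_mem D.ε_pos)

theorem plane_injective : Function.Injective D.plane := fun _ _ h =>
  squeeze_injective D.ε_pos (D.injOn (squeeze_mem D.ε_pos _) (squeeze_mem D.ε_pos _) h)

theorem plane_natCast {j : ℕ} (hj : j ≤ k) : D.plane j = D.emb j := by
  rw [plane, squeeze_natCast hj]

theorem plane_zero : D.plane 0 = x₀ := by
  have := D.plane_natCast (Nat.zero_le k)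
  rwa [Nat.cast_zero, D.emb_zero] at this

theorem natCast_mem_stadium {j : ℕ} (hj : j ≤ k) : (j : ℂ) ∈ stadium D.ε k := by
  have := ofReal_mem_stadium (k := k) D.ε_pos.le j.cast_nonneg
    (by exact_mod_cast hj : ((j : ℕ) : ℝ) ≤ k)
  simpa using this

theorem mem_iff {a : ℂ} : a ∈ A ↔ ∃ z ∈ marked k, D.emb z = a := by
  constructor
  · intro h
    obtain ⟨i, rfl⟩ := D.range_points.ge h
    exact ⟨_, ⟨i, rfl⟩, rfl⟩
  · rintro ⟨_, ⟨i, rfl⟩, rfl⟩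
    exact D.range_points.le ⟨i, rfl⟩

theorem emb_notMem {z : ℂ} (hz : z ∈ stadium D.ε k \ marked k) : D.emb z ∉ A := by
  rw [D.mem_iff]
  rintro ⟨w, hw, h⟩
  have hw' : w ∈ stadium D.ε k := by
    obtain ⟨j, -, h2, rfl⟩ := mem_marked.1 hw
    exact D.natCast_mem_stadium h2
  exact hz.2 (D.injOn hw' hz.1 h ▸ hw)

/-- The embedding, as a map to the complement of the points. -/
def embMap : C(↥(stadium D.ε k \ marked k), ↥Aᶜ) where
  toFun z := ⟨D.emb z, D.emb_notMem z.2⟩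
  continuous_toFun := by
    refine Continuous.subtype_mk ?_ _
    exact D.continuousOn.comp_continuous continuous_subtype_val fun z => z.2.1

/-- The squeezing map, on the complement of the marked points. -/
def squeezeMap : C(MarkedPlane k, ↥(stadium D.ε k \ marked k)) where
  toFun z := ⟨squeeze k D.ε z, squeeze_mem D.ε_pos _, fun h => z.2.2 (squeeze_mem_marked D.ε_pos h)⟩
  continuous_toFun := (continuous_squeeze.comp continuous_subtype_val).subtype_mk _

theorem squeezeMap_base :
    D.squeezeMap (planeBase k) = ⟨0, zero_mem_stadium_diff D.ε_pos.le⟩ := by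
  have := squeeze_natCast (ε := D.ε) (Nat.zero_le k)
  rw [Nat.cast_zero] at this
  exact Subtype.ext this

/-- The map of the plane, on the complement of the marked points. -/
def planeMap : C(MarkedPlane k, ↥Aᶜ) := D.embMap.comp D.squeezeMap

/-- Squeezing preserves the half planes and the gaps, so it takes gap classes of the plane to gap
classes of the stadium, where the formula for model loops applies. -/
theorem push_planeMap {y₀ : ↥Aᶜ} (hy : D.planeMap (planeBase k) = y₀)
    {G : ℕ → LeftPi (MarkedPlane k) (planeBase k)} (hG : IsGapFamily k G) {i : ℕ} (hi : i < k)
    (p : Path y₀ y₀) (hp : ∀ t, (p t : ℂ) = D.emb (modelLoop D.ε i t)) :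
    push D.planeMap hy (G (i + 1) * (G i)⁻¹) = cls p := by
  obtain ⟨P, hP⟩ := exists_modelLoop D.ε_pos D.ε_lt hi
  have hy' : D.embMap ⟨0, zero_mem_stadium_diff D.ε_pos.le⟩ = y₀ := by
    rw [← D.squeezeMap_base]
    exact hy
  have hclass : ∀ m ≤ k, ∃ x : ℝ, ∃ hx : (x : ℂ) ∈ stadium D.ε k \ marked k, InGap k m x ∧
      IsBigonClass _ (lowerPart _) (upperPart _) ⟨x, hx⟩
        (push D.squeezeMap D.squeezeMap_base (G m)) := by
    intro m hm
    have hgap : InGap k m (m + 1 / 2) := ⟨.inr (by linarith), .inr (by linarith)⟩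
    have h := (hG m hm _ hgap).push D.squeezeMap_base (L' := lowerPart _) (U' := upperPart _)
      (fun z hz => squeeze_im_nonpos D.ε_pos hz) fun z hz => squeeze_im_nonneg D.ε_pos hz
    have e : squeeze k D.ε ((m + 1 / 2 : ℝ) : ℂ) = (squeezeRe k D.ε (m + 1 / 2) : ℝ) :=
      squeeze_ofReal _
    refine ⟨squeezeRe k D.ε (m + 1 / 2), e ▸ (D.squeezeMap ⟨_, Set.mem_univ _, hgap.notMem⟩).2,
      hgap.squeezeRe D.ε_pos hm, ?_⟩
    convert h using 1
    exact Subtype.ext e.symm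
  obtain ⟨x, hx, h1, h2⟩ := hclass i hi.le
  obtain ⟨y, hy, h3, h4⟩ := hclass (i + 1) hi
  have := cls_modelLoop convex_stadium (zero_mem_stadium_diff D.ε_pos.le)
    (fun i hi => ball_subset_stadium hi) D.ε_pos D.ε_lt i hi (bigon_stadium D.ε_pos) P hP rfl rfl
    h1 h3 h2 h4
  rw [← push_eq_cls D.embMap hy' P p fun t => Subtype.ext (by rw [hp, ← hP]; rfl), this,
    ← map_inv, ← map_mul, push_push]
  rfl

/-- The loops of a diagram system. -/
theorem exists_loop {i : ℕ} (hi : i < k) {y₀ : ↥Aᶜ} (hy : (y₀ : ℂ) = x₀) :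
    ∃ p : Path y₀ y₀, ∀ t, (p t : ℂ) = D.emb (modelLoop D.ε i t) := by
  obtain ⟨P, hP⟩ := exists_modelLoop D.ε_pos D.ε_lt hi
  have : y₀ = D.embMap ⟨0, zero_mem_stadium_diff D.ε_pos.le⟩ :=
    Subtype.ext (hy.trans D.emb_zero.symm)
  exact ⟨(P.map D.embMap.continuous).cast this this, fun t => by rw [← hP]; rfl⟩

end DiagramSystem

/-! ### The meridian of the origin -/

/-- A conjugate is trivial only if the loop itself is. -/
theorem homotopic_refl_of_hol_eq_one {X : Type*} [TopologicalSpace X] {x a : X} {c : Path x a}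
    {p : Path a a} (h : hol c p c = 1) : p.Homotopic (Path.refl a) := by
  rw [← hol_refl_self c] at h
  unfold hol at h
  rw [cls_eq_iff, ← Path.Homotopic.Quotient.eq] at h
  simp only [Path.Homotopic.Quotient.mk_trans, Path.Homotopic.Quotient.mk_symm,
    Path.Homotopic.Quotient.mk_refl, Path.Homotopic.Quotient.trans_refl,
    Path.Homotopic.Quotient.trans_symm] at h
  rw [← Path.Homotopic.Quotient.eq, Path.Homotopic.Quotient.mk_refl]
  have := congrArg (fun z => Path.Homotopic.Quotient.trans
    (Path.Homotopic.Quotient.trans (Path.Homotopic.Quotient.symm (Path.Homotopic.Quotient.mk c)) z)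
    (Path.Homotopic.Quotient.mk c)) h
  simp only [Path.Homotopic.Quotient.trans_assoc, Path.Homotopic.Quotient.symm_trans,
    Path.Homotopic.Quotient.trans_refl] at this
  rw [← Path.Homotopic.Quotient.trans_assoc, Path.Homotopic.Quotient.symm_trans,
    Path.Homotopic.Quotient.refl_trans] at this
  exact this

/-- A circle around `0` is not contractible in the complement of `0`. -/
theorem not_homotopic_refl_of_circle {ρ : ℝ} (hρ : 0 < ρ) {x : {z : ℂ // z ≠ 0}} {β : Path x x}
    (hβ : ∀ t, (β t : ℂ) = circleLoop 0 ρ t) : ¬ β.Homotopic (Path.refl x) := by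
  intro h
  have key : ∀ τ : ℝ, Complex.exp (Real.log ρ + τ * Complex.I) = circleMap 0 ρ τ := fun τ => by
    rw [Complex.exp_add, ← Complex.ofReal_exp, Real.exp_log hρ]
    simp [circleMap]
  let e : ℂ := Real.log ρ + Real.pi * Complex.I
  have h0 : x = ⟨Complex.exp e, Complex.exp_ne_zero e⟩ := by
    have := hβ 0
    rw [Path.source, circleLoop_apply, Set.Icc.coe_zero, zero_mul, add_zero] at this
    exact Subtype.ext (this.trans (key Real.pi).symm)
  have h1 : (β : C(unitInterval, {z : ℂ // z ≠ 0})) 0 = ⟨Complex.exp e, Complex.exp_ne_zero e⟩ :=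
    β.source.trans h0
  have h2 : (Path.refl x : C(unitInterval, {z : ℂ // z ≠ 0})) 0 =
    ⟨Complex.exp e, Complex.exp_ne_zero e⟩ := h0
  have hend := Complex.isCoveringMap_exp.liftPath_apply_one_eq_of_homotopicRel h e h1 h2
  -- The lift of the circle through `exp` ends `2πi` above its start, whereas the lift of the
  -- constant path does not move; homotopic paths would have lifts with the same end.
  have hl1 := (Complex.isCoveringMap_exp.eq_liftPath_iff h1 (Γ := fun t =>
    Real.log ρ + ((Real.pi + t * (2 * Real.pi) : ℝ) : ℂ) * Complex.I)).2 ⟨by fun_prop, ?_, ?_⟩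
  · have hl2 := (Complex.isCoveringMap_exp.eq_liftPath_iff h2 (Γ := fun _ => e)).2
      ⟨by fun_prop, funext fun _ => h0.symm, rfl⟩
    have := congrArg Complex.im ((congrFun hl1 1).trans (hend.trans (congrFun hl2 1).symm))
    simp [e] at this
  · ext t
    simp only [Function.comp_apply]
    rw [key]
    exact (circleLoop_apply 0 ρ t).symm.trans (hβ t).symm
  · simp [e]

/-- The inclusion of the complement of a set that contains `0`. -/
def toNonzero {A : Set ℂ} (h : (0 : ℂ) ∈ A) : C(↥Aᶜ, {z : ℂ // z ≠ 0}) where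
  toFun z := ⟨z, fun hz => z.2 (hz ▸ h)⟩
  continuous_toFun := by fun_prop

/-- In the plane without `0` a meridian of `0` is a conjugate of a circle around `0`. -/
theorem IsMeridian.push_ne_one {A : Set ℂ} {x₀ : ↥Aᶜ} {g : PiOne A x₀} (h : IsMeridian 0 g) :
    push (toNonzero h.1) rfl g ≠ 1 := by
  obtain ⟨h0, ρ, hρ, -, q, α, β, hβ, rfl⟩ := h
  intro h
  have h := (push_hol (toNonzero h0) rfl α β α).symm.trans h
  exact not_homotopic_refl_of_circle hρ (β := β.map (toNonzero h0).continuous) hβ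
    (homotopic_refl_of_hol_eq_one h)

/-- The geometric generator of a point other than `0` is trivial in the complement of `0`. -/
theorem DiagramSystem.push_loop_eq_one {A : Set ℂ} {x₀ : ↥Aᶜ} {k : ℕ}
    (D : DiagramSystem A (x₀ : ℂ) k) (h0 : (0 : ℂ) ∈ A) {i : ℕ} (hi : i < k)
    (hne : D.emb ((i + 1 : ℕ) : ℂ) ≠ 0)
    (p : Path x₀ x₀) (hp : ∀ t, (p t : ℂ) = D.emb (modelLoop D.ε i t)) :
    push (toNonzero h0) rfl (cls p) = 1 := by
  obtain ⟨P, hP⟩ := exists_modelLoop D.ε_pos D.ε_lt hi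
  have hy' : D.embMap ⟨0, zero_mem_stadium_diff D.ε_pos.le⟩ = x₀ := Subtype.ext D.emb_zero
  rw [← push_eq_cls D.embMap hy' P p fun t => Subtype.ext (by rw [hp, ← hP]; rfl), push_push]
  obtain ⟨a, α, β, -, hβ, rfl⟩ := exists_modelLoop_decomposition convex_stadium
    (zero_mem_stadium_diff D.ε_pos.le) (fun i hi => ball_subset_stadium hi) D.ε_pos D.ε_lt i hi P hP
  refine (push_hol _ _ α β α).trans ?_
  -- The point `0` of `A` is the image of a marked point, and `i + 1` is the only one in this disk.
  -- Its image therefore misses `0` and fills in the loop.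
  have hK : ∀ z ∈ Metric.closedBall ((i + 1 : ℕ) : ℂ) D.ε, D.emb z ≠ 0 := by
    intro z hz hz0
    obtain ⟨w, hw, hw0⟩ := D.mem_iff.1 h0
    have hw' : w ∈ stadium D.ε k := by
      obtain ⟨j, -, h2, rfl⟩ := mem_marked.1 hw
      exact D.natCast_mem_stadium h2
    obtain rfl := D.injOn (ball_subset_stadium hi hz) hw' (hz0.trans hw0.symm)
    rw [Metric.mem_closedBall, dist_eq_norm] at hz
    have := D.ε_lt
    by_cases h : 0 < ‖z - (i + 1 : ℕ)‖
    · exact notMem_marked_of_norm_sub h (by linarith) hw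
    · rw [norm_pos_iff, not_not, sub_eq_zero] at h
      exact hne (h ▸ hw0)
  let f : C(Metric.closedBall ((i + 1 : ℕ) : ℂ) D.ε, {z : ℂ // z ≠ 0}) :=
    ⟨fun z => ⟨D.emb z, hK z z.2⟩, (D.continuousOn.comp_continuous continuous_subtype_val
      fun z => ball_subset_stadium hi z.2).subtype_mk _⟩
  have hβ' : ∀ t, (β t : ℂ) ∈ Metric.closedBall ((i + 1 : ℕ) : ℂ) D.ε := fun t => by
    rw [hβ]
    exact circleMap_mem_closedBall _ D.ε_pos.le _
  have ha : (a : ℂ) ∈ Metric.closedBall ((i + 1 : ℕ) : ℂ) D.ε := by simpa using hβ' 0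
  let β' : Path (⟨a, ha⟩ : Metric.closedBall ((i + 1 : ℕ) : ℂ) D.ε) ⟨a, ha⟩ :=
    ⟨⟨fun t => ⟨β t, hβ' t⟩, by fun_prop⟩, by simp, by simp⟩
  have : ContractibleSpace (Metric.closedBall ((i + 1 : ℕ) : ℂ) D.ε) :=
    (convex_closedBall _ _).contractibleSpace ⟨_, ha⟩
  have hh := (SimplyConnectedSpace.paths_homotopic β' (Path.refl _)).map f
  refine (hol_congr (.refl _) (p' := Path.refl _) ?_ (.refl _)).trans (hol_refl_self _)
  exact hh

/-- Otherwise the last generator would become trivial in the complement of `0`, which a meridian of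
`0` does not. -/
theorem emb_last_eq_zero {r : ℕ} {A : Set ℂ} {x₀ : ↥Aᶜ} (D : DiagramSystem A (x₀ : ℂ) (r + 1))
    (p : Path x₀ x₀) (hp : ∀ t, (p t : ℂ) = D.emb (modelLoop D.ε r t))
    (h : IsMeridian 0 (loopClass p)) : D.emb ((r + 1 : ℕ) : ℂ) = 0 := by
  by_contra hne
  exact h.push_ne_one (D.push_loop_eq_one h.1 (Nat.lt_succ_self r) hne p hp)

/-! ### Roots of maps of the plane -/

/-- An injective map `F u = u * exp (h u)` of the plane lifts through the power map. -/
theorem exists_root_map {F h : ℂ → ℂ} {n : ℕ} (hn : n ≠ 0) (hF : Continuous F)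
    (hinj : Function.Injective F) (hF0 : F 0 = 0) (hh : ContinuousOn h {0}ᶜ)
    (hFh : ∀ u, u ≠ 0 → F u = u * Complex.exp (h u)) {s w₀ : ℂ} (hw₀ : w₀ ≠ 0)
    (hs : s ^ n = F (w₀ ^ n)) :
    ∃ (Φ : ℂ → ℂ) (ω : ℂ), Continuous Φ ∧ Function.Injective Φ ∧ Φ 0 = 0 ∧ Φ w₀ = s ∧ ω ≠ 0 ∧
      (∀ w, Φ w ^ n = F (w ^ n)) ∧ ∀ w, w ≠ 0 → Φ w = ω * w * Complex.exp (h (w ^ n) / n) := by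
  have hnc : (n : ℂ) ≠ 0 := by exact_mod_cast hn
  have hexp : ∀ z : ℂ, Complex.exp (z / n) ^ n = Complex.exp z := fun z => by
    rw [← Complex.exp_nat_mul, mul_div_cancel₀ _ hnc]
  have hc0 : w₀ * Complex.exp (h (w₀ ^ n) / n) ≠ 0 := mul_ne_zero hw₀ (Complex.exp_ne_zero _)
  -- The lift is determined up to a root of unity; this one sends `w₀` to the prescribed base point
  -- `s`.
  let ω : ℂ := s / (w₀ * Complex.exp (h (w₀ ^ n) / n))
  have hω : ω ^ n = 1 := by
    rw [div_pow, hs, mul_pow, hexp, hFh _ (pow_ne_zero n hw₀), div_self]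
    exact mul_ne_zero (pow_ne_zero n hw₀) (Complex.exp_ne_zero _)
  have hω0 : ω ≠ 0 := fun h => by
    rw [h, zero_pow hn] at hω
    exact zero_ne_one hω
  let Φ : ℂ → ℂ := fun w => ω * w * Complex.exp (h (w ^ n) / n)
  have hΦ0 : Φ 0 = 0 := by simp [Φ]
  have hpow : ∀ w, Φ w ^ n = F (w ^ n) := fun w => by
    rcases eq_or_ne w 0 with rfl | hw
    · rw [hΦ0, zero_pow hn, hF0]
    · simp only [Φ]
      rw [mul_pow, mul_pow, hω, one_mul, hexp, hFh _ (pow_ne_zero n hw)]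
  refine ⟨Φ, ω, ?_, ?_, hΦ0, ?_, hω0, hpow, fun _ _ => rfl⟩
  · rw [continuous_iff_continuousAt]
    intro w
    rcases eq_or_ne w 0 with rfl | hw
    · rw [ContinuousAt, hΦ0, tendsto_zero_iff_norm_tendsto_zero]
      -- Nothing is known of `h` near `0`, but the norm of the lift is the `n`-th root of that of `F
      -- (w ^ n)`.
      have h1 : Continuous fun w : ℂ => ‖F (w ^ n)‖ ^ ((1 : ℝ) / n) :=
        Continuous.rpow_const (by fun_prop) fun _ => .inr (by positivity)
      have h2 := h1.tendsto 0
      simp only [zero_pow hn, hF0, norm_zero] at h2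
      rw [Real.zero_rpow (by positivity)] at h2
      refine h2.congr fun w => ?_
      rw [← hpow, norm_pow, one_div, Real.pow_rpow_inv_natCast (norm_nonneg _) hn]
    · have h1 : ContinuousAt (fun w : ℂ => h (w ^ n)) w :=
        ContinuousAt.comp (f := fun w : ℂ => w ^ n) (g := h)
          (hh.continuousAt (isOpen_compl_singleton.mem_nhds (pow_ne_zero n hw)))
          (by fun_prop)
      exact (continuousAt_const.mul continuousAt_id).mul (h1.div_const _).cexp
  · intro w w' hww
    have h1 : w ^ n = w' ^ n := hinj (by rw [← hpow, ← hpow, hww])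
    simp only [Φ] at hww
    rw [h1] at hww
    exact mul_left_cancel₀ hω0 (mul_right_cancel₀ (Complex.exp_ne_zero _) hww)
  · simp only [Φ, ω]
    rw [mul_assoc, div_mul_cancel₀ _ hc0]

/-- The orientation is given on the circle of radius `ε` before squeezing, but needed on the unit
circle after it. Convex combinations of the two curves avoid the centre, so the turning number is
the same. -/
theorem DiagramSystem.turnsOnce_plane {r : ℕ} {A : Set ℂ} {x₀ : ℂ}
    (D : DiagramSystem A x₀ (r + 1)) (h0 : D.emb ((r + 1 : ℕ) : ℂ) = 0) :
    TurnsOnce fun τ => D.plane ((r + 1 : ℕ) - circleMap 0 1 τ) := by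
  have hball : ∀ τ, circleMap ((r + 1 : ℕ) : ℂ) D.ε τ ∈ stadium D.ε (r + 1) := fun τ =>
    ball_subset_stadium (Nat.lt_succ_self r) (circleMap_mem_closedBall _ D.ε_pos.le τ)
  have hmem : ∀ a τ, (1 - clampOne a : ℝ) • circleMap ((r + 1 : ℕ) : ℂ) D.ε τ +
      clampOne a • squeeze (r + 1) D.ε (circleMap ((r + 1 : ℕ) : ℂ) 1 τ) ∈ stadium D.ε (r + 1) :=
    fun a τ => convex_stadium (hball τ) (squeeze_mem D.ε_pos _)
      (sub_nonneg.2 (clampOne_le_one a)) (clampOne_nonneg a) (by ring)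
  have hinj : ∀ z ∈ stadium D.ε (r + 1), z ≠ (r + 1 : ℕ) → D.emb z ≠ 0 := fun z hz hne h =>
    hne (D.injOn hz (D.natCast_mem_stadium le_rfl) (h.trans h0.symm))
  have hcirc : ∀ τ, circleMap ((r + 1 : ℕ) : ℂ) D.ε τ ≠ (r + 1 : ℕ) := fun τ =>
    circleMap_ne_center D.ε_pos.ne'
  have hccw : TurnsOnceAround (fun t => D.emb (circleLoop ((r + 1 : ℕ) : ℂ) D.ε t))
    (D.emb ((r + 1 : ℕ) : ℂ)) := D.ccw (Fin.last r)
  rw [h0, turnsOnceAround_iff (D.continuousOn.comp_continuous (continuous_circleMap _ _) hball)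
    fun τ => hinj _ (hball τ) (hcirc τ)] at hccw
  simp only [sub_zero] at hccw
  have hH := TurnsOnce.of_homotopy (a := 0) (b := 1) (H := fun x : ℝ × ℝ =>
    D.emb ((1 - clampOne x.1 : ℝ) • circleMap ((r + 1 : ℕ) : ℂ) D.ε x.2 +
      clampOne x.1 • squeeze (r + 1) D.ε (circleMap ((r + 1 : ℕ) : ℂ) 1 x.2))) ?_ ?_ ?_ ?_
  · have := hH.shift Real.pi
    convert this using 2 with τ
    rw [DiagramSystem.plane, clampOne_of_ge le_rfl, sub_self, zero_smul, one_smul, zero_add]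
    congr 2
    simp only [circleMap, Complex.ofReal_add, add_mul, Complex.exp_add, Complex.exp_pi_mul_I]
    push_cast
    ring
  · have := continuous_clampOne
    have := continuous_squeeze (k := r + 1) (ε := D.ε)
    have := continuous_circleMap ((r + 1 : ℕ) : ℂ) D.ε
    have := continuous_circleMap ((r + 1 : ℕ) : ℂ) 1
    exact D.continuousOn.comp_continuous (by fun_prop) fun x => hmem _ _
  · exact fun x => hinj _ (hmem _ _)
      (squeeze_convexComb_ne D.ε_pos (clampOne_nonneg _) (clampOne_le_one _) _)
  · intro a τ
    simp only [(periodic_circleMap ((r + 1 : ℕ) : ℂ) _) τ]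
  · simpa [clampOne_of_le] using hccw

/-! ### The diagram system of the covering -/

section Cover

variable {n r q : ℕ} {ε : ℝ} {B : Set ℂ} {t₀ : ℂ}

theorem theta_lastPoint (hn : n ≠ 0) : theta n r q (lastPoint r q) = ((r + 1 : ℕ) : ℂ) := by
  rw [theta, sub_self, snake_zero, zero_pow hn, sub_zero]

theorem theta_natCast (S : SnakeData n r q ε) {i j : ℕ} (hi : 1 ≤ i) (hir : i ≤ r) (hj : j ≤ q) :
    theta n r q ((j * r + i : ℕ) : ℂ) = i := by
  have h1 : (1 : ℝ) ≤ i := by exact_mod_cast hi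
  have h2 : (i : ℝ) ≤ r := by exact_mod_cast hir
  have h3 : (j : ℝ) ≤ q := by exact_mod_cast hj
  have h4 : ((j * r + i : ℕ) : ℝ) < lastPoint r q := by
    rw [cast_lastPoint]
    push_cast
    nlinarith
  have h5 : height r q ((j * r + i : ℕ) : ℝ) = j :=
    height_plateau hj (by push_cast; linarith) (by push_cast; linarith)
  have := theta_ofReal S.n_ne S.q_eq h4 h5
  rw [Complex.ofReal_natCast] at this
  rw [this]
  push_cast
  ring

/-- A marked point of the snake is the last one, or the point number `i` of a sheet. -/
theorem eq_lastPoint_or {m : ℕ} (h1 : 1 ≤ m) (h2 : m ≤ lastPoint r q) :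
    m = lastPoint r q ∨ ∃ i j, 1 ≤ i ∧ i ≤ r ∧ j ≤ q ∧ m = j * r + i := by
  rcases h2.eq_or_lt with h | h
  · exact .inl h
  right
  have h3 : m - 1 < (q + 1) * r := by
    rw [lastPoint] at h
    omega
  have hr : 0 < r := Nat.pos_of_ne_zero fun h => by simp [h] at h3
  refine ⟨(m - 1) % r + 1, (m - 1) / r, by omega, Nat.mod_lt _ hr, ?_, ?_⟩
  · exact Nat.lt_succ_iff.1 ((Nat.div_lt_iff_lt_mul hr).2 h3)
  · have := Nat.div_add_mod' (m - 1) r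
    omega

theorem theta_mem_marked (S : SnakeData n r q ε) {z : ℂ} (hz : z ∈ marked (lastPoint r q)) :
    theta n r q z ∈ marked (r + 1) := by
  obtain ⟨m, h1, h2, rfl⟩ := mem_marked.1 hz
  rw [mem_marked]
  rcases eq_lastPoint_or h1 h2 with rfl | ⟨i, j, hi, hir, hj, rfl⟩
  · exact ⟨r + 1, by omega, le_rfl, theta_lastPoint S.n_ne⟩
  · exact ⟨i, hi, by omega, theta_natCast S hi hir hj⟩

/-- The points of the snake at a given place of the sheets differ by the roots of unity. -/
theorem exists_snake_eq (S : SnakeData n r q ε) (hqn : 0 < r → q + 1 = n) {i : ℕ} (hi : 1 ≤ i)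
    (hir : i ≤ r) {v : ℂ} (hv : v ^ n = ((r + 1 - i : ℝ) : ℂ)) :
    ∃ z ∈ marked (lastPoint r q), snake n r q (lastPoint r q - z) = v := by
  have hn := S.n_ne
  have : NeZero n := ⟨hn⟩
  have hnc : (n : ℂ) ≠ 0 := by exact_mod_cast hn
  have h2 : (i : ℝ) ≤ r := by exact_mod_cast hir
  have hpos : (0 : ℝ) < r + 1 - i := by linarith
  set w : ℂ := (((r + 1 - i : ℝ) ^ ((1 : ℝ) / n) : ℝ) : ℂ) with hw
  have hwn : w ^ n = ((r + 1 - i : ℝ) : ℂ) := by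
    rw [hw, ← Complex.ofReal_pow, one_div, Real.rpow_inv_natCast_pow hpos.le hn]
  have hv0 : v ≠ 0 := fun h => by
    rw [h, zero_pow hn] at hv
    exact hpos.ne (by exact_mod_cast hv)
  have hζ : (w / v) ^ n = 1 := by
    rw [div_pow, hwn, hv, div_self]
    exact_mod_cast hpos.ne'
  -- The inverse ratio is used because the sheets follow one another clockwise; the exponent of the
  -- primitive root is the number of the ray.
  obtain ⟨j, hj, hj'⟩ := (Complex.isPrimitiveRoot_exp n hn).eq_pow_of_pow_eq_one hζ
  have hjq : j ≤ q := by
    have := hqn (by omega)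
    omega
  refine ⟨((j * r + i : ℕ) : ℂ), mem_marked.2 ⟨_, by omega, ?_, rfl⟩, ?_⟩
  · have := Nat.mul_le_mul_right r hjq
    rw [lastPoint]
    nlinarith
  · have := (snake_natCast (n := n) hn hi hir hjq).2.2
    rw [← hw] at this
    push_cast at this ⊢
    rw [this, Complex.exp_neg]
    rw [← Complex.exp_nat_mul] at hj'
    have e : (2 * Real.pi * j / n * Complex.I : ℂ) = j * (2 * Real.pi * Complex.I / n) := by
      field_simp
    rw [e, hj', inv_div, mul_div_cancel₀]
    rintro h
    rw [h, zero_pow hn] at hwn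
    exact hpos.ne (by exact_mod_cast hwn)

variable {Φ h : ℂ → ℂ} {ω : ℂ}

theorem emb_pow (D : DiagramSystem B t₀ (r + 1))
    (hpow : ∀ w, Φ w ^ n = D.plane ((r + 1 : ℕ) - w ^ n)) (z : ℂ) :
    Φ (snake n r q (lastPoint r q - z)) ^ n = D.plane (theta n r q z) := by
  rw [hpow, theta]

/-- If `z ^ n` is the point `i` of `B`, then `z = ζ * Φ w` with `w` the real root and `ζ ^ n = 1`.
Since `Φ` depends on `w` only through the factor `w` and through `w ^ n`, this is `Φ (ζ * w)`, and
`ζ * w` is a marked value of the snake. The point `0` comes from the centre. -/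
theorem range_cover (S : SnakeData n r q ε) (hqn : 0 < r → q + 1 = n)
    (D : DiagramSystem B t₀ (r + 1)) (hlast : D.emb ((r + 1 : ℕ) : ℂ) = 0)
    (hpow : ∀ w, Φ w ^ n = D.plane ((r + 1 : ℕ) - w ^ n)) (hΦ0 : Φ 0 = 0)
    (hΦ : ∀ w, w ≠ 0 → Φ w = ω * w * Complex.exp (h (w ^ n) / n)) :
    (fun z => Φ (snake n r q (lastPoint r q - z))) '' marked (lastPoint r q) =
      powPreimage n B := by
  have hn := S.n_ne
  have hB : ∀ {a}, a ∈ B ↔ ∃ z ∈ marked (r + 1), D.plane z = a := by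
    intro a
    rw [D.mem_iff]
    refine exists_congr fun z => and_congr_right fun hz => ?_
    obtain ⟨j, -, hj, rfl⟩ := mem_marked.1 hz
    rw [D.plane_natCast hj]
  apply Set.Subset.antisymm
  · rintro _ ⟨z, hz, rfl⟩
    refine hB.2 ⟨_, theta_mem_marked S hz, (emb_pow D hpow z).symm⟩
  · intro z hz
    obtain ⟨i', hi', hi⟩ := hB.1 (show z ^ n ∈ B from hz)
    obtain ⟨i, hi1, hi2, rfl⟩ := mem_marked.1 hi'
    rcases hi2.eq_or_lt with rfl | hi2
    · rw [D.plane_natCast le_rfl, hlast] at hi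
      refine ⟨lastPoint r q, mem_marked.2 ⟨_, by simp [lastPoint], le_rfl, rfl⟩, ?_⟩
      simp only [sub_self, snake_zero, hΦ0]
      exact (pow_eq_zero_iff hn).1 hi.symm |>.symm
    · have h2 : (i : ℝ) + 1 ≤ r + 1 := by exact_mod_cast hi2
      have hpos : (0 : ℝ) < r + 1 - i := by linarith
      set w : ℂ := (((r + 1 - i : ℝ) ^ ((1 : ℝ) / n) : ℝ) : ℂ) with hw
      have hwn : w ^ n = ((r + 1 - i : ℝ) : ℂ) := by
        rw [hw, ← Complex.ofReal_pow, one_div, Real.rpow_inv_natCast_pow hpos.le hn]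
      have hw0 : w ≠ 0 := fun h => by
        rw [h, zero_pow hn] at hwn
        exact hpos.ne (by exact_mod_cast hwn)
      have hzw : z ^ n = Φ w ^ n := by
        rw [hpow, hwn, ← hi]
        congr 1
        push_cast
        ring
      by_cases hΦw : Φ w = 0
      · rw [hΦw, zero_pow hn] at hzw
        rw [hzw, ← hlast, ← D.plane_natCast le_rfl] at hi
        have := D.plane_injective hi
        have : i = r + 1 := by exact_mod_cast this
        omega
      · have hζ : (z / Φ w) ^ n = 1 := by
          rw [div_pow, hzw, div_self (pow_ne_zero n hΦw)]
        have hζ0 : z / Φ w ≠ 0 := fun h => by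
          rw [h, zero_pow hn] at hζ
          exact zero_ne_one hζ
        obtain ⟨y, hy, hy'⟩ := exists_snake_eq S hqn hi1 (Nat.lt_succ_iff.1 hi2)
          (v := z / Φ w * w) (by rw [mul_pow, hζ, one_mul, hwn])
        refine ⟨y, hy, ?_⟩
        simp only
        rw [hy', hΦ _ (mul_ne_zero hζ0 hw0), mul_pow, hζ, one_mul]
        have : ω * (z / Φ w * w) * Complex.exp (h (w ^ n) / n) = z / Φ w * Φ w := by
          rw [hΦ w hw0]
          ring
        rw [this, div_mul_cancel₀ _ hΦw]

/-- Near the centre the snake takes the circle to `c * exp (i τ)`. Then `log (ω * c) + i τ + h (…) /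
n` is an explicit logarithm, and its last term is periodic. -/
theorem turnsOnce_cover_last (S : SnakeData n r q ε) (hh : ContinuousOn h {0}ᶜ) (hω : ω ≠ 0)
    (hΦ : ∀ w, w ≠ 0 → Φ w = ω * w * Complex.exp (h (w ^ n) / n)) :
    TurnsOnce fun τ => Φ (snake n r q (lastPoint r q - circleMap (lastPoint r q : ℂ) ε τ)) := by
  have hε := S.ε_pos
  have hε' := S.ε_le'.1
  have hεc : (ε : ℂ) ≠ 0 := by exact_mod_cast hε.ne'
  let c : ℂ := -(((ε ^ ((1 : ℝ) / n) : ℝ) : ℂ) * Complex.exp (-(2 * Real.pi * q / n * Complex.I)))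
  have hc : c ≠ 0 := neg_ne_zero.2 (mul_ne_zero (by exact_mod_cast (Real.rpow_pos_of_pos hε _).ne')
    (Complex.exp_ne_zero _))
  have hu : ∀ τ : ℝ, snake n r q (lastPoint r q - circleMap (lastPoint r q : ℂ) ε τ) =
      c * Complex.exp (τ * Complex.I) := fun τ => by
    have h1 : (lastPoint r q : ℂ) - circleMap (lastPoint r q : ℂ) ε τ =
        ε * -Complex.exp (τ * Complex.I) := by
      simp only [circleMap]
      ring
    have h2 : ‖(ε : ℂ) * -Complex.exp (τ * Complex.I)‖ = ε := by
      rw [norm_mul, norm_neg, Complex.norm_exp_ofReal_mul_I, mul_one, Complex.norm_real,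
        Real.norm_of_nonneg hε.le]
    rw [h1, snake_near S.q_eq (by rw [h2]; linarith), h2, mul_div_cancel_left₀ _ hεc]
    simp only [c]
    ring
  have hne : ∀ τ : ℝ, c * Complex.exp (τ * Complex.I) ≠ 0 := fun τ =>
    mul_ne_zero hc (Complex.exp_ne_zero _)
  refine ⟨fun τ => Complex.log (ω * c) + τ * Complex.I +
    h ((c * Complex.exp (τ * Complex.I)) ^ n) / n, ?_, fun τ => ?_, fun τ => ?_⟩
  · have : Continuous fun τ : ℝ => h ((c * Complex.exp (τ * Complex.I)) ^ n) :=
      hh.comp_continuous (by fun_prop) fun τ => pow_ne_zero n (hne τ)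
    exact (by fun_prop : Continuous fun τ : ℝ => Complex.log (ω * c) + τ * Complex.I).add
      (this.div_const _)
  · beta_reduce
    rw [hu, hΦ _ (hne τ), Complex.exp_add, Complex.exp_add, Complex.exp_log (mul_ne_zero hω hc)]
    ring
  · have : Complex.exp (((τ + 2 * Real.pi : ℝ) : ℂ) * Complex.I) = Complex.exp (τ * Complex.I) := by
      push_cast
      rw [add_mul, Complex.exp_periodic]
    beta_reduce
    rw [this]
    push_cast
    ring

/-- The centre of the circle slides along the axis from the last marked point to `m`; injectivity
keeps the difference nonzero, so the turning number is constant. -/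
theorem turnsOnce_cover (S : SnakeData n r q ε) {f : ℂ → ℂ}
    (hf : ContinuousOn f (stadium ε (lastPoint r q)))
    (hinj : Set.InjOn f (stadium ε (lastPoint r q)))
    (hlast : TurnsOnce fun τ => f (circleMap (lastPoint r q : ℂ) ε τ) - f (lastPoint r q)) {m : ℕ}
    (hm : m ≤ lastPoint r q) : TurnsOnce fun τ => f (circleMap (m : ℂ) ε τ) - f m := by
  have hε := S.ε_pos
  have hmem : ∀ x τ, circleMap (clampTo (lastPoint r q) x : ℂ) ε τ ∈ stadium ε (lastPoint r q) :=
    fun x τ => mem_stadium (clampTo_mem x).1 (clampTo_mem x).2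
      (circleMap_mem_closedBall _ hε.le τ)
  have hmem' : ∀ x, (clampTo (lastPoint r q) x : ℂ) ∈ stadium ε (lastPoint r q) :=
    fun x => ofReal_mem_stadium hε.le (clampTo_mem x).1 (clampTo_mem x).2
  have hc : Continuous (clampTo (lastPoint r q)) := by
    unfold clampTo
    fun_prop
  have hnat : ∀ m ≤ lastPoint r q, clampTo (lastPoint r q) m = m := fun m hm =>
    clampTo_of_mem m.cast_nonneg (by exact_mod_cast hm)
  have := TurnsOnce.of_homotopy (a := lastPoint r q) (b := m) (H := fun x : ℝ × ℝ =>
    f (circleMap (clampTo (lastPoint r q) x.1 : ℂ) ε x.2) - f (clampTo (lastPoint r q) x.1)) ?_ ?_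
    ?_ ?_
  · simpa only [hnat m hm, Complex.ofReal_natCast] using this
  · refine (hf.comp_continuous ?_ fun x => hmem _ _).sub (hf.comp_continuous (by fun_prop)
      fun x => hmem' _)
    unfold circleMap
    fun_prop
  · intro x
    refine sub_ne_zero.2 fun h => ?_
    exact circleMap_ne_center hε.ne' (hinj (hmem _ _) (hmem' _) h)
  · intro a τ
    simp only [(periodic_circleMap _ ε) τ]
  · simpa only [hnat _ le_rfl, Complex.ofReal_natCast] using hlast

/-- The diagram system of the covering `t ↦ t ^ n`. -/
theorem exists_cover_diagram (S : SnakeData n r q ε) (hqn : 0 < r → q + 1 = n)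
    (D : DiagramSystem B t₀ (r + 1)) (hlast : D.emb ((r + 1 : ℕ) : ℂ) = 0) {s : ℂ}
    (hs : s ^ n = t₀) :
    ∃ D' : DiagramSystem (powPreimage n B) s (lastPoint r q), D'.ε = ε ∧
      ∀ z, D'.emb z ^ n = D.plane (theta n r q z) := by
  have hn := S.n_ne
  have hE := D.continuous_plane
  have hplast : D.plane ((r + 1 : ℕ) - 0) = 0 := by
    rw [sub_zero, D.plane_natCast le_rfl, hlast]
  have hFinj : Function.Injective fun u => D.plane ((r + 1 : ℕ) - u) := fun u v huv =>
    sub_right_injective (D.plane_injective huv)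
  obtain ⟨h, hh, hFh⟩ := exists_eq_mul_exp (F := fun u => D.plane ((r + 1 : ℕ) - u))
    (by fun_prop) (fun u hu h0 => hu (hFinj (h0.trans hplast.symm))) one_pos
    (D.turnsOnce_plane hlast)
  have hcast := cast_lastPoint (r := r) (q := q)
  have hp : (0 : ℝ) < lastPoint r q := by
    rw [hcast]
    positivity
  have hdom0 := mem_snakeDom_ofReal (n := n) (r := r) hp.le
  rw [Complex.ofReal_natCast] at hdom0
  have hw₀ : snake n r q (lastPoint r q) ≠ 0 :=
    snake_ne_zero hn S.q_eq hdom0 (by exact_mod_cast hp.ne')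
  have htheta := S.theta_zero
  rw [theta, sub_zero] at htheta
  obtain ⟨Φ, ω, hΦc, hΦi, hΦ0, hΦs, hω, hpow, hΦ⟩ := exists_root_map hn
    (by fun_prop : Continuous fun u => D.plane ((r + 1 : ℕ) - u)) hFinj hplast hh hFh hw₀
    (s := s) (by rw [htheta, D.plane_zero, hs])
  let f : ℂ → ℂ := fun z => Φ (snake n r q (lastPoint r q - z))
  have hfc : ContinuousOn f (stadium ε (lastPoint r q)) :=
    hΦc.comp_continuousOn (continuousOn_snake_sub S)
  have hfi : Set.InjOn f (stadium ε (lastPoint r q)) := fun z hz w hw hzw =>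
    sub_right_injective (snake_injOn hn S.q_eq S.q_lt (S.sub_mem hz) (S.sub_mem hw) (hΦi hzw))
  have hf0 : f (lastPoint r q) = 0 := by simp only [f, sub_self, snake_zero, hΦ0]
  have hrange := range_cover S hqn D hlast hpow hΦ0 hΦ
  refine ⟨⟨f, ε, S.ε_pos, S.ε_lt, hfc, hfi, ?_, ?_, fun i => ?_⟩, rfl, emb_pow D hpow⟩
  · simp only [f, sub_zero, hΦs]
  · rw [← hrange, marked, ← Set.range_comp]
    rfl
  · have hball := fun τ => ball_subset_stadium (ε := ε) i.2 (circleMap_mem_closedBall _ S.ε_pos.le τ)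
    have hcen := ball_subset_stadium i.2 (Metric.mem_closedBall_self (x := (((i : ℕ) + 1 : ℕ) : ℂ))
      S.ε_pos.le)
    rw [turnsOnceAround_iff (hfc.comp_continuous (continuous_circleMap _ _) hball) fun τ hτ =>
      circleMap_ne_center S.ε_pos.ne' (hfi (hball τ) hcen hτ)]
    refine turnsOnce_cover S hfc hfi ?_ i.2
    rw [hf0]
    simpa only [sub_zero] using turnsOnce_cover_last S hh hω hΦ

end Cover

/-! ### The covering -/

theorem powHom_eq_push {n : ℕ} {A : Set ℂ} {s : ↥(powPreimage n A)ᶜ} (g : PiOne (powPreimage n A) s) :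
    powHom n A s g = push (powMap n A) rfl g := by
  obtain ⟨p, rfl⟩ := exists_cls_eq g
  rw [push_cls]
  rfl

/-- As `0` belongs to `A`, the power map restricts to a covering of the complement, and homotopies
lift. -/
theorem powHom_injective {n : ℕ} (hn : n ≠ 0) {A : Set ℂ} (h0 : (0 : ℂ) ∈ A)
    (s : ↥(powPreimage n A)ᶜ) : Function.Injective (powHom n A s) := by
  have hcov : IsCoveringMap (powMap n A) :=
    ((isCoveringMapOn_npow (𝕜 := ℂ) n (by exact_mod_cast hn)).mono
      (t := Aᶜ) fun z hz hz0 => hz (hz0 ▸ h0)).isCoveringMap_restrictPreimage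
  intro a b hab
  obtain ⟨p, rfl⟩ := exists_cls_eq a
  obtain ⟨p', rfl⟩ := exists_cls_eq b
  rw [powHom_eq_push, powHom_eq_push, push_cls, push_cls, cls_eq_iff] at hab
  rw [cls_eq_iff, ← Path.Homotopic.Quotient.eq]
  apply hcov.injective_path_homotopic_map s s
  exact Path.Homotopic.Quotient.eq.2 hab

/-- The image of a geometric generator of the covering. -/
theorem powHom_loop {n r q : ℕ} {ε : ℝ} {B : Set ℂ} {s : ↥(powPreimage n B)ᶜ}
    (S : SnakeData n r q ε) (D : DiagramSystem B (powMap n B s : ℂ) (r + 1)) {f : ℂ → ℂ}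
    (hf : ∀ z, f z ^ n = D.plane (theta n r q z))
    (hy : D.planeMap (planeBase (r + 1)) = powMap n B s) {m : ℕ}
    (P : Path S.base S.base) (hP : ∀ t, (P t : ℂ) = modelLoop ε m t)
    (p : Path s s) (hp : ∀ t, (p t : ℂ) = f (modelLoop ε m t)) :
    powHom n B s (loopClass p) =
      push D.planeMap hy (push (thetaMap S) S.thetaMap_base (cls P)) := by
  refine (powHom_eq_push (cls p)).trans ?_
  rw [push_push, push_cls]
  refine (push_eq_cls _ _ P _ fun t => ?_).symm
  apply Subtype.ext
  change (p t : ℂ) ^ n = D.plane (theta n r q (P t))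
  rw [hp, hP, hf]

end GeomBasis

/-! ### The theorem -/

open GeomBasis in
theorem mainTheorem10 (n r : ℕ) (hn : 1 ≤ n) (B : Finset ℂ) (hB0 : (0 : ℂ) ∈ B)
    (hBr : B.card = r + 1)
    (s : ((GeomBasis.powPreimage n (B : Set ℂ))ᶜ : Set ℂ))
    (γ : Fin (r + 1) → GeomBasis.PiOne (B : Set ℂ) (GeomBasis.powMap n (B : Set ℂ) s))
    (hγ : GeomBasis.IsGeometricBasis γ)
    (hmer : GeomBasis.IsMeridian (0 : ℂ) (γ (Fin.last r))) :
    Function.Injective (GeomBasis.powHom n (B : Set ℂ) s) ∧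
    ∃ δ : Fin (n * r + 1) → GeomBasis.PiOne (GeomBasis.powPreimage n (B : Set ℂ)) s,
      (∀ (j : Fin n) (i : Fin r),
        GeomBasis.powHom n (B : Set ℂ) s (δ (finProdFinEquiv (j, i)).castSucc) =
          GeomBasis.conjBy (γ i.castSucc) (γ (Fin.last r) ^ (j : ℕ))) ∧
      GeomBasis.powHom n (B : Set ℂ) s (δ (Fin.last (n * r))) = γ (Fin.last r) ^ n ∧
      GeomBasis.IsGeometricBasis δ := by
  have hn0 : n ≠ 0 := by omega
  refine ⟨powHom_injective hn0 hB0 s, ?_⟩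
  obtain ⟨D, hD⟩ := hγ
  choose p hp hγp using hD
  have hlast : D.emb ((r + 1 : ℕ) : ℂ) = 0 :=
    emb_last_eq_zero D (p (Fin.last r)) (hp (Fin.last r)) (hγp (Fin.last r) ▸ hmer)
  -- `q` is the number of the last ray, `n - 1` if there are points on the rays. For `r = 0` the
  -- snake goes straight to the centre, and `q = 0`.
  obtain ⟨q, hqn, hq0, hqlt⟩ : ∃ q, (0 < r → q + 1 = n) ∧ (r = 0 → q = 0) ∧ q < n := by
    rcases Nat.eq_zero_or_pos r with h | h
    · exact ⟨0, by omega, fun _ => rfl, by omega⟩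
    · exact ⟨n - 1, by omega, by omega, by omega⟩
  have hnr : (q + 1) * r = n * r := by
    rcases Nat.eq_zero_or_pos r with h | h
    · simp [h]
    · rw [hqn h]
  have hden : (0 : ℝ) < 8 * n * (r + 1) := by
    have : (0 : ℝ) < n := by exact_mod_cast hn
    positivity
  have S : SnakeData n r q (1 / (8 * n * (r + 1))) :=
    ⟨hn0, hq0, hqlt, one_div_pos.2 hden, (mul_one_div_cancel hden.ne').le⟩
  obtain ⟨D', hε, hemb⟩ := exists_cover_diagram S hqn D hlast (s := s) rfl
  obtain ⟨D', hε, hemb⟩ : ∃ D' : DiagramSystem (powPreimage n (B : Set ℂ)) (s : ℂ) (n * r + 1),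
      D'.ε = 1 / (8 * n * (r + 1)) ∧ ∀ z, D'.emb z ^ n = D.plane (theta n r q z) := by
    rw [← hnr]
    exact ⟨D', hε, hemb⟩
  have hloop : ∀ m : Fin (n * r + 1), ∃ p' : Path s s,
      ∀ t, (p' t : ℂ) = D'.emb (modelLoop D'.ε m t) := fun m => D'.exists_loop m.2 rfl
  choose p' hp' using hloop
  obtain ⟨G, hG⟩ := exists_gapFamily (r + 1)
  have hy : D.planeMap (planeBase (r + 1)) = powMap n B s := Subtype.ext D.plane_zero
  -- All generators are now images of model classes, so the computation with the gap family in the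
  -- model gives the result downstairs.
  have hpush : ∀ i : Fin (r + 1), push D.planeMap hy (G (i + 1) * (G i)⁻¹) = γ i := fun i =>
    (D.push_planeMap hy hG i.2 (p i) (hp i)).trans (hγp i).symm
  have hpow : ∀ m : Fin (n * r + 1), ∃ P : Path S.base S.base,
      (∀ t, (P t : ℂ) = modelLoop (1 / (8 * n * (r + 1))) m t) ∧
      powHom n (B : Set ℂ) s (loopClass (p' m)) =
        push D.planeMap hy (push (thetaMap S) S.thetaMap_base (cls P)) := fun m => by
    have hm : (m : ℕ) < lastPoint r q := by
      rw [lastPoint, hnr]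
      exact m.2
    obtain ⟨P, hP⟩ := exists_modelLoop S.ε_pos S.ε_lt hm
    refine ⟨P, hP, powHom_loop S D hemb hy P hP (p' m) fun t => ?_⟩
    rw [hp', hε]
  have hr := hpush (Fin.last r)
  refine ⟨fun m => loopClass (p' m), fun j i => ?_, ?_, D', fun m => ⟨p' m, hp' m, rfl⟩⟩
  · obtain ⟨P, hP, h⟩ := hpow (finProdFinEquiv (j, i)).castSucc
    have hj : (j : ℕ) ≤ q := by
      have := hqn (Fin.pos i)
      omega
    rw [h, push_snake_loop S hG i.2 hj P hP, conjBy, conjBy, map_mul, map_mul, map_inv, map_pow]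
    have hi := hpush i.castSucc
    simp only [Fin.val_last, Fin.val_castSucc] at hr hi
    rw [hr, hi]
  · obtain ⟨P, hP, h⟩ := hpow (Fin.last (n * r))
    simp only [Fin.val_last, ← hnr] at hP
    rw [h, push_snake_last S hG P hP, map_pow]
    simp only [Fin.val_last] at hr
    rw [hr]

end
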